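/- **Setting.** Let $h=h_{\bar 0}\oplus h_{\bar 1}$ be an orthogonal sum of two infinite-dimensional separable complex Hilbert spaces, $P_{\alpha}$ the orthogonal projection onto $h_\alpha$ and $\gamma=P_{\bar 0}-P_{\bar 1}$. Operators on $h$ are $\mathbf Z_2$-graded by giving $P_\alpha XP_\beta$ the degree $\alpha+\beta$, and $[X,Y]_s=XY-(-1)^{\deg X\deg Y}YX$ for homogeneous $X,Y$, extended bilinearly. Let $J$ be an antilinear isometry of $h$ with $J^2=1$ and $J\gamma=\gamma J$, and $P$ an orthogonal projection with $P\gamma=\gamma P$ and $JP=(1-P)J$. Put $q=P-\gamma(1-P)$ and $\tilde h=Ph$. For a bounded operator $X$ on $h$ let $\epsilon(X)=\sum_{\alpha,\beta\in\{0,1\}}(-1)^{\alpha\beta}P_\alpha XP_\beta$. $X$ is *self-dual* if $X=qJ\,\epsilon(X)^*\,qJ$, and $g_2$ is the set of bounded self-dual $X$ for which $PX(1-P)$ and $(1-P)XP$ are Hilbert–Schmidt. Let $\mathcal F=\mathcal F_B(\tilde h_{\bar 0})\otimes\mathcal F_F(\tilde h_{\bar 1})$, where $\tilde h_\alpha=P_\alpha\tilde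 h$, be the Fock space with vacuum $\Omega$, graded by the parity of the number of fermions, with creation operators $\hat a^\dagger(f)=\hat a_B^\dagger(P_{\bar0}f)\otimes 1+1\otimes\hat a_F^\dagger(P_{\bar1}f)$ and $\hat a(f)=\hat a^\dagger(f)^*$, $f\in\tilde h$. Let $\mathcal D\subset\mathcal F$ be the space of finite-particle vectors (vectors with components in finitely many particle-number sectors) and $\mathcal D_0\subset\mathcal D$ the linear span of the vectors $\hat a^\dagger(f_1)\cdots\hat a^\dagger(f_N)\Omega$, $N\ge 0$, $f_i\in\tilde h$. Put $\hat B^\dagger(f)=\hat a^\dagger(Pf)-\hat a(\gamma J(1-P)f)$ for $f\in h$. Let $\tilde J$ be any antilinear isometry of $\tilde h$ with $\tilde J^2=1$, $\tilde J\gamma=\gamma\tilde J$, and $(e_n)_{n\in\mathbf N}$ any orthonormal basis of $\tilde h$. For a bounded operator $Z$ on $\tilde h$ let $$Z\hat a^\dagger\hat a=\sum_n\hat a^\dagger(Ze_n)\hat a(e_n),\quad Z\hat a^\dagger\hat a^\dagger=\sum_n\hat a^\dagger(Ze_n)\hat a^\dagger(\tilde Je_n),\quad Z\hat a\hat a=\sum_n\hat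 a(\tilde JZe_n)\hat a(e_n),$$ $$\hat{d\Gamma}(X)=(PXP)\hat a^\dagger\hat a+\tfrac12(PXJ\tilde JP)\hat a^\dagger\hat a^\dagger-\tfrac12(\gamma\tilde JPJXP)\hat a\hat a ,$$ the series being taken in the norm of $\mathcal F$ at each vector of the domain. **Proposition 1.** Let $X$ be a bounded self-dual operator on $h$. The following are equivalent: (i) $X\in g_2$; (ii) the three series defining $\hat{d\Gamma}(X)$ converge at every vector of $\mathcal D$; (iii) they converge at every vector of $\mathcal D_0$ and define there a closable operator $\hat{d\Gamma}(X)$. For $X\in g_2$ the operator $\hat{d\Gamma}(X)$ maps $\mathcal D$ to $\mathcal D$ and does not depend on $\tilde J$ and $(e_n)$. For $X,Y\in g_2$ and $f\in h$ one has $[X,Y]_s\in g_2$ and, on $\mathcal D$, $$[\hat{d\Gamma}(X),\hat B^\dagger(f)]_s=\hat B^\dagger(Xf),\qquad [\hat{d\Gamma}(X),\hat{d\Gamma}(Y)]_s=\hat{d\Gamma}([X,Y]_s)-\tfrac12c(X,Y)\mathbf 1,$$ with the Schwinger term $$c(X,Y)=\mathrm{Str}\bigl((1-P)XPY-(-1)^{\deg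 X\deg Y}(1-P)YPX\bigr)$$ for homogeneous $X,Y$, extended bilinearly. Here $\mathrm{Str}(A)=\mathrm{Tr}(\gamma A)$, the trace being that of the diagonal part $P\gamma AP+(1-P)\gamma A(1-P)$, which is trace class here (it is the ordinary trace of $\gamma A$ when $A$ is trace class). -/

import Mathlib

open Filter Topology InnerProductSpace
open scoped ENNReal ComplexConjugate

noncomputable section

/-! ### Super algebra -/

/-- The part of degree `α` of `x`, in a ring of operators on a `ℤ/2`-graded space for which `p` is the
projection onto the even subspace: the block `x_{βδ}` has degree `β + δ`. -/
def homPart {R : Type*} [Ring R] (p : R) (α : Fin 2) (x : R) : R :=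
  if α = 0 then p * x * p + (1 - p) * x * (1 - p) else p * x * (1 - p) + (1 - p) * x * p

/-- The supercommutator, extended bilinearly from `x y - (-1)^{deg x · deg y} y x`. -/
def superComm {R : Type*} [Ring R] (p x y : R) : R :=
  ∑ α : Fin 2, ∑ β : Fin 2,
    (homPart p α x * homPart p β y
      - (-1) ^ (α.val * β.val) * (homPart p β y * homPart p α x))

/-! ### Hilbert–Schmidt operators and the trace -/

section Trace

variable {E : Type*} [NormedAddCommGroup E] [InnerProductSpace ℂ E]

/-- `∑ ‖T bᵢ‖² < ∞` for some (equivalently, any) orthonormal basis. -/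
def IsHilbertSchmidt (T : E →L[ℂ] E) : Prop :=
  ∃ (w : Set E) (b : HilbertBasis w ℂ E), Summable fun i => ‖T (b i)‖ ^ 2

/-- `T` has the Hilbert space trace `t`: the diagonal sum converges to `t` in every orthonormal
basis. -/
def HasTrace (T : E →L[ℂ] E) (t : ℂ) : Prop :=
  ∀ (w : Set E) (b : HilbertBasis w ℂ E), HasSum (fun i => ⟪b i, T (b i)⟫_ℂ) t

end Trace

/-! ### The Fock space `ℱ_B ⊗ ℱ_F` in the occupation number representation -/

section Fock

variable {ι₀ ι₁ : Type*}

/-- Occupation numbers: arbitrary for the bosonic modes `ι₀`, zero or one for the fermionic modes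
`ι₁`. -/
abbrev Config (ι₀ ι₁ : Type*) := (ι₀ →₀ ℕ) × Finset ι₁

/-- `ℱ_B ⊗ ℱ_F`, with `ℱ_B = ℓ²(ι₀ →₀ ℕ)` and `ℱ_F = ℓ²(Finset ι₁)`. -/
abbrev Fock (ι₀ ι₁ : Type*) := lp (fun _ : Config ι₀ ι₁ => ℂ) 2

/-- The one-particle space in coordinates. -/
abbrev OnePart (ι₀ ι₁ : Type*) := lp (fun _ : ι₀ ⊕ ι₁ => ℂ) 2

namespace Config

/-- The number of particles. -/
def number (c : Config ι₀ ι₁) : ℕ := (c.1.sum fun _ k => k) + c.2.card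

/-- The occupied modes. -/
def occupied (c : Config ι₀ ι₁) : Finset (ι₀ ⊕ ι₁) := c.1.support.disjSum c.2

variable [LinearOrder ι₁]

/-- Remove one particle. -/
def lower (c : Config ι₀ ι₁) : ι₀ ⊕ ι₁ → Config ι₀ ι₁
  | Sum.inl i => (c.1 - Finsupp.single i 1, c.2)
  | Sum.inr j => (c.1, c.2.erase j)

/-- Add one particle. -/
def raise (c : Config ι₀ ι₁) : ι₀ ⊕ ι₁ → Config ι₀ ι₁
  | Sum.inl i => (c.1 + Finsupp.single i 1, c.2)
  | Sum.inr j => (c.1, insert j c.2)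

/-- The matrix element `⟨c | a†ᵢ | c.lower i⟩` for an occupied mode `i`. -/
def creAmp (c : Config ι₀ ι₁) : ι₀ ⊕ ι₁ → ℂ
  | Sum.inl i => (Real.sqrt (c.1 i) : ℂ)
  | Sum.inr j => (-1) ^ (c.2.filter (· < j)).card

/-- The matrix element `⟨c | aᵢ | c.raise i⟩`; it vanishes on an occupied fermionic mode. -/
def annAmp (c : Config ι₀ ι₁) : ι₀ ⊕ ι₁ → ℂ
  | Sum.inl i => (Real.sqrt (c.1 i + 1) : ℂ)
  | Sum.inr j => if j ∈ c.2 then 0 else (-1) ^ (c.2.filter (· < j)).card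

theorem mem_occupied_raise {c : Config ι₀ ι₁} {i : ι₀ ⊕ ι₁} : i ∈ (c.raise i).occupied := by
  rcases i with i | j <;> simp [occupied, raise]

theorem raise_lower {c : Config ι₀ ι₁} {i : ι₀ ⊕ ι₁} (hi : i ∈ c.occupied) :
    (c.lower i).raise i = c := by
  rcases i with i | j
  · have : c.1 i ≠ 0 := by simpa [occupied] using hi
    refine Prod.ext ?_ rfl
    ext k
    by_cases hk : i = k
    · subst hk; simp [raise, lower]; omega
    · simp [raise, lower, hk]
  · have : j ∈ c.2 := by simpa [occupied] using hi
    refine Prod.ext rfl ?_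
    simp [raise, lower, Finset.insert_erase this]

theorem lower_raise {c : Config ι₀ ι₁} {i : ι₀ ⊕ ι₁} (hi : c.annAmp i ≠ 0) :
    (c.raise i).lower i = c := by
  rcases i with i | j
  · refine Prod.ext ?_ rfl
    ext k
    simp [raise, lower]
  · have : j ∉ c.2 := by
      intro h; simp [annAmp, h] at hi
    refine Prod.ext rfl ?_
    simp [raise, lower, Finset.erase_insert this]

theorem number_raise {c : Config ι₀ ι₁} {i : ι₀ ⊕ ι₁} (hi : c.annAmp i ≠ 0) :
    (c.raise i).number = c.number + 1 := by
  classical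
  rcases i with i | j
  · simp only [raise, number]
    rw [Finsupp.sum_add_index' (by simp) (by simp)]
    simp; omega
  · have : j ∉ c.2 := by
      intro h; simp [annAmp, h] at hi
    simp [raise, number, Finset.card_insert_of_notMem this]; omega

theorem annAmp_lower {c : Config ι₀ ι₁} {i : ι₀ ⊕ ι₁} (hi : i ∈ c.occupied) :
    (c.lower i).annAmp i = c.creAmp i := by
  rcases i with i | j
  · have : c.1 i ≠ 0 := by simpa [occupied] using hi
    have h1 : ((c.1 i - 1 : ℕ) : ℝ) + 1 = c.1 i := by
      have : 1 ≤ c.1 i := by omega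
      push_cast [this]; ring
    simp [annAmp, lower, creAmp, h1]
  · have : j ∈ c.2 := by simpa [occupied] using hi
    have h2 : (c.2.erase j).filter (· < j) = c.2.filter (· < j) := by
      ext k; simp only [Finset.mem_filter, Finset.mem_erase]
      constructor
      · rintro ⟨⟨_, h⟩, h'⟩; exact ⟨h, h'⟩
      · rintro ⟨h, h'⟩; exact ⟨⟨h'.ne, h⟩, h'⟩
    simp [annAmp, lower, creAmp, h2]

theorem creAmp_ne_zero {c : Config ι₀ ι₁} {i : ι₀ ⊕ ι₁} (hi : i ∈ c.occupied) :
    c.creAmp i ≠ 0 := by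
  rcases i with i | j
  · have : c.1 i ≠ 0 := by simpa [occupied] using hi
    simp [creAmp, this]
  · simp [creAmp]

theorem number_lower {c : Config ι₀ ι₁} {i : ι₀ ⊕ ι₁} (hi : i ∈ c.occupied) :
    c.number = (c.lower i).number + 1 := by
  have h := number_raise (c := c.lower i) (i := i)
    (by rw [annAmp_lower hi]; exact creAmp_ne_zero hi)
  rwa [raise_lower hi] at h

theorem sum_creAmp_sq (c : Config ι₀ ι₁) :
    ∑ i ∈ c.occupied, ‖c.creAmp i‖ ^ 2 = c.number := by
  simp [occupied, Finset.sum_disjSum, creAmp, number, Finsupp.sum, abs_of_nonneg]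

end Config

variable (ι₀ ι₁) in
/-- The finite-particle vectors: all vectors of the Fock space with a bounded number of particles. -/
def finPart : Submodule ℂ (Fock ι₀ ι₁) where
  carrier := {φ | ∃ N : ℕ, ∀ c : Config ι₀ ι₁, N < c.number → φ c = 0}
  zero_mem' := ⟨0, fun _ _ => rfl⟩
  add_mem' := by
    rintro φ ψ ⟨N, hN⟩ ⟨M, hM⟩
    refine ⟨max N M, fun c hc => ?_⟩
    rw [lp.coeFn_add, Pi.add_apply, hN c (lt_of_le_of_lt (le_max_left _ _) hc),
      hM c (lt_of_le_of_lt (le_max_right _ _) hc), add_zero]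
  smul_mem' := by
    rintro a φ ⟨N, hN⟩
    refine ⟨N, fun c hc => ?_⟩
    rw [lp.coeFn_smul, Pi.smul_apply, hN c hc, smul_zero]

theorem summable_sq_lp {α : Type*} (f : lp (fun _ : α => ℂ) 2) :
    Summable fun i => ‖f i‖ ^ 2 := by
  simpa using (lp.memℓp f).summable (by norm_num)

theorem memℓp_two_of_summable_sq {α : Type*} {f : α → ℂ} (hf : Summable fun i => ‖f i‖ ^ 2) :
    Memℓp f 2 := memℓp_gen (by simpa using hf)

/-- The projection onto the even vectors, that is, those with an even number of fermions. -/
def fockEven : Module.End ℂ (finPart ι₀ ι₁) where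
  toFun φ := ⟨⟨fun c => if Even c.2.card then φ.1 c else 0,
    memℓp_two_of_summable_sq (by
      refine (summable_sq_lp φ.1).of_nonneg_of_le (fun _ => by positivity) fun c => ?_
      split_ifs <;> simp)⟩, by
    obtain ⟨N, hN⟩ := φ.2
    refine ⟨N, fun c hc => ?_⟩
    change (if Even c.2.card then φ.1 c else 0) = 0
    rw [hN c hc, ite_self]⟩
  map_add' φ ψ := by
    apply Subtype.ext; apply lp.ext; funext c
    change (if Even c.2.card then φ.1 c + ψ.1 c else 0)
      = (if Even c.2.card then φ.1 c else 0) + (if Even c.2.card then ψ.1 c else 0)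
    split_ifs <;> simp
  map_smul' a φ := by
    apply Subtype.ext; apply lp.ext; funext c
    change (if Even c.2.card then a * φ.1 c else 0) = a * (if Even c.2.card then φ.1 c else 0)
    split_ifs <;> simp

/-- The vacuum: no particles. -/
def vacuum : finPart ι₀ ι₁ :=
  ⟨⟨fun c => open Classical in if c = (0, ∅) then 1 else 0, by
    refine memℓp_two_of_summable_sq (summable_of_ne_finset_zero (s := {(0, ∅)}) fun c hc => ?_)
    simp at hc; simp [hc]⟩, by
    refine ⟨0, fun c hc => ?_⟩
    have : c ≠ (0, ∅) := by rintro rfl; simp [Config.number] at hc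
    change (open Classical in if c = (0, ∅) then (1 : ℂ) else 0) = 0
    simp [this]⟩

variable [LinearOrder ι₁]

/-- `a†(f) = ∑ fᵢ a†ᵢ` on functions of the occupation numbers. -/
def creFun (f : OnePart ι₀ ι₁) (φ : Config ι₀ ι₁ → ℂ) (c : Config ι₀ ι₁) : ℂ :=
  ∑ i ∈ c.occupied, c.creAmp i * f i * φ (c.lower i)

/-- `a(f) = ∑ conj fᵢ aᵢ` on functions of the occupation numbers. -/
def annFun (f : OnePart ι₀ ι₁) (φ : Config ι₀ ι₁ → ℂ) (c : Config ι₀ ι₁) : ℂ :=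
  ∑' i, c.annAmp i * conj (f i) * φ (c.raise i)

theorem norm_creFun_sq_le (f : OnePart ι₀ ι₁) (φ : Config ι₀ ι₁ → ℂ) (c : Config ι₀ ι₁) :
    ‖creFun f φ c‖ ^ 2 ≤ c.number * ∑ i ∈ c.occupied, (‖f i‖ * ‖φ (c.lower i)‖) ^ 2 := by
  rw [← Config.sum_creAmp_sq c]
  refine le_trans ?_ (Finset.sum_mul_sq_le_sq_mul_sq _ _ _)
  refine pow_le_pow_left₀ (norm_nonneg _) ?_ 2
  refine (norm_sum_le _ _).trans (Finset.sum_le_sum fun i _ => le_of_eq ?_)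
  rw [norm_mul, norm_mul, mul_assoc]

theorem creFun_eq_zero (f : OnePart ι₀ ι₁) {φ : Config ι₀ ι₁ → ℂ} {N : ℕ}
    (hN : ∀ c : Config ι₀ ι₁, N < c.number → φ c = 0) (c : Config ι₀ ι₁) (hc : N + 1 < c.number) :
    creFun f φ c = 0 := by
  refine Finset.sum_eq_zero fun i hi => ?_
  have := Config.number_lower hi
  rw [hN _ (by omega), mul_zero]

theorem summable_creFun (f : OnePart ι₀ ι₁) {φ : Config ι₀ ι₁ → ℂ}
    (hφ : Summable fun c => ‖φ c‖ ^ 2) :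
    Summable fun c : Config ι₀ ι₁ => ∑ i ∈ c.occupied, (‖f i‖ * ‖φ (c.lower i)‖) ^ 2 := by
  have h1 : Summable fun p : (ι₀ ⊕ ι₁) × Config ι₀ ι₁ => ‖f p.1‖ ^ 2 * ‖φ p.2‖ ^ 2 :=
    (summable_sq_lp f).mul_of_nonneg hφ (fun _ => sq_nonneg _) (fun _ => sq_nonneg _)
  let k : (Σ c : Config ι₀ ι₁, {i // i ∈ c.occupied}) → (ι₀ ⊕ ι₁) × Config ι₀ ι₁ :=
    fun p => (p.2.1, p.1.lower p.2.1)
  have hk : Function.Injective k := by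
    rintro ⟨c, i, hi⟩ ⟨d, j, hj⟩ h
    simp only [k, Prod.mk.injEq] at h
    obtain ⟨rfl, h⟩ := h
    have hcd : c = d := by rw [← Config.raise_lower hi, h, Config.raise_lower hj]
    subst hcd; rfl
  have h3 : Summable fun p : (Σ c : Config ι₀ ι₁, {i // i ∈ c.occupied}) =>
      (‖f p.2.1‖ * ‖φ (p.1.lower p.2.1)‖) ^ 2 := by
    refine (h1.comp_injective hk).congr fun p => ?_
    simp only [Function.comp_apply, k, mul_pow]
  refine h3.sigma.congr fun c => ?_
  rw [tsum_fintype]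
  exact Finset.sum_coe_sort c.occupied fun i => (‖f i‖ * ‖φ (c.lower i)‖) ^ 2

theorem creFun_memℓp (f : OnePart ι₀ ι₁) (φ : finPart ι₀ ι₁) : Memℓp (creFun f φ.1) 2 := by
  obtain ⟨⟨φ, hφ⟩, N, hN⟩ := φ
  have hs := summable_sq_lp ⟨φ, hφ⟩
  change ∀ c : Config ι₀ ι₁, N < c.number → φ c = 0 at hN
  change Memℓp (creFun f φ) 2
  apply memℓp_two_of_summable_sq
  refine ((summable_creFun f hs).mul_left ((N : ℝ) + 1)).of_nonneg_of_le
    (fun _ => sq_nonneg _) fun c => ?_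
  have h0 : 0 ≤ ∑ i ∈ c.occupied, (‖f i‖ * ‖φ (c.lower i)‖) ^ 2 :=
    Finset.sum_nonneg fun _ _ => sq_nonneg _
  have hN0 : (0 : ℝ) ≤ N + 1 := by positivity
  by_cases hc : c.number ≤ N + 1
  · have hc' : (c.number : ℝ) ≤ N + 1 := by exact_mod_cast hc
    exact (norm_creFun_sq_le f φ c).trans (mul_le_mul_of_nonneg_right hc' h0)
  · rw [creFun_eq_zero f hN c (by omega), norm_zero, zero_pow two_ne_zero]
    exact mul_nonneg hN0 h0

theorem creFun_finite (f : OnePart ι₀ ι₁) (φ : finPart ι₀ ι₁) :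
    ∃ N : ℕ, ∀ c : Config ι₀ ι₁, N < c.number → creFun f φ.1 c = 0 := by
  obtain ⟨N, hN⟩ := φ.2
  exact ⟨N + 1, creFun_eq_zero f hN⟩

/-- The creation operator `a†(f)` on the finite-particle vectors. -/
def cre (f : OnePart ι₀ ι₁) : Module.End ℂ (finPart ι₀ ι₁) where
  toFun φ := ⟨⟨creFun f φ.1, creFun_memℓp f φ⟩, creFun_finite f φ⟩
  map_add' φ ψ := by
    apply Subtype.ext; apply lp.ext; funext c
    change creFun f (φ.1 + ψ.1 : Fock ι₀ ι₁) c = creFun f φ.1 c + creFun f ψ.1 c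
    simp [creFun, mul_add, Finset.sum_add_distrib]
  map_smul' a φ := by
    apply Subtype.ext; apply lp.ext; funext c
    change creFun f (a • φ.1 : Fock ι₀ ι₁) c = a * creFun f φ.1 c
    simp only [creFun, lp.coeFn_smul, Pi.smul_apply, smul_eq_mul, Finset.mul_sum]
    exact Finset.sum_congr rfl fun i _ => by ring

theorem summable_annAmp (φ : finPart ι₀ ι₁) :
    Summable fun p : Config ι₀ ι₁ × (ι₀ ⊕ ι₁) => ‖p.1.annAmp p.2 * φ.1 (p.1.raise p.2)‖ ^ 2 := by
  obtain ⟨N, hN⟩ := φ.2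
  let k : (Σ c : Config ι₀ ι₁, {i // i ∈ c.occupied}) → Config ι₀ ι₁ × (ι₀ ⊕ ι₁) :=
    fun p => (p.1.lower p.2.1, p.2.1)
  have hk : Function.Injective k := by
    rintro ⟨c, i, hi⟩ ⟨d, j, hj⟩ h
    simp only [k, Prod.mk.injEq] at h
    obtain ⟨h, rfl⟩ := h
    have hcd : c = d := by rw [← Config.raise_lower hi, h, Config.raise_lower hj]
    subst hcd; rfl
  rw [← hk.summable_iff]
  · have h0 : ∀ p : (Σ c : Config ι₀ ι₁, {i // i ∈ c.occupied}),
        ((fun p : Config ι₀ ι₁ × (ι₀ ⊕ ι₁) => ‖p.1.annAmp p.2 * φ.1 (p.1.raise p.2)‖ ^ 2) ∘ k) p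
          = ‖p.1.creAmp p.2.1‖ ^ 2 * ‖φ.1 p.1‖ ^ 2 := by
      rintro ⟨c, i, hi⟩
      simp [k, Config.raise_lower hi, Config.annAmp_lower hi, mul_pow]
    rw [summable_congr h0, summable_sigma_of_nonneg (fun _ => by positivity)]
    refine ⟨fun c => Summable.of_finite, ?_⟩
    refine ((summable_sq_lp φ.1).mul_left (N : ℝ)).of_nonneg_of_le
      (fun _ => tsum_nonneg fun _ => by positivity) fun c => ?_
    have h5 : ∑' i : {i // i ∈ c.occupied}, ‖c.creAmp i.1‖ ^ 2 * ‖φ.1 c‖ ^ 2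
        = c.number * ‖φ.1 c‖ ^ 2 := by
      rw [tsum_fintype, ← Finset.sum_mul,
        Finset.sum_coe_sort c.occupied (fun i => ‖c.creAmp i‖ ^ 2), Config.sum_creAmp_sq]
    refine h5.le.trans ?_
    by_cases hc : c.number ≤ N
    · gcongr
    · rw [hN c (by omega)]; simp
  · rintro ⟨c, i⟩ hci
    by_cases h : c.annAmp i = 0
    · simp [h]
    · exact absurd ⟨⟨c.raise i, i, Config.mem_occupied_raise⟩, by
        simp [k, Config.lower_raise h]⟩ hci

/-- The components `i ↦ (aᵢ φ)(c)`. -/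
def annVec (φ : finPart ι₀ ι₁) (c : Config ι₀ ι₁) : OnePart ι₀ ι₁ :=
  ⟨fun i => c.annAmp i * φ.1 (c.raise i), memℓp_two_of_summable_sq
    (((summable_prod_of_nonneg (fun _ => by positivity)).1 (summable_annAmp φ)).1 c)⟩

theorem annFun_eq_inner (f : OnePart ι₀ ι₁) (φ : finPart ι₀ ι₁) (c : Config ι₀ ι₁) :
    annFun f φ.1 c = ⟪f, annVec φ c⟫_ℂ := by
  rw [lp.inner_eq_tsum]
  refine tsum_congr fun i => ?_
  simp [annVec]; ring

theorem annFun_memℓp (f : OnePart ι₀ ι₁) (φ : finPart ι₀ ι₁) : Memℓp (annFun f φ.1) 2 := by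
  apply memℓp_two_of_summable_sq
  have h := ((summable_prod_of_nonneg (fun _ => by positivity)).1 (summable_annAmp φ)).2
  refine (h.mul_left (‖f‖ ^ 2)).of_nonneg_of_le (fun _ => by positivity) fun c => ?_
  have h1 : ‖annVec φ c‖ ^ 2 = ∑' i, ‖c.annAmp i * φ.1 (c.raise i)‖ ^ 2 := by
    have := lp.norm_rpow_eq_tsum (p := 2) (by norm_num) (annVec φ c)
    simpa [annVec] using this
  rw [← h1, annFun_eq_inner, ← mul_pow]
  gcongr
  exact norm_inner_le_norm _ _

theorem annFun_finite (f : OnePart ι₀ ι₁) (φ : finPart ι₀ ι₁) :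
    ∃ N : ℕ, ∀ c : Config ι₀ ι₁, N < c.number → annFun f φ.1 c = 0 := by
  obtain ⟨N, hN⟩ := φ.2
  refine ⟨N, fun c hc => ?_⟩
  have : ∀ i, c.annAmp i * conj (f i) * φ.1 (c.raise i) = 0 := fun i => by
    by_cases h : c.annAmp i = 0
    · simp [h]
    · rw [hN _ (by rw [Config.number_raise h]; omega), mul_zero]
  simp [annFun, this]

/-- The annihilation operator `a(f) = a†(f)^*` on the finite-particle vectors. -/
def ann (f : OnePart ι₀ ι₁) : Module.End ℂ (finPart ι₀ ι₁) where
  toFun φ := ⟨⟨annFun f φ.1, annFun_memℓp f φ⟩, annFun_finite f φ⟩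
  map_add' φ ψ := by
    apply Subtype.ext; apply lp.ext; funext c
    change annFun f (φ + ψ : finPart ι₀ ι₁).1 c = annFun f φ.1 c + annFun f ψ.1 c
    rw [annFun_eq_inner, annFun_eq_inner, annFun_eq_inner, ← inner_add_right]
    congr 1
    apply lp.ext; funext i
    exact mul_add _ _ _
  map_smul' a φ := by
    apply Subtype.ext; apply lp.ext; funext c
    change annFun f (a • φ : finPart ι₀ ι₁).1 c = a * annFun f φ.1 c
    rw [annFun_eq_inner, annFun_eq_inner, ← inner_smul_right]
    congr 1
    apply lp.ext; funext i
    exact mul_left_comm _ _ _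

end Fock

/-! ### Neutral particles -/

/-- A complex separable Hilbert space `h = h₀ ⊕ h₁` (bosons and fermions, both of infinite
dimension) with an even conjugation `J` and an even orthogonal projection `P` such that
`J P = (1 - P) J`. The grading is given by the orthogonal projection `P₀` onto `h₀`. -/
structure NeutralSystem (h : Type*) [NormedAddCommGroup h] [InnerProductSpace ℂ h]
    [CompleteSpace h] where
  separable : TopologicalSpace.SeparableSpace h
  P₀ : h →L[ℂ] h
  P₀_proj : IsStarProjection P₀
  infinite₀ : ¬ FiniteDimensional ℂ (LinearMap.range P₀.toLinearMap)
  infinite₁ : ¬ FiniteDimensional ℂ (LinearMap.range (1 - P₀).toLinearMap)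
  J : h →ₗᵢ⋆[ℂ] h
  J_J : ∀ f, J (J f) = f
  J_even : ∀ f, J (P₀ f) = P₀ (J f)
  P : h →L[ℂ] h
  P_proj : IsStarProjection P
  P_even : P * P₀ = P₀ * P
  J_P : ∀ f, J (P f) = J f - P (J f)

namespace NeutralSystem

variable {h : Type*} [NormedAddCommGroup h] [InnerProductSpace ℂ h] [CompleteSpace h]
variable (S : NeutralSystem h)

/-- The Klein operator `γ = P₀ - P₁`. -/
def γ : h →L[ℂ] h := S.P₀ - (1 - S.P₀)

/-- `q = P - γ (1 - P)`. -/
def q : h →L[ℂ] h := S.P - S.γ * (1 - S.P)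

/-- The orthogonal projection onto `h_α`. -/
def gr (α : Fin 2) : h →L[ℂ] h := if α = 0 then S.P₀ else 1 - S.P₀

/-- `ε` multiplies the block of `X` from `h_β` to `h_α` by `(-1)^{αβ}`. -/
def eps (X : h →L[ℂ] h) : h →L[ℂ] h :=
  ∑ α : Fin 2, ∑ β : Fin 2, (-1) ^ (α.val * β.val) * (S.gr α * X * S.gr β)

/-- Self-duality: `X = q J ε(X)^* q J`. -/
def IsSelfDual (X : h →L[ℂ] h) : Prop :=
  ∀ f, X f = S.q (S.J (ContinuousLinearMap.adjoint (S.eps X) (S.q (S.J f))))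

/-- `X ∈ g₂`: `X` is bounded and self-dual, and `P X (1 - P)`, `(1 - P) X P` are
Hilbert–Schmidt. -/
def MemG₂ (X : h →L[ℂ] h) : Prop :=
  S.IsSelfDual X ∧ IsHilbertSchmidt (S.P * X * (1 - S.P)) ∧
    IsHilbertSchmidt ((1 - S.P) * X * S.P)

/-- The operator `(1 - P) X P Y - (-1)^{deg X · deg Y} (1 - P) Y P X`, extended bilinearly. -/
def schwingerOp (X Y : h →L[ℂ] h) : h →L[ℂ] h :=
  ∑ α : Fin 2, ∑ β : Fin 2,
    ((1 - S.P) * homPart S.P₀ α X * S.P * homPart S.P₀ β Y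
      - (-1) ^ (α.val * β.val)
        * ((1 - S.P) * homPart S.P₀ β Y * S.P * homPart S.P₀ α X))

/-- `Str A = Tr (γ A) = t`. The operators in the Schwinger term need not be trace class, but their
diagonal blocks with respect to `h = P h ⊕ (1 - P) h` are; the trace is that of the diagonal part
(and hence the usual trace when `A` is trace class). -/
def HasStr (A : h →L[ℂ] h) (t : ℂ) : Prop :=
  HasTrace (S.P * (S.γ * A) * S.P + (1 - S.P) * (S.γ * A) * (1 - S.P)) t

/-- The half space `h̃ = P h`. -/
def half : Submodule ℂ h := LinearMap.range S.P.toLinearMap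

/-- `P` as a map onto `h̃`. -/
def toHalf : h →L[ℂ] S.half := S.P.codRestrict S.half fun f => ⟨f, rfl⟩

/-- A conjugation on `h̃` that is even. -/
structure HalfConj where
  toMap : S.half →ₗᵢ⋆[ℂ] S.half
  involutive : ∀ f, toMap (toMap f) = f
  even : ∀ f : S.half, (toMap (S.toHalf (S.P₀ f)) : h) = S.P₀ (toMap f)

/-- An orthonormal basis of `h̃`, made of a basis of `h̃₀` and a basis of `h̃₁`. It identifies
`h̃` with its coordinate space, and `ℱ_B(h̃₀) ⊗ ℱ_F(h̃₁)` with `Fock ι₀ ι₁`. -/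
structure ModeBasis (ι₀ ι₁ : Type*) where
  basis : HilbertBasis (ι₀ ⊕ ι₁) ℂ S.half
  even : ∀ i : ι₀, S.P₀ (basis (Sum.inl i)) = basis (Sum.inl i)
  odd : ∀ j : ι₁, S.P₀ (basis (Sum.inr j)) = 0

variable {S}
variable {ι₀ ι₁ : Type*} [LinearOrder ι₁] (b : S.ModeBasis ι₀ ι₁)

namespace ModeBasis

/-- `â†(f)`, `f ∈ h̃`. -/
def aDag (f : S.half) : Module.End ℂ (finPart ι₀ ι₁) := cre (b.basis.repr f)

/-- `â(f)`, `f ∈ h̃`. -/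
def a (f : S.half) : Module.End ℂ (finPart ι₀ ι₁) := ann (b.basis.repr f)

/-- `B̂†(f) = â†(P f) - â(γ J (1 - P) f)`. -/
def BDag (f : h) : Module.End ℂ (finPart ι₀ ι₁) :=
  b.aDag (S.toHalf f) - b.a (S.toHalf (S.γ (S.J (f - S.P f))))

/-- The linear span of the vectors `â†(f₁) ⋯ â†(f_N) Ω`. -/
def algSpan : Submodule ℂ (finPart ι₀ ι₁) :=
  Submodule.span ℂ
    (Set.range fun l : List S.half => (l.map fun f => b.aDag f).prod vacuum)

variable (C : S.HalfConj) (e : HilbertBasis ℕ ℂ S.half)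

/-- The partial sums of a series of operators, applied to `φ`, converge to `ψ` in Fock space. -/
def SeriesAt (T : ℕ → Module.End ℂ (finPart ι₀ ι₁)) (φ : finPart ι₀ ι₁) (ψ : Fock ι₀ ι₁) : Prop :=
  Tendsto (fun N => (((∑ n ∈ Finset.range N, T n) φ : finPart ι₀ ι₁) : Fock ι₀ ι₁)) atTop (𝓝 ψ)

/-- `(Z â†â) φ = ψ`, where `Z â†â = ∑ₙ â†(Z eₙ) â(eₙ)`. -/
def QuadDagA (Z : S.half →L[ℂ] S.half) : finPart ι₀ ι₁ → Fock ι₀ ι₁ → Prop :=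
  SeriesAt fun n => b.aDag (Z (e n)) * b.a (e n)

/-- `(Z â†â†) φ = ψ`, where `Z â†â† = ∑ₙ â†(Z eₙ) â†(J̃ eₙ)`. -/
def QuadDagDag (Z : S.half →L[ℂ] S.half) : finPart ι₀ ι₁ → Fock ι₀ ι₁ → Prop :=
  SeriesAt fun n => b.aDag (Z (e n)) * b.aDag (C.toMap (e n))

/-- `(Z ââ) φ = ψ`, where `Z ââ = ∑ₙ â(J̃ Z eₙ) â(eₙ)`. -/
def QuadAA (Z : S.half →L[ℂ] S.half) : finPart ι₀ ι₁ → Fock ι₀ ι₁ → Prop :=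
  SeriesAt fun n => b.a (C.toMap (Z (e n))) * b.a (e n)

end ModeBasis

variable (S) in
/-- `P X P` on `h̃`. -/
def compPP (X : h →L[ℂ] h) : S.half →L[ℂ] S.half := S.toHalf ∘L X ∘L S.half.subtypeL

/-- `P X J J̃ P` on `h̃`. -/
def compDagDag (C : S.HalfConj) (X : h →L[ℂ] h) : S.half →L[ℂ] S.half :=
  (S.toHalf ∘L X).comp
    (S.J.toContinuousLinearMap.comp
      (S.half.subtypeL.comp C.toMap.toContinuousLinearMap))

/-- `γ J̃ P J X P` on `h̃`. -/
def compAA (C : S.HalfConj) (X : h →L[ℂ] h) : S.half →L[ℂ] S.half :=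
  (S.toHalf ∘L S.γ ∘L S.half.subtypeL).comp
    (C.toMap.toContinuousLinearMap.comp
      (S.toHalf.comp (S.J.toContinuousLinearMap.comp (X ∘L S.half.subtypeL))))

namespace ModeBasis

/-- `dΓ̂(X) φ = ψ`: the three series in
`dΓ̂(X) = (P X P) â†â + ½ (P X J J̃ P) â†â† - ½ (γ P J̃ J X P) ââ`
converge at `φ`, and `ψ` is the resulting value. -/
def Current (C : S.HalfConj) (e : HilbertBasis ℕ ℂ S.half) (X : h →L[ℂ] h)
    (φ : finPart ι₀ ι₁) (ψ : Fock ι₀ ι₁) : Prop :=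
  ∃ ψ₁ ψ₂ ψ₃ : Fock ι₀ ι₁,
    b.QuadDagA e (S.compPP X) φ ψ₁ ∧ b.QuadDagDag C e (compDagDag C X) φ ψ₂ ∧
    b.QuadAA C e (compAA C X) φ ψ₃ ∧
    ψ = ψ₁ + (1 / 2 : ℂ) • ψ₂ - (1 / 2 : ℂ) • ψ₃

/-- `dΓ̂(X)` is well defined on all finite-particle vectors. -/
def CurrentDefined (C : S.HalfConj) (e : HilbertBasis ℕ ℂ S.half) (X : h →L[ℂ] h) : Prop :=
  ∀ φ : finPart ι₀ ι₁, ∃ ψ, b.Current C e X φ ψ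

/-- `dΓ̂(X)` is well defined as a closable operator with domain the linear span of the vectors
`â†(f₁) ⋯ â†(f_N) Ω`. -/
def CurrentClosable (C : S.HalfConj) (e : HilbertBasis ℕ ℂ S.half) (X : h →L[ℂ] h) : Prop :=
  ∃ T : Fock ι₀ ι₁ →ₗ.[ℂ] Fock ι₀ ι₁,
    T.domain = b.algSpan.map (finPart ι₀ ι₁).subtype ∧ T.IsClosable ∧
    ∀ (φ : finPart ι₀ ι₁) (hφ : (φ : Fock ι₀ ι₁) ∈ T.domain), b.Current C e X φ (T ⟨φ, hφ⟩)

end ModeBasis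

end NeutralSystem

end

/-! All work takes place in occupation numbers, on finite-particle vectors, where operators are
controlled sector by sector. Self-duality says that X infinitesimally preserves the graded form
ω(f,g) = ⟨Jf, γq g⟩ (`isSelfDual_iff`). Read on the blocks of h = Ph ⊕ (1-P)h, it makes the kernel K
= PXJP of a†a† and the kernel W = PγJXP of aa graded symmetric, and it expresses the adjoint of PXP
through (1-P)X(1-P) (`kernCC_symm`, `kernAA_symm`, `kernCA_symm`).

Sufficiency. The number operator gives ∑ₙ ‖a(eₙ)φ‖² ≤ N‖φ‖² for φ with at most N particles, and
duality gives a matching bound for ∑ₙ a†(eₙ)χₙ (`sum_norm_ann_sq_le`, `norm_sum_cre_sq_le`). Hence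
the a†a series converges for every bounded kernel and the two pair series converge for
Hilbert–Schmidt kernels, with partial sums bounded uniformly on each sector. The matrix elements of
the sums do not involve the basis. The adjoint series also converge at every finite-particle vector,
which gives closability (`exists_formal_adjoint`).

Necessity. Applied to the vacuum, pair creation gives a vector whose two-particle amplitudes are the
matrix elements of K up to a factor 2, so its norm bounds the Hilbert–Schmidt norm of K
(`modeHS_of_tendsto`). For pair annihilation take t = ∑ (Wδᵢ)ⱼ a†ᵢa†ⱼΩ over a finite set of modes:
the series maps t to 2QΩ, where Q is the truncated square norm of W, while ‖t‖² ≤ 2Q. If the series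
converges on all finite-particle vectors, the uniform boundedness principle on a sector gives 2Q ≤
M‖t‖, so Q stays bounded. On the algebraic span, which need not be complete, closability takes over:
if W were not Hilbert–Schmidt, suitable multiples of the vectors t would tend to 0 while dΓ̂(X) of
them tends to -½Ω.

Commutators. Moving the three series past a†(u) or a(u) leaves contractions. In the pair terms there
are two, equal by the symmetry of the kernels, which cancels the factor ½; the result is B̂†(Xf)
(`dGamma_BDag`). By the graded Jacobi identity the commutator of two currents has the same
supercommutators with all fields as dΓ̂([X,Y]ₛ). By irreducibility (`eq_zero_of_mul_BDag`) the two
differ by a scalar, found from vacuum expectations: ⟨Ω, dΓ̂(X)dΓ̂(Y)Ω⟩ = -½ Str((1-P)XPY), the trace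
of a product of two Hilbert–Schmidt operators (`hasStr_mul`). -/

noncomputable section

/-! ### Sectors, adjointness and number bounds -/

section FockBasics

variable {ι₀ ι₁ : Type*}

variable (ι₀ ι₁) in
/-- The vectors of Fock space with at most `N` particles. -/
def sector (N : ℕ) : Submodule ℂ (Fock ι₀ ι₁) where
  carrier := {φ | ∀ c : Config ι₀ ι₁, N < c.number → φ c = 0}
  zero_mem' := fun _ _ => rfl
  add_mem' := by
    intro φ ψ hφ hψ c hc
    rw [lp.coeFn_add, Pi.add_apply, hφ c hc, hψ c hc, add_zero]
  smul_mem' := by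
    intro a φ hφ c hc
    rw [lp.coeFn_smul, Pi.smul_apply, hφ c hc, smul_zero]

instance : Inner ℂ (finPart ι₀ ι₁) := InnerProductSpace.toInner

theorem fock_inner_smul_right (a : ℂ) (φ ψ : finPart ι₀ ι₁) :
    ⟪φ, a • ψ⟫_ℂ = a * ⟪φ, ψ⟫_ℂ := inner_smul_right φ ψ a

theorem mem_sector_iff {N : ℕ} {φ : Fock ι₀ ι₁} :
    φ ∈ sector ι₀ ι₁ N ↔ ∀ c : Config ι₀ ι₁, N < c.number → φ c = 0 := Iff.rfl

theorem sector_mono {N M : ℕ} (h : N ≤ M) : sector ι₀ ι₁ N ≤ sector ι₀ ι₁ M :=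
  fun _ hφ c hc => hφ c (h.trans_lt hc)

theorem exists_mem_sector (φ : finPart ι₀ ι₁) : ∃ N, (φ : Fock ι₀ ι₁) ∈ sector ι₀ ι₁ N := φ.2

theorem mem_finPart_of_mem_sector {N : ℕ} {φ : Fock ι₀ ι₁} (h : φ ∈ sector ι₀ ι₁ N) :
    φ ∈ finPart ι₀ ι₁ := ⟨N, h⟩

theorem continuous_fock_apply (c : Config ι₀ ι₁) : Continuous fun φ : Fock ι₀ ι₁ => φ c :=
  (continuous_apply c).comp (lp.uniformContinuous_coe (p := 2)).continuous

/-- An intersection of kernels of continuous coordinate functionals. The space `finPart` need not be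
closed, so limits are kept inside it by bounding the particle number along the whole series;
closedness also makes each sector a Banach space. -/
theorem isClosed_sector (N : ℕ) : IsClosed (sector ι₀ ι₁ N : Set (Fock ι₀ ι₁)) := by
  have : (sector ι₀ ι₁ N : Set (Fock ι₀ ι₁))
      = ⋂ (c : Config ι₀ ι₁) (_ : N < c.number), {φ | φ c = 0} := by
    ext φ; simp [mem_sector_iff]
  rw [this]
  exact isClosed_iInter fun c => isClosed_iInter fun _ =>
    isClosed_eq (continuous_fock_apply c) continuous_const

theorem lp_norm_sq {α : Type*} (f : lp (fun _ : α => ℂ) 2) : ‖f‖ ^ 2 = ∑' i, ‖f i‖ ^ 2 := by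
  have := lp.norm_rpow_eq_tsum (p := 2) (by norm_num) f
  simpa using this

variable [LinearOrder ι₁]

theorem cre_apply (f : OnePart ι₀ ι₁) (φ : finPart ι₀ ι₁) (c : Config ι₀ ι₁) :
    (cre f φ).1 c = ∑ i ∈ c.occupied, c.creAmp i * f i * φ.1 (c.lower i) := rfl

theorem ann_apply (f : OnePart ι₀ ι₁) (φ : finPart ι₀ ι₁) (c : Config ι₀ ι₁) :
    (ann f φ).1 c = ⟪f, annVec φ c⟫_ℂ := annFun_eq_inner f φ c

theorem cre_mem_sector (f : OnePart ι₀ ι₁) {φ : finPart ι₀ ι₁} {N : ℕ}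
    (h : φ.1 ∈ sector ι₀ ι₁ N) : (cre f φ).1 ∈ sector ι₀ ι₁ (N + 1) :=
  fun c hc => creFun_eq_zero f h c hc

theorem annVec_eq_zero {φ : finPart ι₀ ι₁} {N : ℕ} (h : φ.1 ∈ sector ι₀ ι₁ N)
    {c : Config ι₀ ι₁} (hc : N ≤ c.number) : annVec φ c = 0 := by
  apply lp.ext; funext i
  change c.annAmp i * φ.1 (c.raise i) = 0
  by_cases hi : c.annAmp i = 0
  · simp [hi]
  · rw [h _ (by rw [Config.number_raise hi]; omega), mul_zero]

theorem ann_mem_sector_pred (f : OnePart ι₀ ι₁) {φ : finPart ι₀ ι₁} {N : ℕ}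
    (h : φ.1 ∈ sector ι₀ ι₁ (N + 1)) : (ann f φ).1 ∈ sector ι₀ ι₁ N := fun c hc => by
  rw [ann_apply, annVec_eq_zero h (by omega), inner_zero_right]

theorem ann_mem_sector (f : OnePart ι₀ ι₁) {φ : finPart ι₀ ι₁} {N : ℕ}
    (h : φ.1 ∈ sector ι₀ ι₁ N) : (ann f φ).1 ∈ sector ι₀ ι₁ N :=
  ann_mem_sector_pred f (sector_mono (Nat.le_succ N) h)

theorem cre_add (f g : OnePart ι₀ ι₁) : cre (f + g) = cre f + cre g := by
  ext φ c
  change creFun (f + g) φ.1 c = creFun f φ.1 c + creFun g φ.1 c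
  simp [creFun, mul_add, add_mul, Finset.sum_add_distrib]

theorem cre_smul (a : ℂ) (f : OnePart ι₀ ι₁) : cre (a • f) = a • cre f := by
  ext φ c
  change creFun (a • f) φ.1 c = a * creFun f φ.1 c
  simp only [creFun, lp.coeFn_smul, Pi.smul_apply, smul_eq_mul, Finset.mul_sum]
  exact Finset.sum_congr rfl fun i _ => by ring

theorem ann_add (f g : OnePart ι₀ ι₁) : ann (f + g) = ann f + ann g := by
  ext φ c
  change (ann (f + g) φ).1 c = (ann f φ).1 c + (ann g φ).1 c
  simp only [ann_apply, inner_add_left]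

theorem ann_smul (a : ℂ) (f : OnePart ι₀ ι₁) : ann (a • f) = conj a • ann f := by
  ext φ c
  change (ann (a • f) φ).1 c = conj a * (ann f φ).1 c
  simp only [ann_apply, inner_smul_left]

theorem conj_creAmp (c : Config ι₀ ι₁) (i : ι₀ ⊕ ι₁) : conj (c.creAmp i) = c.creAmp i := by
  rcases i with i | j <;> simp [Config.creAmp]

/-- Reindexing sums over pairs (configuration, mode to be filled) by pairs
(configuration, occupied mode). -/
theorem hasSum_raise_iff {E : Type*} [AddCommMonoid E] [TopologicalSpace E]
    {G : Config ι₀ ι₁ × (ι₀ ⊕ ι₁) → E} (hG : ∀ p, p.1.annAmp p.2 = 0 → G p = 0) {x : E} :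
    HasSum (fun p : (Σ c : Config ι₀ ι₁, {i // i ∈ c.occupied}) => G (p.1.lower p.2.1, p.2.1)) x
      ↔ HasSum G x := by
  let k : (Σ c : Config ι₀ ι₁, {i // i ∈ c.occupied}) → Config ι₀ ι₁ × (ι₀ ⊕ ι₁) :=
    fun p => (p.1.lower p.2.1, p.2.1)
  have hk : Function.Injective k := by
    rintro ⟨c, i, hi⟩ ⟨d, j, hj⟩ h
    simp only [k, Prod.mk.injEq] at h
    obtain ⟨h, rfl⟩ := h
    have hcd : c = d := by rw [← Config.raise_lower hi, h, Config.raise_lower hj]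
    subst hcd; rfl
  refine hk.hasSum_iff (f := G) ?_
  rintro ⟨c, i⟩ hci
  by_contra h
  have hne : c.annAmp i ≠ 0 := fun h' => h (hG _ h')
  exact hci ⟨⟨c.raise i, i, Config.mem_occupied_raise⟩, by simp [k, Config.lower_raise hne]⟩

theorem summable_mul_of_summable_sq {α : Type*} {f g : α → ℂ}
    (hf : Summable fun i => ‖f i‖ ^ 2) (hg : Summable fun i => ‖g i‖ ^ 2) :
    Summable fun i => f i * g i := by
  refine Summable.of_norm_bounded (hf.add hg) fun i => ?_
  rw [norm_mul]
  nlinarith [sq_nonneg (‖f i‖ - ‖g i‖), sq_nonneg ‖f i‖, sq_nonneg ‖g i‖]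

/-- Both sides are sums of one absolutely summable family `G` over (configuration, mode). Grouping
by the configuration with the particle removed gives the side with a(f); grouping by the one with
the particle added, via `hasSum_raise_iff`, gives the side with a†(f). -/
theorem inner_cre_left (f : OnePart ι₀ ι₁) (φ ψ : finPart ι₀ ι₁) :
    ⟪cre f φ, ψ⟫_ℂ = ⟪φ, ann f ψ⟫_ℂ := by
  let G : Config ι₀ ι₁ × (ι₀ ⊕ ι₁) → ℂ := fun p =>
    conj (φ.1 p.1) * conj (f p.2) * (p.1.annAmp p.2 * ψ.1 (p.1.raise p.2))
  have hG : Summable G := by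
    refine summable_mul_of_summable_sq ?_ (summable_annAmp ψ)
    refine ((summable_sq_lp φ.1).mul_of_nonneg (summable_sq_lp f)
      (fun _ => sq_nonneg _) (fun _ => sq_nonneg _)).congr fun p => ?_
    simp [mul_pow]
  have h1 : HasSum (fun c : Config ι₀ ι₁ => conj (φ.1 c) * (ann f ψ).1 c) (∑' p, G p) := by
    refine hG.hasSum.prod_fiberwise fun c => ?_
    have h2 := (lp.hasSum_inner f (annVec ψ c)).mul_left (conj (φ.1 c))
    rw [← ann_apply] at h2
    refine h2.congr_fun ?_
    intro i
    simp only [G, annVec, RCLike.inner_apply]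
    ring
  have h3 := (hasSum_raise_iff (G := G) (fun p hp => by simp [G, hp])).2 hG.hasSum
  have h4 : HasSum (fun c : Config ι₀ ι₁ => conj ((cre f φ).1 c) * ψ.1 c) (∑' p, G p) := by
    refine h3.sigma fun c => ?_
    have : conj ((cre f φ).1 c) * ψ.1 c
        = ∑ i : {i // i ∈ c.occupied}, G (c.lower i, i) := by
      rw [cre_apply, map_sum, Finset.sum_mul,
        Finset.sum_coe_sort c.occupied (fun i => G (c.lower i, i))]
      refine Finset.sum_congr rfl fun i hi => ?_
      simp only [G, Config.raise_lower hi, Config.annAmp_lower hi, map_mul, conj_creAmp]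
      ring
    rw [this]
    exact hasSum_fintype _
  have h5 : HasSum (fun c : Config ι₀ ι₁ => conj ((cre f φ).1 c) * ψ.1 c) ⟪cre f φ, ψ⟫_ℂ := by
    refine (lp.hasSum_inner (cre f φ).1 ψ.1).congr_fun ?_
    intro c
    simp [RCLike.inner_apply, mul_comm]
  have h6 : HasSum (fun c : Config ι₀ ι₁ => conj (φ.1 c) * (ann f ψ).1 c) ⟪φ, ann f ψ⟫_ℂ := by
    refine (lp.hasSum_inner φ.1 (ann f ψ).1).congr_fun ?_
    intro c
    simp [RCLike.inner_apply, mul_comm]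
  rw [h5.unique h4, h6.unique h1]

theorem inner_ann_left (f : OnePart ι₀ ι₁) (φ ψ : finPart ι₀ ι₁) :
    ⟪ann f φ, ψ⟫_ℂ = ⟪φ, cre f ψ⟫_ℂ := by
  have h := congrArg conj (inner_cre_left f ψ φ)
  exact (inner_conj_symm _ _).symm.trans (h.symm.trans (inner_conj_symm _ _))

theorem summable_norm_annVec_sq (φ : finPart ι₀ ι₁) :
    Summable fun c => ‖annVec φ c‖ ^ 2 := by
  refine (((summable_prod_of_nonneg (fun _ => by positivity)).1
    (summable_annAmp φ)).2).congr fun c => ?_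
  rw [lp_norm_sq]; rfl

/-- The identity ∑ᵢ a†ᵢaᵢ = number operator: regrouped by the upper configuration c, the squared
amplitudes add up to the particle number of c. -/
theorem tsum_norm_annVec_sq_le {φ : finPart ι₀ ι₁} {N : ℕ} (h : φ.1 ∈ sector ι₀ ι₁ N) :
    ∑' c, ‖annVec φ c‖ ^ 2 ≤ N * ‖φ‖ ^ 2 := by
  have h1 := (summable_annAmp φ).hasSum
  have h2 := (hasSum_raise_iff (G := fun p : Config ι₀ ι₁ × (ι₀ ⊕ ι₁) =>
    ‖p.1.annAmp p.2 * φ.1 (p.1.raise p.2)‖ ^ 2) (fun p hp => by simp [hp])).2 h1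
  have h3 : HasSum (fun c : Config ι₀ ι₁ => (c.number : ℝ) * ‖φ.1 c‖ ^ 2)
      (∑' p : Config ι₀ ι₁ × (ι₀ ⊕ ι₁), ‖p.1.annAmp p.2 * φ.1 (p.1.raise p.2)‖ ^ 2) := by
    refine h2.sigma fun c => ?_
    have : (c.number : ℝ) * ‖φ.1 c‖ ^ 2 = ∑ i : {i // i ∈ c.occupied},
        ‖(c.lower i).annAmp i * φ.1 ((c.lower i).raise i)‖ ^ 2 := by
      rw [Finset.sum_coe_sort c.occupied
        (fun i => ‖(c.lower i).annAmp i * φ.1 ((c.lower i).raise i)‖ ^ 2),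
        ← Config.sum_creAmp_sq, Finset.sum_mul]
      refine Finset.sum_congr rfl fun i hi => ?_
      rw [Config.raise_lower hi, Config.annAmp_lower hi, norm_mul, mul_pow]
    rw [this]
    exact hasSum_fintype _
  have h4 : HasSum (fun c => ‖annVec φ c‖ ^ 2)
      (∑' p : Config ι₀ ι₁ × (ι₀ ⊕ ι₁), ‖p.1.annAmp p.2 * φ.1 (p.1.raise p.2)‖ ^ 2) := by
    refine h1.prod_fiberwise fun c => ?_
    rw [lp_norm_sq]
    exact (summable_sq_lp (annVec φ c)).hasSum
  rw [h4.tsum_eq, ← h3.tsum_eq, Submodule.coe_norm, lp_norm_sq, ← tsum_mul_left]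
  refine h3.summable.tsum_le_tsum (fun c => ?_) ((summable_sq_lp φ.1).mul_left _)
  by_cases hc : c.number ≤ N
  · gcongr
  · rw [h c (by omega)]; simp

/-- A Bessel family with constant `B`. -/
def IsBessel {κ E : Type*} [NormedAddCommGroup E] [InnerProductSpace ℂ E] (B : ℝ) (u : κ → E) :
    Prop :=
  ∀ (s : Finset κ) (x : E), ∑ n ∈ s, ‖⟪u n, x⟫_ℂ‖ ^ 2 ≤ B * ‖x‖ ^ 2

theorem Orthonormal.isBessel {κ E : Type*} [NormedAddCommGroup E] [InnerProductSpace ℂ E]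
    {u : κ → E} (hu : Orthonormal ℂ u) : IsBessel 1 u := fun s x => by
  rw [one_mul]; exact hu.sum_inner_products_le x

theorem IsBessel.map {κ E F : Type*} [NormedAddCommGroup E] [InnerProductSpace ℂ E]
    [CompleteSpace E] [NormedAddCommGroup F] [InnerProductSpace ℂ F] [CompleteSpace F]
    {B : ℝ} (hB : 0 ≤ B) {u : κ → E} (hu : IsBessel B u) (Z : E →L[ℂ] F) :
    IsBessel (B * ‖Z‖ ^ 2) fun n => Z (u n) := fun s x => by
  have h := hu s (ContinuousLinearMap.adjoint Z x)
  simp only [ContinuousLinearMap.adjoint_inner_right] at h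
  refine h.trans ?_
  rw [mul_assoc, ← mul_pow]
  gcongr
  refine (ContinuousLinearMap.le_opNorm _ _).trans_eq ?_
  rw [LinearIsometryEquiv.norm_map]

/-- At each configuration c the component of a(uₙ)φ is ⟨uₙ, `annVec φ c`⟩, so the Bessel inequality
applies pointwise in c and the number bound sums the result. The bound is uniform in the number of
terms, which drives all convergence statements. -/
theorem sum_norm_ann_sq_le {κ : Type*} {B : ℝ} {u : κ → OnePart ι₀ ι₁} (hu : IsBessel B u)
    (hB : 0 ≤ B) {φ : finPart ι₀ ι₁} {N : ℕ} (h : φ.1 ∈ sector ι₀ ι₁ N) (s : Finset κ) :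
    ∑ n ∈ s, ‖ann (u n) φ‖ ^ 2 ≤ B * (N * ‖φ‖ ^ 2) := by
  have h1 : ∀ n, ‖ann (u n) φ‖ ^ 2 = ∑' c, ‖⟪u n, annVec φ c⟫_ℂ‖ ^ 2 := fun n => by
    rw [Submodule.coe_norm, lp_norm_sq]
    exact tsum_congr fun c => by rw [ann_apply]
  have h2 : ∀ n, Summable fun c => ‖⟪u n, annVec φ c⟫_ℂ‖ ^ 2 := fun n =>
    (summable_sq_lp (ann (u n) φ).1).congr fun c => by rw [ann_apply]
  simp only [h1]
  rw [← Summable.tsum_finsetSum fun n _ => h2 n]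
  calc _ ≤ ∑' c, B * ‖annVec φ c‖ ^ 2 :=
        (summable_sum fun n _ => h2 n).tsum_le_tsum (fun c => hu s _)
          ((summable_norm_annVec_sq φ).mul_left _)
    _ = B * ∑' c, ‖annVec φ c‖ ^ 2 := tsum_mul_left
    _ ≤ _ := by gcongr; exact tsum_norm_annVec_sq_le h

theorem summable_norm_ann_sq {κ : Type*} {B : ℝ} {u : κ → OnePart ι₀ ι₁} (hu : IsBessel B u)
    (hB : 0 ≤ B) (φ : finPart ι₀ ι₁) : Summable fun n => ‖ann (u n) φ‖ ^ 2 := by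
  obtain ⟨N, hN⟩ := exists_mem_sector φ
  exact summable_of_sum_le (fun _ => by positivity) fun s => sum_norm_ann_sq_le hu hB hN s

/-- Dual to `sum_norm_ann_sq_le`: pair σ = ∑ a†(uₙ)χₙ with itself, move each a†(uₙ) across as a(uₙ),
and apply Cauchy–Schwarz and the annihilation bound to σ, which has at most N + 1 particles. -/
theorem norm_sum_cre_sq_le {κ : Type*} {B : ℝ} {u : κ → OnePart ι₀ ι₁} (hu : IsBessel B u)
    (hB : 0 ≤ B) {χ : κ → finPart ι₀ ι₁} {N : ℕ} (s : Finset κ)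
    (h : ∀ n ∈ s, (χ n).1 ∈ sector ι₀ ι₁ N) :
    ‖∑ n ∈ s, cre (u n) (χ n)‖ ^ 2 ≤ B * (N + 1) * ∑ n ∈ s, ‖χ n‖ ^ 2 := by
  set σ := ∑ n ∈ s, cre (u n) (χ n) with hσ
  have hmem : σ.1 ∈ sector ι₀ ι₁ (N + 1) := by
    have : σ.1 = ∑ n ∈ s, (cre (u n) (χ n)).1 := by
      rw [hσ]; exact map_sum (finPart ι₀ ι₁).subtype _ _
    rw [this]
    exact Submodule.sum_mem _ fun n hn => cre_mem_sector _ (h n hn)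
  have h1 : (‖σ‖ ^ 2 : ℝ) ≤ ∑ n ∈ s, ‖χ n‖ * ‖ann (u n) σ‖ := by
    have h2 : ((‖σ‖ ^ 2 : ℝ) : ℂ) = ∑ n ∈ s, ⟪χ n, ann (u n) σ⟫_ℂ := by
      have : ((‖σ‖ ^ 2 : ℝ) : ℂ) = ⟪σ, σ⟫_ℂ := by
        rw [inner_self_eq_norm_sq_to_K]; norm_cast
      rw [this]
      nth_rewrite 1 [hσ]
      rw [sum_inner]
      exact Finset.sum_congr rfl fun n _ => inner_cre_left _ _ _
    have h3 := congrArg norm h2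
    rw [Complex.norm_real, Real.norm_of_nonneg (by positivity)] at h3
    rw [h3]
    exact (norm_sum_le _ _).trans (Finset.sum_le_sum fun n _ => norm_inner_le_norm _ _)
  have h4 := Finset.sum_mul_sq_le_sq_mul_sq s (fun n => ‖χ n‖) (fun n => ‖ann (u n) σ‖)
  have h5 := sum_norm_ann_sq_le hu hB hmem s
  have h6 : 0 ≤ ∑ n ∈ s, ‖χ n‖ ^ 2 := Finset.sum_nonneg fun _ _ => by positivity
  push_cast at h5
  have h7 : (‖σ‖ ^ 2) ^ 2 ≤ (∑ n ∈ s, ‖χ n‖ ^ 2) * (B * ((N + 1) * ‖σ‖ ^ 2)) :=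
    (pow_le_pow_left₀ (sq_nonneg _) h1 2).trans
      (h4.trans (mul_le_mul_of_nonneg_left h5 h6))
  have hN : (0 : ℝ) ≤ B * (N + 1) := mul_nonneg hB (by positivity)
  generalize ‖σ‖ ^ 2 = t at h7
  generalize ∑ n ∈ s, ‖χ n‖ ^ 2 = r at h6 h7
  -- The inequality so far is quadratic in t = ‖σ‖²; dividing by t is allowed only for t > 0.
  by_cases h0 : t ≤ 0
  · exact h0.trans (mul_nonneg hN h6)
  · refine le_of_mul_le_mul_right ?_ (not_le.1 h0)
    linarith [h7]

theorem isBessel_const {E : Type*} [NormedAddCommGroup E] [InnerProductSpace ℂ E] (f : E) :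
    IsBessel (‖f‖ ^ 2) fun _ : Unit => f := fun s x => by
  refine (Finset.sum_le_univ_sum_of_nonneg fun _ => by positivity).trans ?_
  simp only [Finset.univ_unique, Finset.sum_const, Finset.card_singleton, one_smul]
  rw [← mul_pow]
  gcongr
  exact norm_inner_le_norm _ _

theorem norm_ann_sq_le (f : OnePart ι₀ ι₁) {φ : finPart ι₀ ι₁} {N : ℕ}
    (h : φ.1 ∈ sector ι₀ ι₁ N) : ‖ann f φ‖ ^ 2 ≤ ‖f‖ ^ 2 * (N * ‖φ‖ ^ 2) := by
  simpa using sum_norm_ann_sq_le (isBessel_const f) (by positivity) h Finset.univ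

theorem norm_cre_sq_le (f : OnePart ι₀ ι₁) {φ : finPart ι₀ ι₁} {N : ℕ}
    (h : φ.1 ∈ sector ι₀ ι₁ N) : ‖cre f φ‖ ^ 2 ≤ ‖f‖ ^ 2 * (N + 1) * ‖φ‖ ^ 2 := by
  simpa using norm_sum_cre_sq_le (isBessel_const f) (by positivity) (χ := fun _ => φ)
    Finset.univ (fun _ _ => h)

end FockBasics
end

noncomputable section

/-! ### Modes, the twist, and the canonical (anti)commutation relations -/

section CCR

variable {ι₀ ι₁ : Type*}

/-- The degree of a mode: bosonic modes are even, fermionic modes are odd. -/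
def modeDeg : ι₀ ⊕ ι₁ → Fin 2
  | Sum.inl _ => 0
  | Sum.inr _ => 1

/-- The sign `(-1)^{α · deg i}`. -/
def modeSign (α : Fin 2) (i : ι₀ ⊕ ι₁) : ℂ := (-1) ^ (α.val * (modeDeg i).val)

theorem modeSign_mul_self (α : Fin 2) (i : ι₀ ⊕ ι₁) : modeSign α i * modeSign α i = 1 := by
  rw [modeSign, ← pow_add, ← two_mul, pow_mul]; simp

theorem conj_modeSign (α : Fin 2) (i : ι₀ ⊕ ι₁) : conj (modeSign α i) = modeSign α i := by
  simp [modeSign]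

theorem norm_modeSign (α : Fin 2) (i : ι₀ ⊕ ι₁) : ‖modeSign α i‖ = 1 := by
  simp [modeSign]

/-- The operator `γ^α` on the one-particle space. -/
def twist (α : Fin 2) : OnePart ι₀ ι₁ →ₗᵢ[ℂ] OnePart ι₀ ι₁ where
  toFun f := ⟨fun i => modeSign α i * f i, memℓp_two_of_summable_sq <|
    (summable_sq_lp f).congr fun i => by rw [norm_mul, norm_modeSign, one_mul]⟩
  map_add' f g := by
    apply lp.ext; funext i; exact mul_add _ _ _
  map_smul' a f := by
    apply lp.ext; funext i; exact mul_left_comm _ _ _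
  norm_map' f := by
    have h : ∀ g : OnePart ι₀ ι₁, ‖g‖ = Real.sqrt (∑' i, ‖g i‖ ^ 2) := fun g => by
      rw [← lp_norm_sq, Real.sqrt_sq (norm_nonneg _)]
    rw [h, h]
    congr 1
    refine tsum_congr fun i => ?_
    change ‖modeSign α i * f i‖ ^ 2 = _
    rw [norm_mul, norm_modeSign, one_mul]

theorem twist_apply (α : Fin 2) (f : OnePart ι₀ ι₁) (i : ι₀ ⊕ ι₁) :
    twist α f i = modeSign α i * f i := rfl

@[simp]
theorem twist_twist (α : Fin 2) (f : OnePart ι₀ ι₁) : twist α (twist α f) = f := by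
  apply lp.ext; funext i
  rw [twist_apply, twist_apply, ← mul_assoc, modeSign_mul_self, one_mul]

theorem inner_twist_left (α : Fin 2) (f g : OnePart ι₀ ι₁) :
    ⟪twist α f, g⟫_ℂ = ⟪f, twist α g⟫_ℂ := by
  rw [← (twist α).inner_map_map, twist_twist]

/-- `f` is homogeneous of degree `α`. -/
def IsHom (α : Fin 2) (f : OnePart ι₀ ι₁) : Prop := ∀ i, modeDeg i ≠ α → f i = 0

theorem IsHom.twist_eq {α : Fin 2} {f : OnePart ι₀ ι₁} (hf : IsHom α f) (β : Fin 2) :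
    twist β f = ((-1) ^ (β.val * α.val) : ℂ) • f := by
  apply lp.ext; funext i
  rw [twist_apply, lp.coeFn_smul, Pi.smul_apply, smul_eq_mul]
  by_cases h : modeDeg i = α
  · rw [modeSign, h]
  · rw [hf i h, mul_zero, mul_zero]

open Classical in
/-- The standard basis of the one-particle space. -/
def mode (i : ι₀ ⊕ ι₁) : OnePart ι₀ ι₁ := lp.single 2 i 1

open Classical in
theorem mode_apply (i j : ι₀ ⊕ ι₁) : (mode i : OnePart ι₀ ι₁) j = if j = i then 1 else 0 := by
  rw [mode, lp.single_apply, Pi.single_apply]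

theorem inner_mode_left (i : ι₀ ⊕ ι₁) (f : OnePart ι₀ ι₁) : ⟪mode i, f⟫_ℂ = f i := by
  classical
  rw [mode, lp.inner_single_left]; simp

theorem inner_mode_right (i : ι₀ ⊕ ι₁) (f : OnePart ι₀ ι₁) : ⟪f, mode i⟫_ℂ = conj (f i : ℂ) := by
  rw [← inner_conj_symm, inner_mode_left]

theorem isHom_mode (i : ι₀ ⊕ ι₁) : IsHom (modeDeg i) (mode i : OnePart ι₀ ι₁) := fun j hj => by
  rw [mode_apply, if_neg (fun h => hj (by rw [h]))]

theorem twist_mode (α : Fin 2) (i : ι₀ ⊕ ι₁) :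
    twist α (mode i : OnePart ι₀ ι₁) = modeSign α i • mode i := (isHom_mode i).twist_eq α

theorem hasSum_mode (f : OnePart ι₀ ι₁) : HasSum (fun i => f i • mode i) f := by
  classical
  have h := lp.hasSum_single (p := 2) (by norm_num) f
  refine h.congr_fun fun i => ?_
  apply lp.ext; funext j
  rw [lp.coeFn_smul, Pi.smul_apply, mode_apply, lp.single_apply, Pi.single_apply]
  split_ifs with h
  · subst h; simp
  · simp

variable (ι₀ ι₁) in
/-- The modes as a Hilbert basis. -/
def modes : HilbertBasis (ι₀ ⊕ ι₁) ℂ (OnePart ι₀ ι₁) :=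
  HilbertBasis.ofRepr (LinearIsometryEquiv.refl ℂ _)

theorem modes_apply (i : ι₀ ⊕ ι₁) : modes ι₀ ι₁ i = mode i := by
  classical
  rw [← HilbertBasis.repr_symm_single, mode]
  change lp.single (E := fun _ : ι₀ ⊕ ι₁ => ℂ) 2 i (1 : ℂ) = _
  congr

theorem orthonormal_mode : Orthonormal ℂ (mode : ι₀ ⊕ ι₁ → OnePart ι₀ ι₁) := by
  have h := (modes ι₀ ι₁).orthonormal
  rwa [show ⇑(modes ι₀ ι₁) = mode from funext modes_apply] at h

variable [LinearOrder ι₁]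

/-- `f ↦ a†(f) φ`. -/
def creCLM (φ : finPart ι₀ ι₁) : OnePart ι₀ ι₁ →L[ℂ] finPart ι₀ ι₁ :=
  LinearMap.mkContinuousOfExistsBound
    { toFun := fun f => cre f φ
      map_add' := fun f g => by rw [cre_add]; rfl
      map_smul' := fun a f => by rw [cre_smul]; rfl } (by
    obtain ⟨N, hN⟩ := exists_mem_sector φ
    refine ⟨Real.sqrt ((N + 1) * ‖φ‖ ^ 2), fun f => ?_⟩
    refine le_of_sq_le_sq ?_ (by positivity)
    refine (norm_cre_sq_le f hN).trans_eq ?_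
    rw [mul_pow, Real.sq_sqrt (by positivity)]; ring)

/-- `f ↦ a(f) φ`. -/
def annCLM (φ : finPart ι₀ ι₁) : OnePart ι₀ ι₁ →L⋆[ℂ] finPart ι₀ ι₁ :=
  LinearMap.mkContinuousOfExistsBound
    { toFun := fun f => ann f φ
      map_add' := fun f g => by rw [ann_add]; rfl
      map_smul' := fun a f => by rw [ann_smul]; rfl } (by
    obtain ⟨N, hN⟩ := exists_mem_sector φ
    refine ⟨Real.sqrt (N * ‖φ‖ ^ 2), fun f => ?_⟩
    refine le_of_sq_le_sq ?_ (by positivity)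
    refine (norm_ann_sq_le f hN).trans_eq ?_
    rw [mul_pow, Real.sq_sqrt (by positivity)]; ring)

theorem hasSum_inner_cre (f : OnePart ι₀ ι₁) (φ ψ : finPart ι₀ ι₁) :
    HasSum (fun i => f i * ⟪ψ, cre (mode i) φ⟫_ℂ) ⟪ψ, cre f φ⟫_ℂ := by
  have h := ((hasSum_mode f).mapL (creCLM φ)).mapL (innerSL ℂ ψ)
  refine h.congr_fun fun i => ?_
  rw [map_smul, map_smul]; rfl

theorem hasSum_inner_ann (f : OnePart ι₀ ι₁) (φ ψ : finPart ι₀ ι₁) :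
    HasSum (fun i => conj (f i : ℂ) * ⟪ψ, ann (mode i) φ⟫_ℂ) ⟪ψ, ann f φ⟫_ℂ := by
  have h := ((hasSum_mode f).mapL (annCLM φ)).mapL (innerSL ℂ ψ)
  refine h.congr_fun fun i => ?_
  rw [map_smulₛₗ, map_smul]; rfl

theorem ann_mode_apply (i : ι₀ ⊕ ι₁) (φ : finPart ι₀ ι₁) (c : Config ι₀ ι₁) :
    (ann (mode i) φ).1 c = c.annAmp i * φ.1 (c.raise i) := by
  rw [ann_apply, inner_mode_left]; rfl

open Classical in
theorem cre_mode_apply (i : ι₀ ⊕ ι₁) (φ : finPart ι₀ ι₁) (c : Config ι₀ ι₁) :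
    (cre (mode i) φ).1 c = if i ∈ c.occupied then c.creAmp i * φ.1 (c.lower i) else 0 := by
  rw [cre_apply]
  simp only [mode_apply]
  simp [Finset.sum_ite_eq']

/-- The sign is -1 only for two fermionic modes. For distinct ones, filling the lower mode lengthens
by one the string of occupied modes counted by the amplitude of the higher mode, whereas filling the
higher mode leaves the string of the lower one unchanged. -/
theorem ann_ann_mode (i j : ι₀ ⊕ ι₁) (φ : finPart ι₀ ι₁) :
    ann (mode i) (ann (mode j) φ) = modeSign (modeDeg j) i • ann (mode j) (ann (mode i) φ) := by
  apply Subtype.ext; apply lp.ext; funext c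
  rw [Submodule.coe_smul, lp.coeFn_smul, Pi.smul_apply, smul_eq_mul]
  simp only [ann_mode_apply]
  rcases i with i | i <;> rcases j with j | j
  · simp only [modeSign, modeDeg, Config.annAmp, Config.raise]
    rw [add_right_comm c.1]
    by_cases h : i = j
    · subst h; simp
    · simp [h, Ne.symm h]; ring
  · simp [modeSign, modeDeg, Config.annAmp, Config.raise]; by_cases h : j ∈ c.2 <;> simp [h]; ring
  · simp [modeSign, modeDeg, Config.annAmp, Config.raise]; by_cases h : i ∈ c.2 <;> simp [h]; ring
  · simp only [modeSign, modeDeg, Config.annAmp, Config.raise]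
    by_cases h : i = j
    · subst h; simp
    by_cases hi : i ∈ c.2
    · simp [hi]
    by_cases hj : j ∈ c.2
    · simp [hj]
    rw [Finset.insert_comm i j, Finset.filter_insert, Finset.filter_insert]
    rcases lt_or_gt_of_ne h with hij | hij
    · simp [h, Ne.symm h, hi, hj, hij, not_lt.2 hij.le]; ring
    · simp [h, Ne.symm h, hi, hj, hij, not_lt.2 hij.le]; ring

-- For equal bosonic modes this is (√(n+1))² - (√n)² = 1. For equal fermionic modes exactly one of
-- the two products survives, according to the occupation. For distinct modes only the string signs
-- matter, as for two annihilators.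
open Classical in
theorem ann_cre_mode (i j : ι₀ ⊕ ι₁) (φ : finPart ι₀ ι₁) :
    ann (mode i) (cre (mode j) φ) = (if i = j then (1 : ℂ) else 0) • φ
      + modeSign (modeDeg j) i • cre (mode j) (ann (mode i) φ) := by
  apply Subtype.ext; apply lp.ext; funext c
  rw [Submodule.coe_add, Submodule.coe_smul, Submodule.coe_smul, lp.coeFn_add, Pi.add_apply,
    lp.coeFn_smul, lp.coeFn_smul, Pi.smul_apply, Pi.smul_apply, smul_eq_mul, smul_eq_mul,
    ann_mode_apply, cre_mode_apply, cre_mode_apply, ann_mode_apply]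
  rcases i with i | i <;> rcases j with j | j
  · by_cases h : i = j
    · subst h
      have h1 : (c.raise (Sum.inl i)).lower (Sum.inl i) = c :=
        Config.lower_raise (by simp only [Config.annAmp]; norm_cast; positivity)
      rw [if_pos Config.mem_occupied_raise, h1, if_pos rfl]
      have h2 : (c.raise (Sum.inl i)).creAmp (Sum.inl i) = c.annAmp (Sum.inl i) := by
        simp [Config.creAmp, Config.annAmp, Config.raise]
      have h3 : c.annAmp (Sum.inl i) * c.annAmp (Sum.inl i) = c.1 i + 1 := by
        simp only [Config.annAmp]
        rw [← Complex.ofReal_mul, Real.mul_self_sqrt (by positivity)]; simp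
      rw [h2, ← mul_assoc, h3]
      by_cases h4 : Sum.inl i ∈ c.occupied
      · rw [if_pos h4, Config.raise_lower h4, Config.annAmp_lower h4]
        have h5 : c.creAmp (Sum.inl i) * c.creAmp (Sum.inl i) = c.1 i := by
          simp only [Config.creAmp]
          rw [← Complex.ofReal_mul, Real.mul_self_sqrt (by positivity)]; simp
        rw [← mul_assoc (c.creAmp _), h5]
        simp [modeSign, modeDeg]; ring
      · rw [if_neg h4]
        have : c.1 i = 0 := by simpa [Config.occupied] using h4
        simp [this]
    · have h1 : ((c.raise (Sum.inl i)).lower (Sum.inl j))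
          = (c.lower (Sum.inl j)).raise (Sum.inl i) := by
        refine Prod.ext ?_ rfl
        ext k
        simp only [Config.raise, Config.lower, Finsupp.coe_add, Finsupp.coe_tsub, Pi.add_apply,
          Pi.sub_apply, Finsupp.single_apply]
        split_ifs with h1 h2 <;> first | omega | (subst h1; exact absurd h2.symm h)
      rw [h1]
      simp [modeSign, modeDeg, Config.occupied, Config.annAmp, Config.raise, Config.lower,
        Config.creAmp, h, Ne.symm h]
      split_ifs <;> ring
  · simp [modeSign, modeDeg, Config.occupied, Config.annAmp, Config.raise, Config.lower,
      Config.creAmp]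
    split_ifs <;> ring
  · simp [modeSign, modeDeg, Config.occupied, Config.annAmp, Config.raise, Config.lower,
      Config.creAmp]
    by_cases hi : i ∈ c.2 <;> simp [hi]
    split_ifs <;> ring
  · by_cases h : i = j
    · subst h
      by_cases hi : i ∈ c.2
      · have h4 : Sum.inr i ∈ c.occupied := by simpa [Config.occupied] using hi
        rw [if_pos h4 (α := ℂ), Config.raise_lower h4, Config.annAmp_lower h4]
        simp [modeSign, modeDeg, Config.annAmp, hi, Config.creAmp]
        rw [← mul_assoc, ← pow_add, ← two_mul, pow_mul]; simp
      · have h4 : Sum.inr i ∉ c.occupied := by simpa [Config.occupied] using hi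
        rw [if_neg h4, if_pos Config.mem_occupied_raise,
          Config.lower_raise (by simp [Config.annAmp, hi])]
        simp [Config.annAmp, hi, Config.creAmp, Config.raise, Finset.filter_insert]
        rw [← mul_assoc, ← pow_add, ← two_mul, pow_mul]; simp
    · by_cases hi : i ∈ c.2
      · simp [Config.annAmp, hi, Config.lower, h]
      by_cases hj : j ∈ c.2
      · have h1 : (insert i c.2).erase j = insert i (c.2.erase j) :=
          Finset.erase_insert_of_ne h
        simp only [modeSign, modeDeg, Config.occupied, Config.annAmp, Config.raise, Config.lower,
          Config.creAmp, h1]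
        rw [Finset.filter_insert]
        have h2 : (c.2.erase j).filter (· < i) = (c.2.filter (· < i)).erase j :=
          Finset.filter_erase ..
        rw [h2]
        rcases lt_or_gt_of_ne h with hij | hij
        · have : j ∉ c.2.filter (· < i) := by simp [hij.le]
          simp [h, Ne.symm h, hi, hj, hij, Finset.erase_eq_of_notMem this]; ring
        · have hm : j ∈ c.2.filter (· < i) := by simp [hij, hj]
          have h3 : (c.2.filter (· < i)).card = ((c.2.filter (· < i)).erase j).card + 1 := by
            rw [Finset.card_erase_add_one hm]
          rw [h3]
          simp [h, Ne.symm h, hi, hj, hij, not_lt.2 hij.le]; ring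
      · simp [Config.occupied, Config.raise, h, Ne.symm h, hj]

theorem inner_ann_cre_mode (u : OnePart ι₀ ι₁) (j : ι₀ ⊕ ι₁) (φ ψ : finPart ι₀ ι₁) :
    ⟪ψ, ann u (cre (mode j) φ)⟫_ℂ = conj (u j : ℂ) * ⟪ψ, φ⟫_ℂ
      + ⟪ψ, cre (mode j) (ann (twist (modeDeg j) u) φ)⟫_ℂ := by
  classical
  have h1 := hasSum_inner_ann u (cre (mode j) φ) ψ
  have h2 := hasSum_inner_ann (twist (modeDeg j) u) φ (ann (mode j) ψ)
  have h3 := hasSum_ite_eq j (conj (u j : ℂ) * ⟪ψ, φ⟫_ℂ)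
  rw [inner_ann_left] at h2
  refine h1.unique ((h3.add h2).congr_fun fun i => ?_)
  rw [ann_cre_mode, inner_add_right, fock_inner_smul_right, fock_inner_smul_right, inner_ann_left,
    twist_apply, map_mul, conj_modeSign]
  split_ifs with h
  · subst h; ring
  · ring

/-- Matrix elements are continuous in f and u, so the relation extends from modes by expansion. Only
f has to be homogeneous: the graded sign against an arbitrary u is carried by replacing u with γ^α
u, which avoids splitting u into its even and odd parts. -/
theorem ann_mul_cre {α : Fin 2} {f : OnePart ι₀ ι₁} (hf : IsHom α f) (u : OnePart ι₀ ι₁) :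
    ann u * cre f = ⟪u, f⟫_ℂ • 1 + cre f * ann (twist α u) := by
  refine LinearMap.ext fun φ => ext_inner_left ℂ fun ψ => ?_
  change ⟪ψ, ann u (cre f φ)⟫_ℂ = ⟪ψ, ⟪u, f⟫_ℂ • φ + cre f (ann (twist α u) φ)⟫_ℂ
  rw [inner_add_right, fock_inner_smul_right]
  have h1 := hasSum_inner_cre f φ (cre u ψ)
  rw [inner_cre_left] at h1
  have h2 := (lp.hasSum_inner u f).mul_right ⟪ψ, φ⟫_ℂ
  refine h1.unique ((h2.add (hasSum_inner_cre f _ ψ)).congr_fun fun i => ?_)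
  rw [inner_cre_left, inner_ann_cre_mode, RCLike.inner_apply]
  by_cases h : modeDeg i = α
  · rw [h]; ring
  · rw [hf i h]; ring

theorem inner_ann_ann_mode (u : OnePart ι₀ ι₁) (j : ι₀ ⊕ ι₁) (φ ψ : finPart ι₀ ι₁) :
    ⟪ψ, ann u (ann (mode j) φ)⟫_ℂ = ⟪ψ, ann (mode j) (ann (twist (modeDeg j) u) φ)⟫_ℂ := by
  have h1 := hasSum_inner_ann u (ann (mode j) φ) ψ
  have h2 := hasSum_inner_ann (twist (modeDeg j) u) φ (cre (mode j) ψ)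
  rw [inner_cre_left] at h2
  refine h1.unique (h2.congr_fun fun i => ?_)
  rw [ann_ann_mode, fock_inner_smul_right, inner_cre_left, twist_apply, map_mul, conj_modeSign]
  ring

theorem ann_mul_ann {α : Fin 2} {f : OnePart ι₀ ι₁} (hf : IsHom α f) (u : OnePart ι₀ ι₁) :
    ann u * ann f = ann f * ann (twist α u) := by
  refine LinearMap.ext fun φ => ext_inner_left ℂ fun ψ => ?_
  change ⟪ψ, ann u (ann f φ)⟫_ℂ = ⟪ψ, ann f (ann (twist α u) φ)⟫_ℂ
  have h1 := hasSum_inner_ann f φ (cre u ψ)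
  rw [inner_cre_left] at h1
  refine h1.unique ((hasSum_inner_ann f _ ψ).congr_fun fun i => ?_)
  rw [inner_cre_left, inner_ann_ann_mode]
  by_cases h : modeDeg i = α
  · rw [h]
  · rw [hf i h]; simp

theorem cre_mul_cre {α : Fin 2} {f : OnePart ι₀ ι₁} (hf : IsHom α f) (u : OnePart ι₀ ι₁) :
    cre u * cre f = cre f * cre (twist α u) := by
  refine LinearMap.ext fun φ => ext_inner_left ℂ fun ψ => ?_
  change ⟪ψ, cre u (cre f φ)⟫_ℂ = ⟪ψ, cre f (cre (twist α u) φ)⟫_ℂ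
  rw [← inner_ann_left, ← inner_ann_left, ← inner_ann_left, ← inner_ann_left]
  have h := congrArg (fun T => T ψ) (ann_mul_ann hf (twist α u))
  rw [twist_twist] at h
  exact congrArg (fun x => ⟪x, φ⟫_ℂ) h.symm

end CCR
end

noncomputable section

/-! ### Operators that are bounded on each sector, and series of such operators -/

section SectorBounded

variable {ι₀ ι₁ : Type*}

/-- `T` maps every sector boundedly into some sector. -/
def SecBdd (T : Module.End ℂ (finPart ι₀ ι₁)) : Prop :=
  ∀ N, ∃ (M : ℕ) (C : ℝ), ∀ φ : finPart ι₀ ι₁, φ.1 ∈ sector ι₀ ι₁ N →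
    (T φ).1 ∈ sector ι₀ ι₁ M ∧ ‖T φ‖ ≤ C * ‖φ‖

theorem SecBdd.add {T T' : Module.End ℂ (finPart ι₀ ι₁)} (h : SecBdd T) (h' : SecBdd T') :
    SecBdd (T + T') := fun N => by
  obtain ⟨M, C, hC⟩ := h N
  obtain ⟨M', C', hC'⟩ := h' N
  refine ⟨max M M', C + C', fun φ hφ => ⟨?_, ?_⟩⟩
  · exact Submodule.add_mem _ (sector_mono (le_max_left _ _) (hC φ hφ).1)
      (sector_mono (le_max_right _ _) (hC' φ hφ).1)
  · rw [LinearMap.add_apply, add_mul]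
    exact (norm_add_le _ _).trans (add_le_add (hC φ hφ).2 (hC' φ hφ).2)

theorem SecBdd.smul {T : Module.End ℂ (finPart ι₀ ι₁)} (h : SecBdd T) (a : ℂ) :
    SecBdd (a • T) := fun N => by
  obtain ⟨M, C, hC⟩ := h N
  refine ⟨M, ‖a‖ * C, fun φ hφ => ⟨Submodule.smul_mem _ _ (hC φ hφ).1, ?_⟩⟩
  rw [LinearMap.smul_apply, norm_smul, mul_assoc]
  exact mul_le_mul_of_nonneg_left (hC φ hφ).2 (norm_nonneg _)

theorem SecBdd.sub {T T' : Module.End ℂ (finPart ι₀ ι₁)} (h : SecBdd T) (h' : SecBdd T') :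
    SecBdd (T - T') := by
  have h1 : T - T' = T + (-1 : ℂ) • T' := LinearMap.ext fun φ => by
    rw [LinearMap.add_apply, LinearMap.smul_apply, neg_one_smul, LinearMap.sub_apply,
      sub_eq_add_neg]
  rw [h1]
  exact h.add (h'.smul (-1))

theorem SecBdd.one : SecBdd (1 : Module.End ℂ (finPart ι₀ ι₁)) := fun N =>
  ⟨N, 1, fun φ hφ => ⟨hφ, by rw [one_mul]; exact le_rfl⟩⟩

theorem SecBdd.mul {T T' : Module.End ℂ (finPart ι₀ ι₁)} (h : SecBdd T) (h' : SecBdd T') :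
    SecBdd (T * T') := fun N => by
  obtain ⟨M, C, hC⟩ := h' N
  obtain ⟨M', C', hC'⟩ := h M
  refine ⟨M', |C'| * C, fun φ hφ => ⟨(hC' _ (hC φ hφ).1).1, ?_⟩⟩
  refine ((hC' _ (hC φ hφ).1).2.trans
    (mul_le_mul_of_nonneg_right (le_abs_self C') (norm_nonneg _))).trans ?_
  rw [mul_assoc]
  exact mul_le_mul_of_nonneg_left (hC φ hφ).2 (abs_nonneg _)

/-- The operators concerned are unbounded on `finPart`; limits pass through them only along families
that stay in one sector. -/
theorem SecBdd.tendsto {T : Module.End ℂ (finPart ι₀ ι₁)} (h : SecBdd T) {α : Type*}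
    {l : Filter α} {x : α → finPart ι₀ ι₁} {y : finPart ι₀ ι₁} {N : ℕ}
    (hx : ∀ i, (x i).1 ∈ sector ι₀ ι₁ N) (hy : Tendsto x l (𝓝 y)) :
    Tendsto (fun i => T (x i)) l (𝓝 (T y)) := by
  obtain ⟨K, hK⟩ := exists_mem_sector y
  -- The limit is only known to lie in some sector K, so the estimate is made in a sector that
  -- contains both it and the family.
  obtain ⟨M, C, hC⟩ := h (max N K)
  rw [tendsto_iff_norm_sub_tendsto_zero] at hy ⊢
  have h0 := hy.const_mul C
  rw [mul_zero] at h0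
  refine squeeze_zero (fun _ => norm_nonneg _) (fun i => ?_) h0
  rw [← map_sub]
  exact (hC _ (Submodule.sub_mem _ (sector_mono (le_max_left _ _) (hx i))
    (sector_mono (le_max_right _ _) hK))).2

theorem coe_finPart_sum {κ : Type*} (s : Finset κ) (x : κ → finPart ι₀ ι₁) :
    (∑ n ∈ s, x n).1 = ∑ n ∈ s, (x n).1 := map_sum (finPart ι₀ ι₁).subtype _ _

theorem sum_mem_sector {κ : Type*} {s : Finset κ} {x : κ → finPart ι₀ ι₁} {N : ℕ}
    (hx : ∀ n ∈ s, (x n).1 ∈ sector ι₀ ι₁ N) : (∑ n ∈ s, x n).1 ∈ sector ι₀ ι₁ N := by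
  rw [coe_finPart_sum]; exact Submodule.sum_mem _ hx

theorem SecBdd.hasSum {T : Module.End ℂ (finPart ι₀ ι₁)} (h : SecBdd T) {κ : Type*}
    {x : κ → finPart ι₀ ι₁} {y : finPart ι₀ ι₁} {N : ℕ}
    (hx : ∀ n, (x n).1 ∈ sector ι₀ ι₁ N) (hy : HasSum x y) :
    HasSum (fun n => T (x n)) (T y) := by
  have := h.tendsto (fun s => sum_mem_sector (s := s) fun n _ => hx n) hy
  refine this.congr fun s => ?_
  rw [map_sum]

theorem hasSum_finPart_apply {κ : Type*} {x : κ → finPart ι₀ ι₁} {y : finPart ι₀ ι₁}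
    (h : HasSum x y) (c : Config ι₀ ι₁) : HasSum (fun n => (x n).1 c) (y.1 c) := by
  have h1 : HasSum (fun n => (x n).1) y.1 := h.mapL (finPart ι₀ ι₁).subtypeL
  have h2 := ((continuous_fock_apply c).tendsto y.1).comp h1
  refine h2.congr fun s => ?_
  rw [Function.comp_apply, lp.coeFn_sum, Finset.sum_apply]

/-- The bound turns the Cauchy criterion for r into the one for x in the complete Fock space;
closedness of the sector then puts the sum back into `finPart`. -/
theorem summable_finPart_of_sq_bound {κ : Type*} {x : κ → finPart ι₀ ι₁} {N : ℕ}
    (hx : ∀ n, (x n).1 ∈ sector ι₀ ι₁ N) {r : κ → ℝ} (hr : Summable r) (C : ℝ)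
    (h : ∀ s : Finset κ, ‖∑ n ∈ s, x n‖ ^ 2 ≤ C * ∑ n ∈ s, r n) : Summable x := by
  have h1 : Summable fun n => (x n).1 := by
    rw [summable_iff_vanishing_norm]
    intro ε hε
    obtain ⟨s, hs⟩ := summable_iff_vanishing_norm.1 (hr.mul_left C) (ε ^ 2) (by positivity)
    refine ⟨s, fun t ht => ?_⟩
    have h2 := (h t).trans_lt ((le_abs_self _).trans_lt (by
      rw [Finset.mul_sum]; exact hs t ht))
    rw [← coe_finPart_sum]
    exact lt_of_pow_lt_pow_left₀ 2 hε.le h2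
  obtain ⟨y, hy⟩ := h1
  have hmem : y ∈ sector ι₀ ι₁ N := (isClosed_sector N).mem_of_tendsto hy
    (Eventually.of_forall fun s => Submodule.sum_mem _ fun n _ => hx n)
  refine ⟨⟨y, mem_finPart_of_mem_sector hmem⟩, ?_⟩
  change Tendsto _ _ _
  rw [tendsto_subtype_rng]
  refine hy.congr fun s => ?_
  exact (coe_finPart_sum s x).symm

/-- A series of operators that converges strongly, with partial sums uniformly bounded on each
sector. -/
structure GoodSeries {κ : Type*} (T : κ → Module.End ℂ (finPart ι₀ ι₁)) : Prop where
  summable : ∀ φ, Summable fun n => T n φ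
  bdd : ∀ N, ∃ (M : ℕ) (C : ℝ), ∀ φ : finPart ι₀ ι₁, φ.1 ∈ sector ι₀ ι₁ N → ∀ s : Finset κ,
    (∑ n ∈ s, T n φ).1 ∈ sector ι₀ ι₁ M ∧ ‖∑ n ∈ s, T n φ‖ ≤ C * ‖φ‖

open Classical in
/-- The sum of a strongly convergent series of operators (zero if it does not converge). -/
def opSum {κ : Type*} (T : κ → Module.End ℂ (finPart ι₀ ι₁)) : Module.End ℂ (finPart ι₀ ι₁) :=
  if h : ∀ φ, Summable fun n => T n φ then
    { toFun := fun φ => ∑' n, T n φ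
      map_add' := fun φ ψ => by
        simp only [map_add]; exact (h φ).tsum_add (h ψ)
      map_smul' := fun a φ => by
        simp only [map_smul]; exact (h φ).tsum_const_smul a }
  else 0

theorem GoodSeries.hasSum {κ : Type*} {T : κ → Module.End ℂ (finPart ι₀ ι₁)} (h : GoodSeries T)
    (φ : finPart ι₀ ι₁) : HasSum (fun n => T n φ) (opSum T φ) := by
  rw [opSum, dif_pos h.summable]
  exact (h.summable φ).hasSum

theorem GoodSeries.secBdd {κ : Type*} {T : κ → Module.End ℂ (finPart ι₀ ι₁)}
    (h : GoodSeries T) : SecBdd (opSum T) := fun N => by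
  obtain ⟨M, C, hC⟩ := h.bdd N
  refine ⟨M, C, fun φ hφ => ⟨?_, ?_⟩⟩
  · have h1 : HasSum (fun n => (T n φ).1) (opSum T φ).1 :=
      (h.hasSum φ).mapL (finPart ι₀ ι₁).subtypeL
    refine (isClosed_sector M).mem_of_tendsto h1 (Eventually.of_forall fun s => ?_)
    rw [← coe_finPart_sum]
    exact (hC φ hφ s).1
  · exact le_of_tendsto (h.hasSum φ).norm (Eventually.of_forall fun s => (hC φ hφ s).2)

theorem GoodSeries.hasSum_map {κ : Type*} {T : κ → Module.End ℂ (finPart ι₀ ι₁)}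
    (h : GoodSeries T) {A : Module.End ℂ (finPart ι₀ ι₁)} (hA : SecBdd A) (φ : finPart ι₀ ι₁) :
    HasSum (fun n => A (T n φ)) (A (opSum T φ)) := by
  obtain ⟨N, hN⟩ := exists_mem_sector φ
  obtain ⟨M, C, hC⟩ := h.bdd N
  refine hA.hasSum (N := M) (fun n => ?_) (h.hasSum φ)
  have := (hC φ hN {n}).1
  rwa [Finset.sum_singleton] at this

theorem GoodSeries.add {κ : Type*} {T T' : κ → Module.End ℂ (finPart ι₀ ι₁)}
    (h : GoodSeries T) (h' : GoodSeries T') : GoodSeries fun n => T n + T' n where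
  summable φ := (h.summable φ).add (h'.summable φ)
  bdd N := by
    obtain ⟨M, C, hC⟩ := h.bdd N
    obtain ⟨M', C', hC'⟩ := h'.bdd N
    refine ⟨max M M', C + C', fun φ hφ s => ?_⟩
    have h1 : ∑ n ∈ s, (T n + T' n) φ = ∑ n ∈ s, T n φ + ∑ n ∈ s, T' n φ :=
      Finset.sum_add_distrib
    rw [h1, add_mul]
    exact ⟨Submodule.add_mem _ (sector_mono (le_max_left _ _) (hC φ hφ s).1)
      (sector_mono (le_max_right _ _) (hC' φ hφ s).1),
      (norm_add_le _ _).trans (add_le_add (hC φ hφ s).2 (hC' φ hφ s).2)⟩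

theorem GoodSeries.smul {κ : Type*} {T : κ → Module.End ℂ (finPart ι₀ ι₁)}
    (h : GoodSeries T) (a : ℂ) : GoodSeries fun n => a • T n where
  summable φ := (h.summable φ).const_smul a
  bdd N := by
    obtain ⟨M, C, hC⟩ := h.bdd N
    refine ⟨M, ‖a‖ * C, fun φ hφ s => ?_⟩
    have h1 : ∑ n ∈ s, (a • T n) φ = a • ∑ n ∈ s, T n φ := by
      rw [Finset.smul_sum]; rfl
    rw [h1, norm_smul, mul_assoc]
    exact ⟨Submodule.smul_mem _ _ (hC φ hφ s).1,
      mul_le_mul_of_nonneg_left (hC φ hφ s).2 (norm_nonneg _)⟩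

/-- A vector concentrated on one configuration. -/
def configVec (c : Config ι₀ ι₁) : finPart ι₀ ι₁ :=
  ⟨open Classical in lp.single 2 c 1, ⟨c.number, fun d hd => by
    classical
    rw [lp.single_apply, Pi.single_apply, if_neg]
    rintro rfl; omega⟩⟩

open Classical in
theorem configVec_apply (c d : Config ι₀ ι₁) :
    (configVec c).1 d = if d = c then 1 else 0 := by
  change (lp.single (E := fun _ : Config ι₀ ι₁ => ℂ) 2 c 1 : Fock ι₀ ι₁) d = _
  rw [lp.single_apply, Pi.single_apply]

theorem configVec_zero : (configVec (0, ∅) : finPart ι₀ ι₁) = vacuum := by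
  apply Subtype.ext; apply lp.ext; funext c
  rw [configVec_apply]; rfl

theorem hasSum_configVec (φ : finPart ι₀ ι₁) : HasSum (fun c => φ.1 c • configVec c) φ := by
  classical
  have h := lp.hasSum_single (p := 2) (by norm_num) φ.1
  change Tendsto _ _ _
  rw [tendsto_subtype_rng]
  refine h.congr fun s => ?_
  rw [coe_finPart_sum]
  refine Finset.sum_congr rfl fun c _ => ?_
  apply lp.ext; funext d
  rw [Submodule.coe_smul, lp.coeFn_smul, Pi.smul_apply, configVec_apply, lp.single_apply,
    Pi.single_apply]
  split_ifs with h
  · subst h; simp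
  · simp

theorem SecBdd.eq_zero_of_configVec {T : Module.End ℂ (finPart ι₀ ι₁)} (h : SecBdd T)
    (h0 : ∀ c, T (configVec c) = 0) : T = 0 := by
  classical
  refine LinearMap.ext fun φ => ?_
  obtain ⟨N, hN⟩ := exists_mem_sector φ
  have h1 := h.hasSum (N := N) (fun c => ?_) (hasSum_configVec φ)
  · rw [LinearMap.zero_apply]
    refine h1.unique ?_
    simp only [map_smul, h0, smul_zero]
    exact hasSum_zero
  · intro d hd
    rw [Submodule.coe_smul, lp.coeFn_smul, Pi.smul_apply, configVec_apply]
    split_ifs with hdc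
    · subst hdc; rw [hN _ hd]; simp
    · simp

theorem vacuum_mem_sector : (vacuum : finPart ι₀ ι₁).1 ∈ sector ι₀ ι₁ 0 := by
  intro c hc
  rw [← configVec_zero, configVec_apply, if_neg]
  rintro rfl
  simp [Config.number] at hc

/-- The component along the vacuum. -/
def vacCoeff (φ : finPart ι₀ ι₁) : ℂ := φ.1 (0, ∅)

@[simp]
theorem vacCoeff_vacuum : vacCoeff (vacuum : finPart ι₀ ι₁) = 1 := by
  rw [vacCoeff, ← configVec_zero, configVec_apply, if_pos rfl]

@[simp]
theorem vacCoeff_add (φ ψ : finPart ι₀ ι₁) : vacCoeff (φ + ψ) = vacCoeff φ + vacCoeff ψ := rfl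

@[simp]
theorem vacCoeff_sub (φ ψ : finPart ι₀ ι₁) : vacCoeff (φ - ψ) = vacCoeff φ - vacCoeff ψ := rfl

@[simp]
theorem vacCoeff_smul (a : ℂ) (φ : finPart ι₀ ι₁) : vacCoeff (a • φ) = a * vacCoeff φ := rfl

theorem vacCoeff_eq_inner (φ : finPart ι₀ ι₁) : vacCoeff φ = ⟪vacuum, φ⟫_ℂ := by
  classical
  rw [← configVec_zero]
  change _ = ⟪(lp.single (E := fun _ : Config ι₀ ι₁ => ℂ) 2 ((0, ∅) : Config ι₀ ι₁) 1 :
    Fock ι₀ ι₁), φ.1⟫_ℂ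
  rw [lp.inner_single_left]
  simp [vacCoeff]

variable [LinearOrder ι₁]

theorem secBdd_cre (f : OnePart ι₀ ι₁) : SecBdd (cre f) := fun N => by
  refine ⟨N + 1, ‖f‖ * Real.sqrt (N + 1), fun φ hφ => ⟨cre_mem_sector f hφ, ?_⟩⟩
  refine le_of_sq_le_sq ?_ (by positivity)
  refine (norm_cre_sq_le f hφ).trans_eq ?_
  rw [mul_pow, mul_pow, Real.sq_sqrt (by positivity)]

theorem secBdd_ann (f : OnePart ι₀ ι₁) : SecBdd (ann f) := fun N => by
  refine ⟨N, ‖f‖ * Real.sqrt N, fun φ hφ => ⟨ann_mem_sector f hφ, ?_⟩⟩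
  refine le_of_sq_le_sq ?_ (by positivity)
  refine (norm_ann_sq_le f hφ).trans_eq ?_
  rw [mul_pow, mul_pow, Real.sq_sqrt (by positivity)]; ring

/-- A subspace that contains the vacuum and is stable under the creation operators contains all
configurations. -/
theorem configVec_mem_span (p : Submodule ℂ (finPart ι₀ ι₁)) (h0 : vacuum ∈ p)
    (h1 : ∀ i, ∀ φ ∈ p, cre (mode i) φ ∈ p) (c : Config ι₀ ι₁) : configVec c ∈ p := by
  induction hn : c.number generalizing c with
  | zero =>
    have : c = (0, ∅) := by
      by_contra hc
      have hne : c.occupied.Nonempty := by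
        by_contra h
        rw [Finset.not_nonempty_iff_eq_empty, Config.occupied, Finset.disjSum_eq_empty] at h
        exact hc (Prod.ext (Finsupp.support_eq_empty.1 h.1) h.2)
      obtain ⟨i, hi⟩ := hne
      have := Config.number_lower hi
      omega
    rw [this, configVec_zero]; exact h0
  | succ n ih =>
    have hne : c.occupied.Nonempty := by
      by_contra h
      have := Config.sum_creAmp_sq c
      rw [Finset.not_nonempty_iff_eq_empty.1 h, hn, Finset.sum_empty] at this
      norm_cast at this
    obtain ⟨i, hi⟩ := hne
    have h2 := ih (c.lower i) (by have := Config.number_lower hi; omega)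
    -- Putting back the particle in an occupied mode i reproduces c up to the nonzero amplitude, so
    -- the induction runs over the particle number.
    have h3 : configVec c = (c.creAmp i)⁻¹ • cre (mode i) (configVec (c.lower i)) := by
      classical
      apply Subtype.ext; apply lp.ext; funext d
      rw [Submodule.coe_smul, lp.coeFn_smul, Pi.smul_apply, cre_mode_apply, configVec_apply,
        configVec_apply, smul_eq_mul]
      by_cases hd : d = c
      · subst hd
        simp [hi, Config.creAmp_ne_zero hi]
      · rw [if_neg hd]
        by_cases hid : i ∈ d.occupied
        · rw [if_pos hid, if_neg, mul_zero, mul_zero]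
          intro h
          exact hd (by rw [← Config.raise_lower hid, h, Config.raise_lower hi])
        · rw [if_neg hid, mul_zero]
    rw [h3]
    exact Submodule.smul_mem _ _ (h1 i _ h2)

/-- Irreducibility: a sector-bounded operator is zero if it vanishes at the vacuum and the
space it annihilates is stable under the creation operators. -/
theorem SecBdd.eq_zero {T : Module.End ℂ (finPart ι₀ ι₁)} (h : SecBdd T) (h0 : T vacuum = 0)
    (h1 : ∀ i φ, T φ = 0 → T (cre (mode i) φ) = 0) : T = 0 :=
  h.eq_zero_of_configVec fun c =>
    configVec_mem_span (LinearMap.ker T) h0 (fun i φ hφ => h1 i φ hφ) c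

@[simp]
theorem ann_vacuum (f : OnePart ι₀ ι₁) : ann f vacuum = 0 := by
  have := norm_ann_sq_le f (vacuum_mem_sector (ι₀ := ι₀) (ι₁ := ι₁))
  simpa using this

@[simp]
theorem vacCoeff_cre (f : OnePart ι₀ ι₁) (φ : finPart ι₀ ι₁) : vacCoeff (cre f φ) = 0 := by
  rw [vacCoeff_eq_inner, ← inner_ann_left, ann_vacuum, inner_zero_left]

/-- A vector annihilated by all modes is a multiple of the vacuum. -/
theorem eq_smul_vacuum {φ : finPart ι₀ ι₁} (h : ∀ i, ann (mode i) φ = 0) :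
    φ = vacCoeff φ • vacuum := by
  classical
  apply Subtype.ext; apply lp.ext; funext c
  rw [Submodule.coe_smul, lp.coeFn_smul, Pi.smul_apply, ← configVec_zero, configVec_apply]
  split_ifs with hc
  · subst hc; simp [vacCoeff]
  · have hne : c.occupied.Nonempty := by
      by_contra h'
      rw [Finset.not_nonempty_iff_eq_empty, Config.occupied, Finset.disjSum_eq_empty] at h'
      exact hc (Prod.ext (Finsupp.support_eq_empty.1 h'.1) h'.2)
    obtain ⟨i, hi⟩ := hne
    have h1 := ann_mode_apply i φ (c.lower i)
    rw [h i, Config.raise_lower hi, Config.annAmp_lower hi] at h1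
    rw [smul_zero]
    exact (mul_eq_zero.1 h1.symm).resolve_left (Config.creAmp_ne_zero hi)

/-! ### Quadratic series -/

/-- The annihilators make ‖a(vₙ)φ‖ square summable and the creators cost only a Bessel constant, so
a bounded kernel is enough: no Hilbert–Schmidt condition falls on PXP. -/
theorem goodSeries_cre_ann {κ : Type*} {B B' : ℝ} {u v : κ → OnePart ι₀ ι₁}
    (hu : IsBessel B u) (hB : 0 ≤ B) (hv : IsBessel B' v) (hB' : 0 ≤ B') :
    GoodSeries fun n => cre (u n) * ann (v n) := by
  have key : ∀ (N : ℕ) (φ : finPart ι₀ ι₁), φ.1 ∈ sector ι₀ ι₁ N → ∀ s : Finset κ,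
      ‖∑ n ∈ s, (cre (u n) * ann (v n)) φ‖ ^ 2
        ≤ B * (N + 1) * ∑ n ∈ s, ‖ann (v n) φ‖ ^ 2 := fun N φ hφ s =>
    norm_sum_cre_sq_le hu hB (χ := fun n => ann (v n) φ) s fun n _ => ann_mem_sector _ hφ
  have hsec : ∀ (N : ℕ) (φ : finPart ι₀ ι₁), φ.1 ∈ sector ι₀ ι₁ N → ∀ n,
      ((cre (u n) * ann (v n)) φ).1 ∈ sector ι₀ ι₁ (N + 1) := fun N φ hφ n =>
    cre_mem_sector _ (ann_mem_sector _ hφ)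
  constructor
  · intro φ
    obtain ⟨N, hN⟩ := exists_mem_sector φ
    exact summable_finPart_of_sq_bound (hsec N φ hN) (summable_norm_ann_sq hv hB' φ) _
      (key N φ hN)
  · intro N
    refine ⟨N + 1, Real.sqrt (B * (N + 1) * (B' * N)), fun φ hφ s =>
      ⟨sum_mem_sector fun n _ => hsec N φ hφ n, le_of_sq_le_sq ?_ (by positivity)⟩⟩
    rw [mul_pow, Real.sq_sqrt (by positivity)]
    refine (key N φ hφ s).trans ?_
    rw [mul_assoc _ (B' * N), mul_assoc B']
    exact mul_le_mul_of_nonneg_left (sum_norm_ann_sq_le hv hB' hφ s) (by positivity)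

/-- Here the inner factor a†(fₙ)φ does not decay by itself; its square summability must come from
∑‖fₙ‖², and this is where the Hilbert–Schmidt condition enters. -/
theorem goodSeries_cre_cre {κ : Type*} {B : ℝ} {u f : κ → OnePart ι₀ ι₁}
    (hu : IsBessel B u) (hB : 0 ≤ B) (hf : Summable fun n => ‖f n‖ ^ 2) :
    GoodSeries fun n => cre (u n) * cre (f n) := by
  -- The factor N + 1 comes from the inner creation operator, N + 2 from the outer one, which acts
  -- on at most N + 1 particles.
  have key : ∀ (N : ℕ) (φ : finPart ι₀ ι₁), φ.1 ∈ sector ι₀ ι₁ N → ∀ s : Finset κ,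
      ‖∑ n ∈ s, (cre (u n) * cre (f n)) φ‖ ^ 2
        ≤ (B * (N + 2) * (N + 1) * ‖φ‖ ^ 2) * ∑ n ∈ s, ‖f n‖ ^ 2 := fun N φ hφ s => by
    refine (norm_sum_cre_sq_le hu hB (χ := fun n => cre (f n) φ) s
      fun n _ => cre_mem_sector _ hφ).trans ?_
    rw [Finset.mul_sum, Finset.mul_sum]
    refine Finset.sum_le_sum fun n _ => ?_
    refine (mul_le_mul_of_nonneg_left (norm_cre_sq_le (f n) hφ) (by positivity)).trans_eq ?_
    push_cast; ring
  have hsec : ∀ (N : ℕ) (φ : finPart ι₀ ι₁), φ.1 ∈ sector ι₀ ι₁ N → ∀ n,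
      ((cre (u n) * cre (f n)) φ).1 ∈ sector ι₀ ι₁ (N + 1 + 1) := fun N φ hφ n =>
    cre_mem_sector _ (cre_mem_sector _ hφ)
  constructor
  · intro φ
    obtain ⟨N, hN⟩ := exists_mem_sector φ
    exact summable_finPart_of_sq_bound (hsec N φ hN) hf _ (key N φ hN)
  · intro N
    have h0 : 0 ≤ ∑' n, ‖f n‖ ^ 2 := tsum_nonneg fun _ => sq_nonneg _
    refine ⟨N + 1 + 1, Real.sqrt (B * (N + 2) * (N + 1) * ∑' n, ‖f n‖ ^ 2), fun φ hφ s =>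
      ⟨sum_mem_sector fun n _ => hsec N φ hφ n, le_of_sq_le_sq ?_ (by positivity)⟩⟩
    rw [mul_pow, Real.sq_sqrt (by positivity)]
    refine (key N φ hφ s).trans ?_
    rw [mul_right_comm]
    refine mul_le_mul_of_nonneg_right (mul_le_mul_of_nonneg_left ?_ (by positivity)) (sq_nonneg _)
    exact hf.sum_le_tsum s fun _ _ => sq_nonneg _

/-- The triangle inequality suffices: ‖a(fₙ)a(uₙ)φ‖ ≤ √N ‖fₙ‖‖a(uₙ)φ‖ is a product of two square
summable families. -/
theorem goodSeries_ann_ann {κ : Type*} {B : ℝ} {u f : κ → OnePart ι₀ ι₁}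
    (hu : IsBessel B u) (hB : 0 ≤ B) (hf : Summable fun n => ‖f n‖ ^ 2) :
    GoodSeries fun n => ann (f n) * ann (u n) := by
  have key : ∀ (N : ℕ) (φ : finPart ι₀ ι₁), φ.1 ∈ sector ι₀ ι₁ N → ∀ s : Finset κ,
      ‖∑ n ∈ s, (ann (f n) * ann (u n)) φ‖ ^ 2
        ≤ (N * (B * (N * ‖φ‖ ^ 2))) * ∑ n ∈ s, ‖f n‖ ^ 2 := fun N φ hφ s => by
    have h1 : ‖∑ n ∈ s, (ann (f n) * ann (u n)) φ‖
        ≤ ∑ n ∈ s, ‖f n‖ * (Real.sqrt N * ‖ann (u n) φ‖) := by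
      refine (norm_sum_le _ _).trans (Finset.sum_le_sum fun n _ => ?_)
      refine le_of_sq_le_sq ?_ (by positivity)
      refine (norm_ann_sq_le (f n) (ann_mem_sector (u n) hφ)).trans_eq ?_
      rw [mul_pow, mul_pow, Real.sq_sqrt (by positivity)]
    refine (pow_le_pow_left₀ (norm_nonneg _) h1 2).trans
      ((Finset.sum_mul_sq_le_sq_mul_sq _ _ _).trans ?_)
    rw [mul_comm]
    refine mul_le_mul_of_nonneg_right ?_ (Finset.sum_nonneg fun _ _ => sq_nonneg _)
    simp only [mul_pow]
    rw [← Finset.mul_sum, Real.sq_sqrt (by positivity)]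
    exact mul_le_mul_of_nonneg_left (sum_norm_ann_sq_le hu hB hφ s) (by positivity)
  have hsec : ∀ (N : ℕ) (φ : finPart ι₀ ι₁), φ.1 ∈ sector ι₀ ι₁ N → ∀ n,
      ((ann (f n) * ann (u n)) φ).1 ∈ sector ι₀ ι₁ N := fun N φ hφ n =>
    ann_mem_sector _ (ann_mem_sector _ hφ)
  constructor
  · intro φ
    obtain ⟨N, hN⟩ := exists_mem_sector φ
    exact summable_finPart_of_sq_bound (hsec N φ hN) hf _ (key N φ hN)
  · intro N
    have h0 : 0 ≤ ∑' n, ‖f n‖ ^ 2 := tsum_nonneg fun _ => sq_nonneg _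
    refine ⟨N, Real.sqrt (N * (B * N) * ∑' n, ‖f n‖ ^ 2), fun φ hφ s =>
      ⟨sum_mem_sector fun n _ => hsec N φ hφ n, le_of_sq_le_sq ?_ (by positivity)⟩⟩
    rw [mul_pow, Real.sq_sqrt (by positivity)]
    refine (key N φ hφ s).trans ?_
    have h1 : (N * (B * (N * ‖φ‖ ^ 2)) : ℝ) = N * (B * N) * ‖φ‖ ^ 2 := by ring
    rw [h1, mul_right_comm]
    refine mul_le_mul_of_nonneg_right (mul_le_mul_of_nonneg_left ?_ (by positivity)) (sq_nonneg _)
    exact hf.sum_le_tsum s fun _ _ => sq_nonneg _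

end SectorBounded
end

/-! ### Twisted kernels, the quadratic operators and their independence of the basis. -/

noncomputable section

section Quadratic

variable {ι₀ ι₁ : Type*}

theorem twist_zero (f : OnePart ι₀ ι₁) : twist 0 f = f := by
  apply lp.ext; funext i
  rw [twist_apply]; simp [modeSign]

theorem isHom_add_twist (f : OnePart ι₀ ι₁) : IsHom 0 (f + twist 1 f) := fun i hi => by
  rcases i with i | j
  · exact absurd rfl hi
  · rw [lp.coeFn_add, Pi.add_apply, twist_apply]; simp [modeSign, modeDeg]

theorem isHom_sub_twist (f : OnePart ι₀ ι₁) : IsHom 1 (f - twist 1 f) := fun i hi => by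
  rcases i with i | j
  · rw [lp.coeFn_sub, Pi.sub_apply, twist_apply]; simp [modeSign, modeDeg]
  · exact absurd rfl hi

/-- `γ^α Z γ^α`. -/
def conjTwist (α : Fin 2) (Z : OnePart ι₀ ι₁ →L[ℂ] OnePart ι₀ ι₁) :
    OnePart ι₀ ι₁ →L[ℂ] OnePart ι₀ ι₁ :=
  (twist α).toContinuousLinearMap.comp (Z.comp (twist α).toContinuousLinearMap)

/-- `γ^α K γ^α` for antilinear `K`. -/
def conjTwistₛ (α : Fin 2) (K : OnePart ι₀ ι₁ →L⋆[ℂ] OnePart ι₀ ι₁) :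
    OnePart ι₀ ι₁ →L⋆[ℂ] OnePart ι₀ ι₁ :=
  (twist α).toContinuousLinearMap.comp (K.comp (twist α).toContinuousLinearMap)

@[simp]
theorem conjTwist_apply (α : Fin 2) (Z : OnePart ι₀ ι₁ →L[ℂ] OnePart ι₀ ι₁)
    (f : OnePart ι₀ ι₁) : conjTwist α Z f = twist α (Z (twist α f)) := rfl

@[simp]
theorem conjTwistₛ_apply (α : Fin 2) (K : OnePart ι₀ ι₁ →L⋆[ℂ] OnePart ι₀ ι₁)
    (f : OnePart ι₀ ι₁) : conjTwistₛ α K f = twist α (K (twist α f)) := rfl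

/-- The antilinear operator `K` is Hilbert–Schmidt. -/
def ModeHS (K : OnePart ι₀ ι₁ →L⋆[ℂ] OnePart ι₀ ι₁) : Prop :=
  Summable fun i => ‖K (mode i)‖ ^ 2

theorem conjTwistₛ_mode (α : Fin 2) (K : OnePart ι₀ ι₁ →L⋆[ℂ] OnePart ι₀ ι₁) (i : ι₀ ⊕ ι₁) :
    conjTwistₛ α K (mode i) = modeSign α i • twist α (K (mode i)) := by
  rw [conjTwistₛ_apply, twist_mode, map_smulₛₗ, map_smul, conj_modeSign]

theorem conjTwist_mode (α : Fin 2) (Z : OnePart ι₀ ι₁ →L[ℂ] OnePart ι₀ ι₁) (i : ι₀ ⊕ ι₁) :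
    conjTwist α Z (mode i) = modeSign α i • twist α (Z (mode i)) := by
  rw [conjTwist_apply, twist_mode, map_smul, map_smul]

theorem ModeHS.conjTwist {K : OnePart ι₀ ι₁ →L⋆[ℂ] OnePart ι₀ ι₁} (h : ModeHS K) (α : Fin 2) :
    ModeHS (conjTwistₛ α K) := by
  refine Summable.congr h fun i => ?_
  rw [conjTwistₛ_mode, norm_smul, norm_modeSign, one_mul, LinearIsometry.norm_map]

theorem IsBessel.twist {κ : Type*} {B : ℝ} {u : κ → OnePart ι₀ ι₁} (hu : IsBessel B u)
    (α : Fin 2) : IsBessel B fun n => twist α (u n) := fun s x => by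
  simp only [inner_twist_left]
  exact (hu s _).trans_eq (by rw [LinearIsometry.norm_map])

theorem coe_modes : ⇑(modes ι₀ ι₁) = mode := funext modes_apply

theorem hasSum_apply_onePart {κ : Type*} {x : κ → OnePart ι₀ ι₁} {y : OnePart ι₀ ι₁}
    (h : HasSum x y) (i : ι₀ ⊕ ι₁) : HasSum (fun n => x n i) (y i) := by
  have h1 := h.mapL (innerSL ℂ (mode i))
  simp only [innerSL_apply_apply, inner_mode_left] at h1
  exact h1

/-- For antilinear K the tensor ∑ K eₙ ⊗ eₙ does not depend on the basis: expanding δⱼ produces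
conjugate coefficients, which K conjugates back. For this reason the pair kernels are taken
antilinear. -/
theorem hasSum_mul_apply {κ : Type*} (e : HilbertBasis κ ℂ (OnePart ι₀ ι₁))
    (K : OnePart ι₀ ι₁ →L⋆[ℂ] OnePart ι₀ ι₁) (i j : ι₀ ⊕ ι₁) :
    HasSum (fun n => K (e n) i * e n j) (K (mode j) i) := by
  have h1 := hasSum_apply_onePart ((e.hasSum_repr (mode j)).mapL K) i
  refine h1.congr_fun fun n => ?_
  rw [map_smulₛₗ, lp.coeFn_smul, Pi.smul_apply, smul_eq_mul, e.repr_apply_apply,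
    inner_mode_right, Complex.conj_conj, mul_comm]

variable [LinearOrder ι₁]

/-! ### Elementwise commutation relations -/

theorem ann_cre {α : Fin 2} {f : OnePart ι₀ ι₁} (hf : IsHom α f) (u : OnePart ι₀ ι₁)
    (φ : finPart ι₀ ι₁) :
    ann u (cre f φ) = ⟪u, f⟫_ℂ • φ + cre f (ann (twist α u) φ) :=
  LinearMap.congr_fun (ann_mul_cre hf u) φ

theorem ann_ann {α : Fin 2} {f : OnePart ι₀ ι₁} (hf : IsHom α f) (u : OnePart ι₀ ι₁)
    (φ : finPart ι₀ ι₁) : ann u (ann f φ) = ann f (ann (twist α u) φ) :=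
  LinearMap.congr_fun (ann_mul_ann hf u) φ

theorem cre_cre {α : Fin 2} {f : OnePart ι₀ ι₁} (hf : IsHom α f) (u : OnePart ι₀ ι₁)
    (φ : finPart ι₀ ι₁) : cre u (cre f φ) = cre f (cre (twist α u) φ) :=
  LinearMap.congr_fun (cre_mul_cre hf u) φ

theorem cre_ann {α : Fin 2} {f : OnePart ι₀ ι₁} (hf : IsHom α f) (u : OnePart ι₀ ι₁)
    (φ : finPart ι₀ ι₁) :
    cre u (ann f φ) = ann f (cre (twist α u) φ) - ⟪f, twist α u⟫_ℂ • φ := by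
  refine eq_sub_of_add_eq (ext_inner_left ℂ fun ψ => ?_)
  rw [inner_add_right, ← inner_ann_left, ← inner_cre_left, ← inner_cre_left, ← inner_ann_left,
    ann_cre hf, twist_twist, inner_add_left, add_comm, fock_inner_smul_right]
  congr 1
  rw [← inner_conj_symm f]
  exact (inner_smul_left ψ φ _).symm

/-- Split f into its even part (f + γf)/2 and its odd part (f - γf)/2 and commute each past a†(v).
This puts the merely Bessel factor in front, as `goodSeries_cre_cre` requires, and keeps the square
summable one inside. -/
theorem cre_mul_cre_swap (f v : OnePart ι₀ ι₁) :
    cre f * cre v = (1 / 2 : ℂ) • (cre v * cre (f + twist 1 f))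
      + (1 / 2 : ℂ) • (cre (twist 1 v) * cre (f - twist 1 f)) := by
  have h0 := cre_mul_cre (isHom_add_twist f) v
  have h1 := cre_mul_cre (isHom_sub_twist f) (twist 1 v)
  rw [twist_zero] at h0
  rw [twist_twist] at h1
  rw [h0, h1, ← smul_mul_assoc, ← smul_mul_assoc, ← add_mul, ← cre_smul, ← cre_smul, ← cre_add]
  congr 2
  module

theorem goodSeries_cre_cre_swap {κ : Type*} {B : ℝ} {u f : κ → OnePart ι₀ ι₁}
    (hu : IsBessel B u) (hB : 0 ≤ B) (hf : Summable fun n => ‖f n‖ ^ 2) :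
    GoodSeries fun n => cre (f n) * cre (u n) := by
  have h1 : ∀ n, ‖f n + twist 1 (f n)‖ ^ 2 ≤ 4 * ‖f n‖ ^ 2 := fun n => by
    have := norm_add_le (f n) (twist 1 (f n))
    rw [LinearIsometry.norm_map] at this
    nlinarith [norm_nonneg (f n + twist 1 (f n)), norm_nonneg (f n)]
  have h2 : ∀ n, ‖f n - twist 1 (f n)‖ ^ 2 ≤ 4 * ‖f n‖ ^ 2 := fun n => by
    have := norm_sub_le (f n) (twist 1 (f n))
    rw [LinearIsometry.norm_map] at this
    nlinarith [norm_nonneg (f n - twist 1 (f n)), norm_nonneg (f n)]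
  have h3 := goodSeries_cre_cre hu hB
    ((hf.mul_left 4).of_nonneg_of_le (fun _ => sq_nonneg _) h1)
  have h4 := goodSeries_cre_cre (hu.twist 1) hB
    ((hf.mul_left 4).of_nonneg_of_le (fun _ => sq_nonneg _) h2)
  have h5 := (h3.smul (1 / 2)).add (h4.smul (1 / 2))
  simpa only [← cre_mul_cre_swap] using h5

/-! ### The quadratic operators -/

/-- `∑ᵢ a†(Z δᵢ) a(δᵢ)`. -/
def quadCA (Z : OnePart ι₀ ι₁ →L[ℂ] OnePart ι₀ ι₁) : Module.End ℂ (finPart ι₀ ι₁) :=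
  opSum fun i => cre (Z (mode i)) * ann (mode i)

/-- `∑ᵢ a†(K δᵢ) a†(δᵢ)`. -/
def quadCC (K : OnePart ι₀ ι₁ →L⋆[ℂ] OnePart ι₀ ι₁) : Module.End ℂ (finPart ι₀ ι₁) :=
  opSum fun i => cre (K (mode i)) * cre (mode i)

/-- `∑ᵢ a(W δᵢ) a(δᵢ)`. -/
def quadAA (W : OnePart ι₀ ι₁ →L⋆[ℂ] OnePart ι₀ ι₁) : Module.End ℂ (finPart ι₀ ι₁) :=
  opSum fun i => ann (W (mode i)) * ann (mode i)

theorem goodSeries_CA {κ : Type*} {e : κ → OnePart ι₀ ι₁} (he : Orthonormal ℂ e)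
    (Z : OnePart ι₀ ι₁ →L[ℂ] OnePart ι₀ ι₁) : GoodSeries fun n => cre (Z (e n)) * ann (e n) :=
  goodSeries_cre_ann (he.isBessel.map zero_le_one Z) (by positivity) he.isBessel zero_le_one

theorem goodSeries_CC {κ : Type*} {e : κ → OnePart ι₀ ι₁} (he : Orthonormal ℂ e)
    {K : OnePart ι₀ ι₁ →L⋆[ℂ] OnePart ι₀ ι₁} (hK : Summable fun n => ‖K (e n)‖ ^ 2) :
    GoodSeries fun n => cre (K (e n)) * cre (e n) :=
  goodSeries_cre_cre_swap he.isBessel zero_le_one hK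

theorem goodSeries_AA {κ : Type*} {e : κ → OnePart ι₀ ι₁} (he : Orthonormal ℂ e)
    {W : OnePart ι₀ ι₁ →L⋆[ℂ] OnePart ι₀ ι₁} (hW : Summable fun n => ‖W (e n)‖ ^ 2) :
    GoodSeries fun n => ann (W (e n)) * ann (e n) :=
  goodSeries_ann_ann he.isBessel zero_le_one hW

theorem goodSeries_quadCA (Z : OnePart ι₀ ι₁ →L[ℂ] OnePart ι₀ ι₁) :
    GoodSeries fun i : ι₀ ⊕ ι₁ => cre (Z (mode i)) * ann (mode i) :=
  goodSeries_CA orthonormal_mode Z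

theorem goodSeries_quadCC {K : OnePart ι₀ ι₁ →L⋆[ℂ] OnePart ι₀ ι₁} (hK : ModeHS K) :
    GoodSeries fun i : ι₀ ⊕ ι₁ => cre (K (mode i)) * cre (mode i) :=
  goodSeries_CC orthonormal_mode hK

theorem goodSeries_quadAA {W : OnePart ι₀ ι₁ →L⋆[ℂ] OnePart ι₀ ι₁} (hW : ModeHS W) :
    GoodSeries fun i : ι₀ ⊕ ι₁ => ann (W (mode i)) * ann (mode i) :=
  goodSeries_AA orthonormal_mode hW

/-! ### Independence of the basis -/

/-- At a fixed configuration a creation operator is a finite sum over occupied modes, so summing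
over n only expands a vector in the basis e. The value does not mention e; comparison with the
standard basis then gives basis independence. -/
theorem hasSum_coord_CA {κ : Type*} (e : HilbertBasis κ ℂ (OnePart ι₀ ι₁))
    (Z : OnePart ι₀ ι₁ →L[ℂ] OnePart ι₀ ι₁) (φ : finPart ι₀ ι₁) (c : Config ι₀ ι₁) :
    HasSum (fun n => ((cre (Z (e n)) * ann (e n)) φ).1 c)
      (∑ i ∈ c.occupied, c.creAmp i * Z (annVec φ (c.lower i)) i) := by
  have h : ∀ n, ((cre (Z (e n)) * ann (e n)) φ).1 c = ∑ i ∈ c.occupied,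
      c.creAmp i * (⟪e n, annVec φ (c.lower i)⟫_ℂ * Z (e n) i) := fun n => by
    rw [Module.End.mul_apply, cre_apply]
    refine Finset.sum_congr rfl fun i _ => ?_
    rw [ann_apply]; ring
  simp only [h]
  refine hasSum_sum fun i _ => HasSum.mul_left _ ?_
  have h1 := hasSum_apply_onePart ((e.hasSum_repr (annVec φ (c.lower i))).mapL Z) i
  simpa only [map_smul, lp.coeFn_smul, Pi.smul_apply, smul_eq_mul, e.repr_apply_apply] using h1

theorem hasSum_coord_CC {κ : Type*} (e : HilbertBasis κ ℂ (OnePart ι₀ ι₁))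
    (K : OnePart ι₀ ι₁ →L⋆[ℂ] OnePart ι₀ ι₁) (φ : finPart ι₀ ι₁) (c : Config ι₀ ι₁) :
    HasSum (fun n => ((cre (K (e n)) * cre (e n)) φ).1 c)
      (∑ i ∈ c.occupied, ∑ j ∈ (c.lower i).occupied, c.creAmp i * (c.lower i).creAmp j
        * φ.1 ((c.lower i).lower j) * K (mode j) i) := by
  have h : ∀ n, ((cre (K (e n)) * cre (e n)) φ).1 c = ∑ i ∈ c.occupied,
      ∑ j ∈ (c.lower i).occupied, c.creAmp i * (c.lower i).creAmp j
        * φ.1 ((c.lower i).lower j) * (K (e n) i * e n j) := fun n => by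
    rw [Module.End.mul_apply, cre_apply]
    refine Finset.sum_congr rfl fun i _ => ?_
    rw [cre_apply, Finset.mul_sum]
    refine Finset.sum_congr rfl fun j _ => ?_
    ring
  simp only [h]
  exact hasSum_sum fun i _ => hasSum_sum fun j _ => (hasSum_mul_apply e K i j).mul_left _

theorem hasSum_coord_CC_swap {κ : Type*} (e : HilbertBasis κ ℂ (OnePart ι₀ ι₁))
    (K : OnePart ι₀ ι₁ →L⋆[ℂ] OnePart ι₀ ι₁) (φ : finPart ι₀ ι₁) (c : Config ι₀ ι₁) :
    HasSum (fun n => ((cre (e n) * cre (K (e n))) φ).1 c)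
      (∑ i ∈ c.occupied, ∑ j ∈ (c.lower i).occupied, c.creAmp i * (c.lower i).creAmp j
        * φ.1 ((c.lower i).lower j) * K (mode i) j) := by
  have h : ∀ n, ((cre (e n) * cre (K (e n))) φ).1 c = ∑ i ∈ c.occupied,
      ∑ j ∈ (c.lower i).occupied, c.creAmp i * (c.lower i).creAmp j
        * φ.1 ((c.lower i).lower j) * (K (e n) j * e n i) := fun n => by
    rw [Module.End.mul_apply, cre_apply]
    refine Finset.sum_congr rfl fun i _ => ?_
    rw [cre_apply, Finset.mul_sum]
    refine Finset.sum_congr rfl fun j _ => ?_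
    ring
  simp only [h]
  exact hasSum_sum fun i _ => hasSum_sum fun j _ => (hasSum_mul_apply e K j i).mul_left _

theorem hasSum_quadCA {κ : Type*} (e : HilbertBasis κ ℂ (OnePart ι₀ ι₁))
    (Z : OnePart ι₀ ι₁ →L[ℂ] OnePart ι₀ ι₁) (φ : finPart ι₀ ι₁) :
    HasSum (fun n => (cre (Z (e n)) * ann (e n)) φ) (quadCA Z φ) := by
  have h := (goodSeries_CA e.orthonormal Z).hasSum φ
  convert h using 1
  apply Subtype.ext; apply lp.ext; funext c
  have h1 := hasSum_finPart_apply h c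
  have h2 := hasSum_finPart_apply ((goodSeries_quadCA Z).hasSum φ) c
  have h3 := hasSum_coord_CA (modes ι₀ ι₁) Z φ c
  simp only [coe_modes] at h3
  rw [h1.unique (hasSum_coord_CA e Z φ c), ← h2.unique h3]; rfl

theorem hasSum_quadCC {κ : Type*} (e : HilbertBasis κ ℂ (OnePart ι₀ ι₁))
    {K : OnePart ι₀ ι₁ →L⋆[ℂ] OnePart ι₀ ι₁} (hK : ModeHS K)
    (hKe : Summable fun n => ‖K (e n)‖ ^ 2) (φ : finPart ι₀ ι₁) :
    HasSum (fun n => (cre (K (e n)) * cre (e n)) φ) (quadCC K φ) := by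
  have h := (goodSeries_CC e.orthonormal hKe).hasSum φ
  convert h using 1
  apply Subtype.ext; apply lp.ext; funext c
  have h1 := hasSum_finPart_apply h c
  have h2 := hasSum_finPart_apply ((goodSeries_quadCC hK).hasSum φ) c
  have h3 := hasSum_coord_CC (modes ι₀ ι₁) K φ c
  simp only [coe_modes] at h3
  rw [h1.unique (hasSum_coord_CC e K φ c), ← h2.unique h3]; rfl

/-- The components of aa involve infinite sums over modes, unlike those of a†a†. Passing to the
adjoint series reduces basis independence of pair annihilation to the finite sums of
`hasSum_coord_CC_swap`. -/
theorem hasSum_inner_AA {κ : Type*} {e : κ → OnePart ι₀ ι₁} (he : Orthonormal ℂ e)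
    {W : OnePart ι₀ ι₁ →L⋆[ℂ] OnePart ι₀ ι₁} (hW : Summable fun n => ‖W (e n)‖ ^ 2)
    (φ ψ : finPart ι₀ ι₁) :
    HasSum (fun n => ⟪φ, (ann (W (e n)) * ann (e n)) ψ⟫_ℂ)
      ⟪opSum (fun n => cre (e n) * cre (W (e n))) φ, ψ⟫_ℂ := by
  have h := (goodSeries_cre_cre he.isBessel zero_le_one hW).hasSum φ
  have h1 := h.mapL (innerSLFlip ℂ ψ)
  refine h1.congr_fun fun n => ?_
  rw [Module.End.mul_apply, ← inner_cre_left, ← inner_cre_left]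
  rfl

theorem hasSum_quadAA {κ : Type*} (e : HilbertBasis κ ℂ (OnePart ι₀ ι₁))
    {W : OnePart ι₀ ι₁ →L⋆[ℂ] OnePart ι₀ ι₁} (hW : ModeHS W)
    (hWe : Summable fun n => ‖W (e n)‖ ^ 2) (φ : finPart ι₀ ι₁) :
    HasSum (fun n => (ann (W (e n)) * ann (e n)) φ) (quadAA W φ) := by
  have h := (goodSeries_AA e.orthonormal hWe).hasSum φ
  convert h using 1
  refine ext_inner_left ℂ fun ψ => ?_
  have h1 := h.mapL (innerSL ℂ ψ)
  have h2 := ((goodSeries_quadAA hW).hasSum φ).mapL (innerSL ℂ ψ)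
  have h1' := hasSum_inner_AA e.orthonormal hWe ψ φ
  have h2' := hasSum_inner_AA orthonormal_mode hW ψ φ
  refine (h2.unique h2').trans (Eq.trans ?_ (h1.unique h1').symm)
  congr 1
  apply Subtype.ext; apply lp.ext; funext c
  have h3 := hasSum_finPart_apply
    ((goodSeries_cre_cre e.orthonormal.isBessel zero_le_one hWe).hasSum ψ) c
  have h4 := hasSum_finPart_apply
    ((goodSeries_cre_cre orthonormal_mode.isBessel zero_le_one hW).hasSum ψ) c
  have h5 := hasSum_coord_CC_swap (modes ι₀ ι₁) W ψ c
  simp only [coe_modes] at h5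
  rw [h3.unique (hasSum_coord_CC_swap e W ψ c), ← h4.unique h5]

end Quadratic
end

noncomputable section

/-! ### Commutators of the quadratic operators with the fields -/

section Commutators

variable {ι₀ ι₁ : Type*}

theorem ModeHS.add {K K' : OnePart ι₀ ι₁ →L⋆[ℂ] OnePart ι₀ ι₁} (h : ModeHS K)
    (h' : ModeHS K') : ModeHS (K + K') := by
  refine ((Summable.add h h').mul_left 2).of_nonneg_of_le (fun _ => sq_nonneg _) fun i => ?_
  have := norm_add_le (K (mode i)) (K' (mode i))
  change ‖K (mode i) + K' (mode i)‖ ^ 2 ≤ _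
  nlinarith [norm_nonneg (K (mode i) + K' (mode i)), norm_nonneg (K (mode i)),
    norm_nonneg (K' (mode i)), sq_nonneg (‖K (mode i)‖ - ‖K' (mode i)‖)]

theorem ModeHS.smul {K : OnePart ι₀ ι₁ →L⋆[ℂ] OnePart ι₀ ι₁} (h : ModeHS K) (a : ℂ) :
    ModeHS (a • K) := by
  refine (Summable.mul_left (‖a‖ ^ 2) h).congr fun i => ?_
  change _ = ‖a • K (mode i)‖ ^ 2
  rw [norm_smul, mul_pow]

/-- The sign of a configuration: the parity of the number of fermions. -/
def configSign (c : Config ι₀ ι₁) : ℂ := (-1) ^ c.2.card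

variable (ι₀ ι₁) in
/-- The parity operator on Fock space. -/
def parity : Module.End ℂ (finPart ι₀ ι₁) := (2 : ℂ) • fockEven - 1

theorem parity_apply (φ : finPart ι₀ ι₁) (c : Config ι₀ ι₁) :
    (parity ι₀ ι₁ φ).1 c = configSign c * φ.1 c := by
  change 2 * (if Even c.2.card then φ.1 c else 0) - φ.1 c = _
  rw [configSign]
  split_ifs with h
  · rw [h.neg_one_pow]; ring
  · rw [(Nat.not_even_iff_odd.1 h).neg_one_pow]; ring

theorem conj_configSign (c : Config ι₀ ι₁) : conj (configSign c) = configSign c := by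
  simp [configSign]

theorem inner_parity_left (φ ψ : finPart ι₀ ι₁) :
    ⟪parity ι₀ ι₁ φ, ψ⟫_ℂ = ⟪φ, parity ι₀ ι₁ ψ⟫_ℂ := by
  have h1 := lp.hasSum_inner (𝕜 := ℂ) (parity ι₀ ι₁ φ).1 ψ.1
  have h2 := lp.hasSum_inner (𝕜 := ℂ) φ.1 (parity ι₀ ι₁ ψ).1
  refine h1.unique (h2.congr_fun fun c => ?_)
  rw [RCLike.inner_apply, RCLike.inner_apply, parity_apply, parity_apply, map_mul,
    conj_configSign]
  ring

theorem parity_parity (φ : finPart ι₀ ι₁) : parity ι₀ ι₁ (parity ι₀ ι₁ φ) = φ := by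
  apply Subtype.ext; apply lp.ext; funext c
  rw [parity_apply, parity_apply, ← mul_assoc, configSign, ← pow_add, ← two_mul, pow_mul]
  simp

theorem secBdd_parity : SecBdd (parity ι₀ ι₁) := fun N => by
  refine ⟨N, 1, fun φ hφ => ⟨fun c hc => by rw [parity_apply, hφ c hc, mul_zero], ?_⟩⟩
  refine le_of_sq_le_sq ?_ (by positivity)
  rw [one_mul, Submodule.coe_norm, Submodule.coe_norm, lp_norm_sq, lp_norm_sq]
  refine (tsum_congr fun c => ?_).le
  rw [parity_apply, norm_mul]
  simp [configSign]

variable [LinearOrder ι₁]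

theorem hasSum_cre (f : OnePart ι₀ ι₁) (φ : finPart ι₀ ι₁) :
    HasSum (fun i => (f i : ℂ) • cre (mode i) φ) (cre f φ) := by
  refine ((hasSum_mode f).mapL (creCLM φ)).congr_fun fun i => ?_
  rw [map_smul]; rfl

theorem hasSum_ann (f : OnePart ι₀ ι₁) (φ : finPart ι₀ ι₁) :
    HasSum (fun i => conj (f i : ℂ) • ann (mode i) φ) (ann f φ) := by
  refine ((hasSum_mode f).mapL (annCLM φ)).congr_fun fun i => ?_
  rw [map_smulₛₗ]; rfl

theorem hasSum_cre_map (Z : OnePart ι₀ ι₁ →L[ℂ] OnePart ι₀ ι₁) (f : OnePart ι₀ ι₁)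
    (φ : finPart ι₀ ι₁) : HasSum (fun i => (f i : ℂ) • cre (Z (mode i)) φ) (cre (Z f) φ) := by
  refine (((hasSum_mode f).mapL Z).mapL (creCLM φ)).congr_fun fun i => ?_
  rw [map_smul, map_smul]; rfl

theorem hasSum_cre_mapₛ (K : OnePart ι₀ ι₁ →L⋆[ℂ] OnePart ι₀ ι₁) (f : OnePart ι₀ ι₁)
    (φ : finPart ι₀ ι₁) :
    HasSum (fun i => conj (f i : ℂ) • cre (K (mode i)) φ) (cre (K f) φ) := by
  refine (((hasSum_mode f).mapL K).mapL (creCLM φ)).congr_fun fun i => ?_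
  rw [map_smulₛₗ, map_smul]; rfl

theorem hasSum_ann_mapₛ (W : OnePart ι₀ ι₁ →L⋆[ℂ] OnePart ι₀ ι₁) (f : OnePart ι₀ ι₁)
    (φ : finPart ι₀ ι₁) : HasSum (fun i => (f i : ℂ) • ann (W (mode i)) φ) (ann (W f) φ) := by
  refine (((hasSum_mode f).mapL W).mapL (annCLM φ)).congr_fun fun i => ?_
  rw [map_smulₛₗ, map_smulₛₗ, Complex.conj_conj]; rfl

theorem cre_conjTwist_ann (α : Fin 2) (Z : OnePart ι₀ ι₁ →L[ℂ] OnePart ι₀ ι₁) (i : ι₀ ⊕ ι₁)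
    (φ : finPart ι₀ ι₁) : cre (twist α (Z (mode i))) (ann (twist α (mode i)) φ)
      = cre (conjTwist α Z (mode i)) (ann (mode i) φ) := by
  rw [conjTwist_mode, twist_mode, ann_smul, cre_smul, conj_modeSign, LinearMap.smul_apply,
    LinearMap.smul_apply, map_smul]

theorem cre_conjTwist_cre (α : Fin 2) (K : OnePart ι₀ ι₁ →L⋆[ℂ] OnePart ι₀ ι₁) (i : ι₀ ⊕ ι₁)
    (φ : finPart ι₀ ι₁) : cre (twist α (K (mode i))) (cre (twist α (mode i)) φ)
      = cre (conjTwistₛ α K (mode i)) (cre (mode i) φ) := by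
  rw [conjTwistₛ_mode, twist_mode, cre_smul, cre_smul, LinearMap.smul_apply,
    LinearMap.smul_apply, map_smul]

theorem ann_conjTwist_ann (α : Fin 2) (W : OnePart ι₀ ι₁ →L⋆[ℂ] OnePart ι₀ ι₁) (i : ι₀ ⊕ ι₁)
    (φ : finPart ι₀ ι₁) : ann (twist α (W (mode i))) (ann (twist α (mode i)) φ)
      = ann (conjTwistₛ α W (mode i)) (ann (mode i) φ) := by
  rw [conjTwistₛ_mode, twist_mode, ann_smul, ann_smul, LinearMap.smul_apply,
    LinearMap.smul_apply, map_smul]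

variable {α : Fin 2} {f : OnePart ι₀ ι₁} (hf : IsHom α f)

include hf

/-- Moving a†(f) to the left through the i-th term leaves the contraction ⟨δᵢ, f⟩ a†(Zδᵢ), and these
sum to a†(Zf). The uncontracted terms have both factors twisted by γ^α, that is, Z is replaced by
γ^α Z γ^α. -/
theorem quadCA_cre (Z : OnePart ι₀ ι₁ →L[ℂ] OnePart ι₀ ι₁) (φ : finPart ι₀ ι₁) :
    quadCA Z (cre f φ) = cre (Z f) φ + cre f (quadCA (conjTwist α Z) φ) := by
  have h1 := (goodSeries_quadCA Z).hasSum (cre f φ)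
  have h2 := (goodSeries_quadCA (conjTwist α Z)).hasSum_map (secBdd_cre f) φ
  refine h1.unique (((hasSum_cre_map Z f φ).add h2).congr_fun fun i => ?_)
  rw [Module.End.mul_apply, Module.End.mul_apply, ann_cre hf, inner_mode_left, map_add, map_smul,
    cre_cre hf, cre_conjTwist_ann]

theorem quadCC_cre {K : OnePart ι₀ ι₁ →L⋆[ℂ] OnePart ι₀ ι₁} (hK : ModeHS K)
    (φ : finPart ι₀ ι₁) : quadCC K (cre f φ) = cre f (quadCC (conjTwistₛ α K) φ) := by
  have h1 := (goodSeries_quadCC hK).hasSum (cre f φ)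
  have h2 := (goodSeries_quadCC (hK.conjTwist α)).hasSum_map (secBdd_cre f) φ
  refine h1.unique (h2.congr_fun fun i => ?_)
  rw [Module.End.mul_apply, Module.End.mul_apply, cre_cre hf, cre_cre hf, cre_conjTwist_cre]

/-- Each of the two annihilators can contract with f. The inner one gives a(Wf). The outer one gives
the adjoint of W at f, represented by g; its twist arises from passing f over the inner annihilator
first. -/
theorem quadAA_cre {W : OnePart ι₀ ι₁ →L⋆[ℂ] OnePart ι₀ ι₁} (hW : ModeHS W)
    {g : OnePart ι₀ ι₁} (hg : ∀ v, ⟪W v, f⟫_ℂ = ⟪g, v⟫_ℂ) (φ : finPart ι₀ ι₁) :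
    quadAA W (cre f φ)
      = ann (W f) φ + ann (twist α g) φ + cre f (quadAA (conjTwistₛ α W) φ) := by
  have h1 := (goodSeries_quadAA hW).hasSum (cre f φ)
  have h2 := (goodSeries_quadAA (hW.conjTwist α)).hasSum_map (secBdd_cre f) φ
  refine h1.unique ((((hasSum_ann_mapₛ W f φ).add (hasSum_ann (twist α g) φ)).add h2).congr_fun
    fun i => ?_)
  rw [Module.End.mul_apply, Module.End.mul_apply, ann_cre hf, inner_mode_left, map_add, map_smul,
    ann_cre hf, ann_conjTwist_ann, hg, inner_mode_right, twist_mode, ann_smul, twist_apply,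
    map_mul, mul_comm, mul_smul, LinearMap.smul_apply, add_assoc]

theorem quadCA_ann (Z : OnePart ι₀ ι₁ →L[ℂ] OnePart ι₀ ι₁)
    {g : OnePart ι₀ ι₁} (hg : ∀ v, ⟪f, conjTwist α Z v⟫_ℂ = ⟪g, v⟫_ℂ) (φ : finPart ι₀ ι₁) :
    quadCA Z (ann f φ) = ann f (quadCA (conjTwist α Z) φ) - ann g φ := by
  have h1 := (goodSeries_quadCA Z).hasSum (ann f φ)
  have h2 := (goodSeries_quadCA (conjTwist α Z)).hasSum_map (secBdd_ann f) φ
  refine h1.unique ((h2.sub (hasSum_ann g φ)).congr_fun fun i => ?_)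
  rw [Module.End.mul_apply, Module.End.mul_apply, ann_ann hf, cre_ann hf, cre_conjTwist_ann,
    ← inner_mode_right, ← hg, conjTwist_mode, inner_smul_right, twist_mode, ann_smul,
    conj_modeSign, LinearMap.smul_apply, smul_smul, mul_comm (modeSign α i)]

/-- The counterpart of `quadAA_cre`: a(f) contracts with either creator, and g represents the
adjoint of the twisted kernel at f. -/
theorem quadCC_ann {K : OnePart ι₀ ι₁ →L⋆[ℂ] OnePart ι₀ ι₁} (hK : ModeHS K)
    {g : OnePart ι₀ ι₁} (hg : ∀ v, ⟪f, conjTwistₛ α K v⟫_ℂ = ⟪v, g⟫_ℂ) (φ : finPart ι₀ ι₁) :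
    quadCC K (ann f φ)
      = ann f (quadCC (conjTwistₛ α K) φ) - cre g φ - cre (K (twist α f)) φ := by
  have h1 := (goodSeries_quadCC hK).hasSum (ann f φ)
  have h2 := (goodSeries_quadCC (hK.conjTwist α)).hasSum_map (secBdd_ann f) φ
  refine h1.unique (((h2.sub (hasSum_cre g φ)).sub (hasSum_cre_mapₛ K (twist α f) φ)).congr_fun
    fun i => ?_)
  rw [Module.End.mul_apply, Module.End.mul_apply, cre_ann hf, map_sub, map_smul, cre_ann hf,
    cre_conjTwist_cre, ← inner_mode_left, ← hg, conjTwistₛ_mode, inner_smul_right,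
    ← inner_mode_right, inner_twist_left, twist_mode, cre_smul (modeSign α i) (mode i),
    LinearMap.smul_apply, smul_smul, mul_comm (modeSign α i)]

theorem quadAA_ann {W : OnePart ι₀ ι₁ →L⋆[ℂ] OnePart ι₀ ι₁} (hW : ModeHS W)
    (φ : finPart ι₀ ι₁) : quadAA W (ann f φ) = ann f (quadAA (conjTwistₛ α W) φ) := by
  have h1 := (goodSeries_quadAA hW).hasSum (ann f φ)
  have h2 := (goodSeries_quadAA (hW.conjTwist α)).hasSum_map (secBdd_ann f) φ
  refine h1.unique (h2.congr_fun fun i => ?_)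
  rw [Module.End.mul_apply, Module.End.mul_apply, ann_ann hf, ann_ann hf, ann_conjTwist_ann]

omit hf

theorem quadCA_vacuum (Z : OnePart ι₀ ι₁ →L[ℂ] OnePart ι₀ ι₁) : quadCA Z vacuum = 0 := by
  refine ((goodSeries_quadCA Z).hasSum vacuum).unique ?_
  simp only [Module.End.mul_apply, ann_vacuum, map_zero]
  exact hasSum_zero

theorem quadAA_vacuum {W : OnePart ι₀ ι₁ →L⋆[ℂ] OnePart ι₀ ι₁} (hW : ModeHS W) :
    quadAA W vacuum = 0 := by
  refine ((goodSeries_quadAA hW).hasSum vacuum).unique ?_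
  simp only [Module.End.mul_apply, ann_vacuum, map_zero]
  exact hasSum_zero

/-! ### Linearity in the kernel -/

theorem quadCA_add (Z Z' : OnePart ι₀ ι₁ →L[ℂ] OnePart ι₀ ι₁) :
    quadCA (Z + Z') = quadCA Z + quadCA Z' := LinearMap.ext fun φ => by
  have h := ((goodSeries_quadCA Z).hasSum φ).add ((goodSeries_quadCA Z').hasSum φ)
  refine ((goodSeries_quadCA (Z + Z')).hasSum φ).unique (h.congr_fun fun i => ?_)
  rw [add_apply, cre_add, add_mul]; rfl

theorem quadCA_smul (a : ℂ) (Z : OnePart ι₀ ι₁ →L[ℂ] OnePart ι₀ ι₁) :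
    quadCA (a • Z) = a • quadCA Z := LinearMap.ext fun φ => by
  have h := ((goodSeries_quadCA Z).hasSum φ).const_smul a
  refine ((goodSeries_quadCA (a • Z)).hasSum φ).unique (h.congr_fun fun i => ?_)
  change (cre (a • Z (mode i)) * ann (mode i)) φ = _
  rw [cre_smul, smul_mul_assoc]; rfl

theorem quadCC_add {K K' : OnePart ι₀ ι₁ →L⋆[ℂ] OnePart ι₀ ι₁} (hK : ModeHS K)
    (hK' : ModeHS K') : quadCC (K + K') = quadCC K + quadCC K' := LinearMap.ext fun φ => by
  have h := ((goodSeries_quadCC hK).hasSum φ).add ((goodSeries_quadCC hK').hasSum φ)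
  refine ((goodSeries_quadCC (hK.add hK')).hasSum φ).unique (h.congr_fun fun i => ?_)
  rw [add_apply, cre_add, add_mul]; rfl

theorem quadCC_smul (a : ℂ) {K : OnePart ι₀ ι₁ →L⋆[ℂ] OnePart ι₀ ι₁} (hK : ModeHS K) :
    quadCC (a • K) = a • quadCC K := LinearMap.ext fun φ => by
  have h := ((goodSeries_quadCC hK).hasSum φ).const_smul a
  refine ((goodSeries_quadCC (hK.smul a)).hasSum φ).unique (h.congr_fun fun i => ?_)
  change (cre (a • K (mode i)) * cre (mode i)) φ = _
  rw [cre_smul, smul_mul_assoc]; rfl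

theorem quadAA_add {W W' : OnePart ι₀ ι₁ →L⋆[ℂ] OnePart ι₀ ι₁} (hW : ModeHS W)
    (hW' : ModeHS W') : quadAA (W + W') = quadAA W + quadAA W' := LinearMap.ext fun φ => by
  have h := ((goodSeries_quadAA hW).hasSum φ).add ((goodSeries_quadAA hW').hasSum φ)
  refine ((goodSeries_quadAA (hW.add hW')).hasSum φ).unique (h.congr_fun fun i => ?_)
  rw [add_apply, ann_add, add_mul]; rfl

theorem quadAA_smul (a : ℂ) {W : OnePart ι₀ ι₁ →L⋆[ℂ] OnePart ι₀ ι₁} (hW : ModeHS W) :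
    quadAA (conj a • W) = a • quadAA W := LinearMap.ext fun φ => by
  have h := ((goodSeries_quadAA hW).hasSum φ).const_smul a
  refine ((goodSeries_quadAA (hW.smul (conj a))).hasSum φ).unique (h.congr_fun fun i => ?_)
  change (ann (conj a • W (mode i)) * ann (mode i)) φ = _
  rw [ann_smul, smul_mul_assoc, Complex.conj_conj]; rfl

/-! ### Parity -/

theorem configSign_lower {c : Config ι₀ ι₁} {i : ι₀ ⊕ ι₁} (hi : i ∈ c.occupied) :
    configSign c = modeSign 1 i * configSign (c.lower i) := by
  rcases i with i | j
  · simp [configSign, modeSign, modeDeg, Config.lower]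
  · have hj : j ∈ c.2 := by simpa [Config.occupied] using hi
    simp only [configSign, modeSign, modeDeg, Config.lower]
    rw [← Finset.card_erase_add_one hj, pow_succ]; simp

theorem parity_cre (f : OnePart ι₀ ι₁) (φ : finPart ι₀ ι₁) :
    parity ι₀ ι₁ (cre f φ) = cre (twist 1 f) (parity ι₀ ι₁ φ) := by
  apply Subtype.ext; apply lp.ext; funext c
  rw [parity_apply, cre_apply, cre_apply, Finset.mul_sum]
  refine Finset.sum_congr rfl fun i hi => ?_
  rw [parity_apply, twist_apply, configSign_lower hi]; ring

theorem parity_ann (f : OnePart ι₀ ι₁) (φ : finPart ι₀ ι₁) :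
    parity ι₀ ι₁ (ann f φ) = ann (twist 1 f) (parity ι₀ ι₁ φ) := by
  refine ext_inner_left ℂ fun ψ => ?_
  rw [← inner_parity_left, ← inner_cre_left, ← inner_cre_left, ← inner_parity_left, parity_cre,
    twist_twist]

theorem parity_quadCA (Z : OnePart ι₀ ι₁ →L[ℂ] OnePart ι₀ ι₁) (φ : finPart ι₀ ι₁) :
    parity ι₀ ι₁ (quadCA Z φ) = quadCA (conjTwist 1 Z) (parity ι₀ ι₁ φ) := by
  have h1 := (goodSeries_quadCA Z).hasSum_map secBdd_parity φ
  have h2 := (goodSeries_quadCA (conjTwist 1 Z)).hasSum (parity ι₀ ι₁ φ)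
  refine h1.unique (h2.congr_fun fun i => ?_)
  rw [Module.End.mul_apply, Module.End.mul_apply, parity_cre, parity_ann, cre_conjTwist_ann]

theorem parity_quadCC {K : OnePart ι₀ ι₁ →L⋆[ℂ] OnePart ι₀ ι₁} (hK : ModeHS K)
    (φ : finPart ι₀ ι₁) :
    parity ι₀ ι₁ (quadCC K φ) = quadCC (conjTwistₛ 1 K) (parity ι₀ ι₁ φ) := by
  have h1 := (goodSeries_quadCC hK).hasSum_map secBdd_parity φ
  have h2 := (goodSeries_quadCC (hK.conjTwist 1)).hasSum (parity ι₀ ι₁ φ)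
  refine h1.unique (h2.congr_fun fun i => ?_)
  rw [Module.End.mul_apply, Module.End.mul_apply, parity_cre, parity_cre, cre_conjTwist_cre]

theorem parity_quadAA {W : OnePart ι₀ ι₁ →L⋆[ℂ] OnePart ι₀ ι₁} (hW : ModeHS W)
    (φ : finPart ι₀ ι₁) :
    parity ι₀ ι₁ (quadAA W φ) = quadAA (conjTwistₛ 1 W) (parity ι₀ ι₁ φ) := by
  have h1 := (goodSeries_quadAA hW).hasSum_map secBdd_parity φ
  have h2 := (goodSeries_quadAA (hW.conjTwist 1)).hasSum (parity ι₀ ι₁ φ)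
  refine h1.unique (h2.congr_fun fun i => ?_)
  rw [Module.End.mul_apply, Module.End.mul_apply, parity_ann, parity_ann, ann_conjTwist_ann]

end Commutators
end

noncomputable section

/-! ### Hilbert–Schmidt operators and traces of products -/

section HilbertSchmidt

variable {E : Type*} [NormedAddCommGroup E] [InnerProductSpace ℂ E]

theorem HilbertBasis.hasSum_norm_inner_sq {κ : Type*} (b : HilbertBasis κ ℂ E) (x : E) :
    HasSum (fun i => ‖⟪b i, x⟫_ℂ‖ ^ 2) (‖x‖ ^ 2) := by
  have h := (summable_sq_lp (b.repr x)).hasSum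
  rw [← lp_norm_sq, LinearIsometryEquiv.norm_map] at h
  simpa only [b.repr_apply_apply] using h

/-- Parseval in the second basis. The matrix form is symmetric in the two bases up to passing to the
adjoint, whence invariance under adjoints and, applying this twice, independence of the basis. -/
theorem summable_sq_matrix_iff {κ l : Type*} (T : E →L[ℂ] E) (b : HilbertBasis κ ℂ E)
    (g : HilbertBasis l ℂ E) :
    (Summable fun i => ‖T (b i)‖ ^ 2)
      ↔ Summable fun p : κ × l => ‖⟪g p.2, T (b p.1)⟫_ℂ‖ ^ 2 := by
  rw [summable_prod_of_nonneg fun _ => sq_nonneg _]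
  simp only [(g.hasSum_norm_inner_sq _).tsum_eq, (g.hasSum_norm_inner_sq _).summable,
    implies_true, true_and]

theorem IsHilbertSchmidt.mul_left {T : E →L[ℂ] E} (h : IsHilbertSchmidt T) (A : E →L[ℂ] E) :
    IsHilbertSchmidt (A * T) := by
  obtain ⟨w, b, h⟩ := h
  refine ⟨w, b, (h.mul_left (‖A‖ ^ 2)).of_nonneg_of_le (fun _ => sq_nonneg _) fun i => ?_⟩
  rw [← mul_pow]
  exact pow_le_pow_left₀ (norm_nonneg _) (A.le_opNorm _) 2

theorem IsHilbertSchmidt.smul {T : E →L[ℂ] E} (h : IsHilbertSchmidt T) (a : ℂ) :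
    IsHilbertSchmidt (a • T) := by
  obtain ⟨w, b, h⟩ := h
  refine ⟨w, b, (h.mul_left (‖a‖ ^ 2)).congr fun i => ?_⟩
  change _ = ‖a • T (b i)‖ ^ 2
  rw [norm_smul, mul_pow]

theorem HasTrace.add {A B : E →L[ℂ] E} {s t : ℂ} (hA : HasTrace A s) (hB : HasTrace B t) :
    HasTrace (A + B) (s + t) := fun w b => by
  refine ((hA w b).add (hB w b)).congr_fun fun i => ?_
  rw [add_apply, inner_add_right]

theorem HasTrace.smul {A : E →L[ℂ] E} {s : ℂ} (hA : HasTrace A s) (a : ℂ) :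
    HasTrace (a • A) (a * s) := fun w b => by
  refine ((hA w b).mul_left a).congr_fun fun i => ?_
  rw [smul_apply, inner_smul_right]

variable [CompleteSpace E]

theorem summable_sq_adjoint {κ l : Type*} {T : E →L[ℂ] E} {b : HilbertBasis κ ℂ E}
    (h : Summable fun i => ‖T (b i)‖ ^ 2) (g : HilbertBasis l ℂ E) :
    Summable fun j => ‖ContinuousLinearMap.adjoint T (g j)‖ ^ 2 := by
  rw [summable_sq_matrix_iff _ g b]
  rw [summable_sq_matrix_iff _ b g] at h
  refine ((Equiv.prodComm l κ).summable_iff.2 h).congr fun p => ?_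
  simp only [Function.comp_apply, Equiv.prodComm_apply, Prod.fst_swap, Prod.snd_swap]
  rw [ContinuousLinearMap.adjoint_inner_right, ← inner_conj_symm, RCLike.norm_conj]

theorem isHilbertSchmidt_of_summable {κ : Type*} {T : E →L[ℂ] E} {b : HilbertBasis κ ℂ E}
    (h : Summable fun i => ‖T (b i)‖ ^ 2) : IsHilbertSchmidt T := by
  obtain ⟨w, g, _⟩ := exists_hilbertBasis ℂ E
  refine ⟨w, g, ?_⟩
  have := summable_sq_adjoint (summable_sq_adjoint h g) g
  rwa [ContinuousLinearMap.adjoint_adjoint] at this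

theorem IsHilbertSchmidt.summable {κ : Type*} {T : E →L[ℂ] E} (h : IsHilbertSchmidt T)
    (g : HilbertBasis κ ℂ E) : Summable fun i => ‖T (g i)‖ ^ 2 := by
  obtain ⟨w, b, h⟩ := h
  have := summable_sq_adjoint (summable_sq_adjoint h g) g
  rwa [ContinuousLinearMap.adjoint_adjoint] at this

theorem IsHilbertSchmidt.adjoint {T : E →L[ℂ] E} (h : IsHilbertSchmidt T) :
    IsHilbertSchmidt (ContinuousLinearMap.adjoint T) := by
  obtain ⟨w, b, h⟩ := h
  exact ⟨w, b, summable_sq_adjoint h b⟩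

theorem IsHilbertSchmidt.mul_right {T : E →L[ℂ] E} (h : IsHilbertSchmidt T) (A : E →L[ℂ] E) :
    IsHilbertSchmidt (T * A) := by
  have := (h.adjoint.mul_left (ContinuousLinearMap.adjoint A)).adjoint
  have h2 : ContinuousLinearMap.adjoint
      (ContinuousLinearMap.adjoint A * ContinuousLinearMap.adjoint T) = T * A := by
    change ContinuousLinearMap.adjoint
      (ContinuousLinearMap.adjoint A ∘L ContinuousLinearMap.adjoint T) = T ∘L A
    rw [ContinuousLinearMap.adjoint_comp, ContinuousLinearMap.adjoint_adjoint,
      ContinuousLinearMap.adjoint_adjoint]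
  rwa [h2] at this

theorem IsHilbertSchmidt.add {T T' : E →L[ℂ] E} (h : IsHilbertSchmidt T)
    (h' : IsHilbertSchmidt T') : IsHilbertSchmidt (T + T') := by
  obtain ⟨w, b, h⟩ := h
  refine ⟨w, b, ((h.add (h'.summable b)).mul_left 2).of_nonneg_of_le
    (fun _ => sq_nonneg _) fun i => ?_⟩
  have := norm_add_le (T (b i)) (T' (b i))
  change ‖T (b i) + T' (b i)‖ ^ 2 ≤ _
  nlinarith [norm_nonneg (T (b i) + T' (b i)), norm_nonneg (T (b i)),
    norm_nonneg (T' (b i)), sq_nonneg (‖T (b i)‖ - ‖T' (b i)‖)]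

/-- The family ⟨bᵢ, A gⱼ⟩⟨gⱼ, B bᵢ⟩ is absolutely summable as a product of two square summable
matrices; summing it by rows and by columns gives the two diagonal sums. -/
theorem exists_hasSum_trace_mul {κ l : Type*} {A B : E →L[ℂ] E} (hA : IsHilbertSchmidt A)
    (hB : IsHilbertSchmidt B) (b : HilbertBasis κ ℂ E) (g : HilbertBasis l ℂ E) :
    ∃ t, HasSum (fun i => ⟪b i, A (B (b i))⟫_ℂ) t ∧ HasSum (fun j => ⟪g j, B (A (g j))⟫_ℂ) t := by
  have h1 := (summable_sq_matrix_iff B b g).1 (hB.summable b)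
  have h2 : Summable fun p : κ × l => ‖⟪b p.1, A (g p.2)⟫_ℂ‖ ^ 2 := by
    have := (summable_sq_matrix_iff A g b).1 (hA.summable g)
    exact (Equiv.prodComm κ l).summable_iff.2 this
  have h3 := (summable_mul_of_summable_sq h2 h1).hasSum
  refine ⟨_, h3.prod_fiberwise fun i => ?_, ((Equiv.prodComm l κ).hasSum_iff.2 h3).prod_fiberwise
    fun j => ?_⟩
  · have := g.hasSum_inner_mul_inner (ContinuousLinearMap.adjoint A (b i)) (B (b i))
    simpa only [ContinuousLinearMap.adjoint_inner_left] using this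
  · have := b.hasSum_inner_mul_inner (ContinuousLinearMap.adjoint B (g j)) (A (g j))
    simp only [ContinuousLinearMap.adjoint_inner_left] at this
    refine this.congr_fun fun i => ?_
    simp only [Function.comp_apply, Equiv.prodComm_apply, Prod.fst_swap, Prod.snd_swap]
    rw [mul_comm]

theorem hasTrace_mul {κ : Type*} {A B : E →L[ℂ] E} (hA : IsHilbertSchmidt A)
    (hB : IsHilbertSchmidt B) (b : HilbertBasis κ ℂ E) {t : ℂ}
    (ht : HasSum (fun i => ⟪b i, A (B (b i))⟫_ℂ) t) : HasTrace (A * B) t := by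
  intro w g
  -- The diagonal sum of BA in b serves as a common value for the diagonal sums of AB in b and in g.
  obtain ⟨t₁, h1, h2⟩ := exists_hasSum_trace_mul hA hB b b
  obtain ⟨t₂, h3, h4⟩ := exists_hasSum_trace_mul hA hB g b
  rw [ht.unique h1, h2.unique h4]
  exact h3

end HilbertSchmidt

/-! ### The neutral system -/

/-- Polarization: the real terms are preserved because J preserves norms, and iJg = J(-ig) exchanges
the two imaginary terms, which conjugates the inner product. -/
theorem inner_map_map_of_antilinear {h : Type*} [NormedAddCommGroup h] [InnerProductSpace ℂ h]
    (J : h →ₗᵢ⋆[ℂ] h) (f g : h) : ⟪J f, J g⟫_ℂ = ⟪g, f⟫_ℂ := by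
  have h1 : ∀ x y : h, ‖J x + J y‖ = ‖x + y‖ := fun x y => by rw [← map_add, J.norm_map]
  have h2 : ∀ x y : h, ‖J x - J y‖ = ‖x - y‖ := fun x y => by rw [← map_sub, J.norm_map]
  have h3 : Complex.I • J g = J (-(Complex.I • g)) := by
    rw [map_neg, map_smulₛₗ]; simp
  rw [← inner_conj_symm g f, inner_eq_sum_norm_sq_div_four, inner_eq_sum_norm_sq_div_four]
  simp only [RCLike.I_to_complex, h3, h1, h2, sub_neg_eq_add, ← sub_eq_add_neg]
  simp only [map_div₀, map_add, map_sub, map_mul, map_pow, Complex.conj_ofReal, Complex.conj_I,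
    map_ofNat, Complex.coe_algebraMap]
  ring

namespace NeutralSystem

variable {h : Type*} [NormedAddCommGroup h] [InnerProductSpace ℂ h] [CompleteSpace h]
variable (S : NeutralSystem h)

theorem inner_J_left (f g : h) : ⟪S.J f, g⟫_ℂ = ⟪S.J g, f⟫_ℂ := by
  rw [← inner_map_map_of_antilinear S.J, S.J_J]

theorem inner_J_right (f g : h) : ⟪f, S.J g⟫_ℂ = ⟪g, S.J f⟫_ℂ := by
  rw [← inner_map_map_of_antilinear S.J, S.J_J]

theorem P_P (f : h) : S.P (S.P f) = S.P f := DFunLike.congr_fun S.P_proj.isIdempotentElem f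

theorem P₀_P₀ (f : h) : S.P₀ (S.P₀ f) = S.P₀ f := DFunLike.congr_fun S.P₀_proj.isIdempotentElem f

theorem inner_P_left (f g : h) : ⟪S.P f, g⟫_ℂ = ⟪f, S.P g⟫_ℂ := by
  rw [← ContinuousLinearMap.adjoint_inner_right, S.P_proj.isSelfAdjoint.adjoint_eq]

theorem inner_P₀_left (f g : h) : ⟪S.P₀ f, g⟫_ℂ = ⟪f, S.P₀ g⟫_ℂ := by
  rw [← ContinuousLinearMap.adjoint_inner_right, S.P₀_proj.isSelfAdjoint.adjoint_eq]

theorem P_P₀ (f : h) : S.P (S.P₀ f) = S.P₀ (S.P f) := DFunLike.congr_fun S.P_even f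

theorem γ_apply (f : h) : S.γ f = S.P₀ f - (f - S.P₀ f) := rfl

theorem q_apply (f : h) : S.q f = S.P f - S.γ (f - S.P f) := rfl

theorem γ_γ (f : h) : S.γ (S.γ f) = f := by
  simp only [γ_apply, map_sub, P₀_P₀]; abel

theorem inner_γ_left (f g : h) : ⟪S.γ f, g⟫_ℂ = ⟪f, S.γ g⟫_ℂ := by
  simp only [γ_apply, inner_sub_left, inner_sub_right, inner_P₀_left]

theorem P_γ (f : h) : S.P (S.γ f) = S.γ (S.P f) := by
  simp only [γ_apply, map_sub, P_P₀]

theorem J_γ (f : h) : S.J (S.γ f) = S.γ (S.J f) := by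
  simp only [γ_apply, map_sub, S.J_even]

theorem P_J (f : h) : S.P (S.J f) = S.J f - S.J (S.P f) := by
  rw [S.J_P]; abel

/-- `γ q = γ P - (1 - P)`. -/
def γq : h →L[ℂ] h := S.γ * S.P - (1 - S.P)

theorem γq_apply (f : h) : S.γq f = S.γ (S.P f) - (f - S.P f) := rfl

theorem γ_q (f : h) : S.γ (S.q f) = S.γq f := by
  rw [q_apply, γq_apply, map_sub, γ_γ]

theorem γq_γ (f : h) : S.γq (S.γ f) = S.γ (S.γq f) := by
  simp only [γq_apply, P_γ, map_sub]

theorem q_eq (f : h) : S.q f = S.γ (S.γq f) := by rw [← γ_q, γ_γ]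

theorem γq_γq (f : h) : S.γq (S.γq f) = f := by
  simp only [γq_apply, map_sub, P_γ, P_P, γ_γ]; abel

theorem inner_γq_left (f g : h) : ⟪S.γq f, g⟫_ℂ = ⟪f, S.γq g⟫_ℂ := by
  simp only [γq_apply, inner_sub_left, inner_sub_right, inner_P_left, inner_γ_left, P_γ]

theorem J_q (f : h) : S.J (S.q f) = - S.γq (S.J f) := by
  simp only [q_apply, γq_apply, map_sub, J_γ, S.J_P]; abel

theorem J_γq (f : h) : S.J (S.γq f) = - S.q (S.J f) := by
  rw [← γ_q, J_γ, J_q, map_neg, ← q_eq]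

/-- `f` is homogeneous of degree `α`. -/
def Hom (α : Fin 2) (f : h) : Prop := S.γ f = ((-1) ^ α.val : ℂ) • f

theorem Hom.J {α : Fin 2} {f : h} (hf : S.Hom α f) : S.Hom α (S.J f) := by
  rw [Hom, ← J_γ, hf, map_smulₛₗ]; simp

theorem exists_hom_decomposition (f : h) :
    ∃ f₀ f₁, S.Hom 0 f₀ ∧ S.Hom 1 f₁ ∧ f = f₀ + f₁ := by
  refine ⟨S.P₀ f, f - S.P₀ f, ?_, ?_, by abel⟩
  · simp [Hom, γ_apply, P₀_P₀]
  · simp [Hom, γ_apply, P₀_P₀]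

/-- `γ^α X γ^α`. -/
def conjγ (α : Fin 2) (X : h →L[ℂ] h) : h →L[ℂ] h := S.γ ^ α.val * X * S.γ ^ α.val

theorem conjγ_apply (α : Fin 2) (X : h →L[ℂ] h) (f : h) :
    S.conjγ α X f = (S.γ ^ α.val) (X ((S.γ ^ α.val) f)) := rfl

theorem conjγ_zero (X : h →L[ℂ] h) : S.conjγ 0 X = X := by simp [conjγ]

theorem conjγ_one_apply (X : h →L[ℂ] h) (f : h) : S.conjγ 1 X f = S.γ (X (S.γ f)) := by
  simp [conjγ]

/-- The (super)symplectic form preserved by self-dual operators. -/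
def omega (f g : h) : ℂ := ⟪S.J f, S.γq g⟫_ℂ

theorem eps_apply (X : h →L[ℂ] h) (f : h) :
    S.eps X f = S.P₀ (X f) + (X (S.γ f) - S.P₀ (X (S.γ f))) := by
  simp [eps, gr, Fin.sum_univ_two, γ_apply]; abel

/-- Since ε(X) = P₀X + (1 - P₀)Xγ, pairing it with the degree-α vector qJf amounts to using Xγ^α.
The remaining γ^α on the left absorbs the difference between q and γq on that vector. -/
theorem inner_eps {α : Fin 2} {f : h} (hf : S.Hom α f) (X : h →L[ℂ] h) (g : h) :
    ⟪S.q (S.J f), S.eps X g⟫_ℂ = S.omega f (S.conjγ α X g) := by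
  have h1 := Hom.J S hf
  have h2 : S.Hom α (S.q (S.J f)) := by
    have h0 : S.γ (S.γq (S.J f)) = ((-1) ^ α.val : ℂ) • S.γq (S.J f) := by
      rw [← γq_γ, h1, map_smul]
    rw [Hom, q_eq, h0, map_smul, h0]
  have h3 : ⟪S.q (S.J f), S.eps X g⟫_ℂ = ⟪S.q (S.J f), X ((S.γ ^ α.val) g)⟫_ℂ := by
    have h4 : ∀ x, S.P₀ x = (1 / 2 : ℂ) • (x + S.γ x) := fun x => by
      rw [γ_apply]; module
    rw [eps_apply, h4, h4]
    simp only [inner_add_right, inner_sub_right, inner_smul_right, ← inner_γ_left]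
    unfold Hom at h2
    fin_cases α
    · simp at h2 ⊢; rw [h2]; ring
    · simp at h2 ⊢; simp only [h2, inner_neg_left]; ring
  rw [h3, omega, conjγ_apply, ← inner_γq_left]
  have h5 : ∀ x y, ⟪x, (S.γ ^ α.val) y⟫_ℂ = ⟪(S.γ ^ α.val) x, y⟫_ℂ := by
    intro x y
    fin_cases α
    · simp
    · simp [inner_γ_left]
  rw [h5]
  congr 1
  rw [q_eq]
  unfold Hom at h1
  fin_cases α
  · simp at h1 ⊢
    rw [← γq_γ, h1]
  · simp

theorem inner_J_q (x g : h) :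
    S.omega (S.q (S.J x)) g = - ⟪x, g⟫_ℂ := by
  rw [omega, J_q, S.J_J, inner_neg_left, inner_γq_left, γq_γq]

/-- Self-duality as infinitesimal invariance of ω, with the graded sign written as conjugation by
γ^α. Applying ω to the defining identity undoes qJ by `inner_J_q`; conversely, nondegeneracy of the
inner product recovers the identity on homogeneous vectors, and additivity gives it everywhere. -/
theorem isSelfDual_iff (X : h →L[ℂ] h) :
    S.IsSelfDual X ↔ ∀ α f, S.Hom α f → ∀ g,
      S.omega (X f) g + S.omega f (S.conjγ α X g) = 0 := by
  constructor
  · intro hX α f hf g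
    rw [← inner_eps S hf, hX f, inner_J_q, ContinuousLinearMap.adjoint_inner_left]
    ring
  · intro hX
    have key : ∀ α f, S.Hom α f →
        X f = S.q (S.J (ContinuousLinearMap.adjoint (S.eps X) (S.q (S.J f)))) := by
      intro α f hf
      have h1 : ∀ g, ⟪S.γq (S.J (X f)) + ContinuousLinearMap.adjoint (S.eps X) (S.q (S.J f)),
          g⟫_ℂ = 0 := fun g => by
        rw [inner_add_left, inner_γq_left, ContinuousLinearMap.adjoint_inner_left,
          inner_eps S hf]
        exact hX α f hf g
      have h2 := inner_self_eq_zero.1 (h1 _)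
      rw [eq_neg_of_add_eq_zero_right h2, map_neg, J_γq, neg_neg, S.J_J, q_eq, q_eq, γq_γ, γq_γq,
        γ_γ]
    intro f
    obtain ⟨f₀, f₁, h0, h1, rfl⟩ := S.exists_hom_decomposition f
    rw [map_add, key 0 f₀ h0, key 1 f₁ h1]
    simp only [map_add]

end NeutralSystem

end

noncomputable section

/-! ### Homogeneous parts -/

/-- The degree projections are the averages over conjugation by the grading operator 2p - 1. This
form serves both operators on h and operators on Fock space. -/
theorem homPart_eq {R : Type*} [Ring R] [Algebra ℂ R] (p : R) (α : Fin 2) (x : R) :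
    homPart p α x
      = (1 / 2 : ℂ) • (x + ((-1) ^ α.val : ℂ) • ((p - (1 - p)) * x * (p - (1 - p)))) := by
  have h : ∀ y : R, y = (1 / 2 : ℂ) • (y + y) := fun y => by module
  rw [h (homPart p α x)]
  congr 1
  fin_cases α
  · simp only [homPart, Fin.zero_eta, if_true, pow_zero, one_smul]
    noncomm_ring
  · simp only [homPart, Fin.mk_one, one_ne_zero, if_false, pow_one, neg_one_smul]
    noncomm_ring

theorem homPart_add_homPart {R : Type*} [Ring R] (p x : R) :
    homPart p 0 x + homPart p 1 x = x := by
  simp only [homPart, if_true, one_ne_zero, if_false]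
  noncomm_ring

theorem neg_one_pow_add_val (α β : Fin 2) :
    ((-1) ^ (α + β).val : ℂ) = (-1) ^ α.val * (-1) ^ β.val := by
  fin_cases α <;> fin_cases β <;> simp

namespace NeutralSystem

variable {h : Type*} [NormedAddCommGroup h] [InnerProductSpace ℂ h] [CompleteSpace h]
variable (S : NeutralSystem h)

theorem omega_add_left (f f' g : h) : S.omega (f + f') g = S.omega f g + S.omega f' g := by
  simp only [omega, map_add, inner_add_left]

theorem omega_add_right (f g g' : h) : S.omega f (g + g') = S.omega f g + S.omega f g' := by
  simp only [omega, map_add, inner_add_right]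

theorem omega_smul_left (a : ℂ) (f g : h) : S.omega (a • f) g = a * S.omega f g := by
  simp only [omega, map_smulₛₗ, inner_smul_left, Complex.conj_conj]

theorem omega_smul_right (a : ℂ) (f g : h) : S.omega f (a • g) = a * S.omega f g := by
  simp only [omega, map_smul, inner_smul_right]

theorem omega_γ_left (f g : h) : S.omega (S.γ f) g = S.omega f (S.γ g) := by
  rw [omega, J_γ, inner_γ_left, ← γq_γ, omega]

theorem γ_mul_γ : S.γ * S.γ = 1 := by
  ext f; exact S.γ_γ f

theorem conjγ_add (α : Fin 2) (X Y : h →L[ℂ] h) :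
    S.conjγ α (X + Y) = S.conjγ α X + S.conjγ α Y := by
  rw [conjγ, mul_add, add_mul]; rfl

theorem conjγ_smul (α : Fin 2) (a : ℂ) (X : h →L[ℂ] h) :
    S.conjγ α (a • X) = a • S.conjγ α X := by
  simp [conjγ]

theorem conjγ_one (X : h →L[ℂ] h) : S.conjγ 1 X = S.γ * X * S.γ := by simp [conjγ]

theorem conjγ_one_conjγ_one (X : h →L[ℂ] h) : S.conjγ 1 (S.conjγ 1 X) = X := by
  rw [conjγ_one, conjγ_one]
  calc S.γ * (S.γ * X * S.γ) * S.γ = (S.γ * S.γ) * X * (S.γ * S.γ) := by noncomm_ring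
    _ = X := by rw [γ_mul_γ, one_mul, mul_one]

theorem homPart_P₀ (α : Fin 2) (X : h →L[ℂ] h) :
    homPart S.P₀ α X = (1 / 2 : ℂ) • (X + ((-1) ^ α.val : ℂ) • S.conjγ 1 X) := by
  rw [homPart_eq, conjγ_one]; rfl

/-- The operator `X` is homogeneous of degree `ξ`. -/
def OpHom (ξ : Fin 2) (X : h →L[ℂ] h) : Prop := S.conjγ 1 X = ((-1) ^ ξ.val : ℂ) • X

theorem opHom_homPart (α : Fin 2) (X : h →L[ℂ] h) : S.OpHom α (homPart S.P₀ α X) := by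
  rw [OpHom, homPart_P₀, conjγ_smul, conjγ_add, conjγ_smul, conjγ_one_conjγ_one]
  fin_cases α <;> simp [add_comm]

variable {S}

theorem OpHom.conjγ {ξ : Fin 2} {X : h →L[ℂ] h} (hX : S.OpHom ξ X) (α : Fin 2) :
    S.conjγ α X = ((-1) ^ (ξ.val * α.val) : ℂ) • X := by
  fin_cases α
  · simp [conjγ_zero]
  · simpa [OpHom] using hX

theorem OpHom.γ_apply {ξ : Fin 2} {X : h →L[ℂ] h} (hX : S.OpHom ξ X) (f : h) :
    S.γ (X f) = ((-1) ^ ξ.val : ℂ) • X (S.γ f) := by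
  have h1 := DFunLike.congr_fun hX (S.γ f)
  rw [conjγ_one_apply, γ_γ] at h1
  exact h1

theorem OpHom.hom_apply {ξ α : Fin 2} {X : h →L[ℂ] h} (hX : S.OpHom ξ X) {f : h}
    (hf : S.Hom α f) : S.Hom (ξ + α) (X f) := by
  rw [Hom, hX.γ_apply, hf, map_smul, smul_smul, neg_one_pow_add_val]

theorem OpHom.mul {ξ η : Fin 2} {X Y : h →L[ℂ] h} (hX : S.OpHom ξ X) (hY : S.OpHom η Y) :
    S.OpHom (ξ + η) (X * Y) := by
  have h1 : S.conjγ 1 (X * Y) = S.conjγ 1 X * S.conjγ 1 Y := by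
    rw [conjγ_one, conjγ_one, conjγ_one]
    calc S.γ * (X * Y) * S.γ = S.γ * X * 1 * Y * S.γ := by noncomm_ring
      _ = _ := by rw [← γ_mul_γ]; noncomm_ring
  rw [OpHom, h1, hX, hY, neg_one_pow_add_val, smul_mul_smul_comm]

theorem OpHom.add {ξ : Fin 2} {X Y : h →L[ℂ] h} (hX : S.OpHom ξ X) (hY : S.OpHom ξ Y) :
    S.OpHom ξ (X + Y) := by
  rw [OpHom, conjγ_add, hX, hY, smul_add]

theorem OpHom.smul {ξ : Fin 2} {X : h →L[ℂ] h} (hX : S.OpHom ξ X) (a : ℂ) :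
    S.OpHom ξ (a • X) := by
  rw [OpHom, conjγ_smul, hX, smul_comm]

/-- The supercommutator of operators of degrees `ξ` and `η`. -/
def brk (ξ η : Fin 2) (X Y : h →L[ℂ] h) : h →L[ℂ] h :=
  X * Y - ((-1) ^ (ξ.val * η.val) : ℂ) • (Y * X)

theorem OpHom.brk {ξ η : Fin 2} {X Y : h →L[ℂ] h} (hX : S.OpHom ξ X) (hY : S.OpHom η Y) :
    S.OpHom (ξ + η) (brk ξ η X Y) := by
  have h1 := (hX.mul hY).add (((add_comm η ξ ▸ hY.mul hX).smul (-(-1) ^ (ξ.val * η.val))))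
  rwa [neg_smul, ← sub_eq_add_neg] at h1

theorem IsSelfDual.add {X Y : h →L[ℂ] h} (hX : S.IsSelfDual X) (hY : S.IsSelfDual Y) :
    S.IsSelfDual (X + Y) := by
  rw [isSelfDual_iff] at *
  intro α f hf g
  rw [conjγ_add, add_apply, add_apply, omega_add_left, omega_add_right]
  linear_combination hX α f hf g + hY α f hf g

theorem IsSelfDual.smul {X : h →L[ℂ] h} (hX : S.IsSelfDual X) (a : ℂ) :
    S.IsSelfDual (a • X) := by
  rw [isSelfDual_iff] at *
  intro α f hf g
  rw [conjγ_smul, smul_apply, smul_apply, omega_smul_left, omega_smul_right]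
  linear_combination a * hX α f hf g

theorem IsSelfDual.conjγ_one {X : h →L[ℂ] h} (hX : S.IsSelfDual X) :
    S.IsSelfDual (S.conjγ 1 X) := by
  rw [isSelfDual_iff] at *
  intro α f hf g
  have h1 : S.conjγ α (S.conjγ 1 X) = S.conjγ 1 (S.conjγ α X) := by
    fin_cases α
    · simp [conjγ_zero]
    · rfl
  have h2 := hX α f hf (S.γ g)
  rw [h1, conjγ_one_apply, conjγ_one_apply, omega_γ_left, ← omega_γ_left S f, hf, map_smul,
    omega_smul_left, omega_smul_left]
  linear_combination (-1) ^ α.val * h2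

theorem IsSelfDual.omega_apply {ξ α : Fin 2} {X : h →L[ℂ] h} (hX : S.IsSelfDual X)
    (hξ : S.OpHom ξ X) {f : h} (hf : S.Hom α f) (g : h) :
    S.omega (X f) g = -((-1) ^ (ξ.val * α.val) * S.omega f (X g)) := by
  have h1 := (S.isSelfDual_iff X).1 hX α f hf g
  rw [hξ.conjγ, smul_apply, omega_smul_right] at h1
  linear_combination h1

theorem IsSelfDual.brk {ξ η : Fin 2} {X Y : h →L[ℂ] h} (hX : S.IsSelfDual X)
    (hY : S.IsSelfDual Y) (hξ : S.OpHom ξ X) (hη : S.OpHom η Y) :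
    S.IsSelfDual (brk ξ η X Y) := by
  rw [isSelfDual_iff]
  intro α f hf g
  have h1 : S.omega (X (Y f)) g = (-1) ^ (ξ.val * (η + α).val) * (-1) ^ (η.val * α.val)
      * S.omega f (Y (X g)) := by
    rw [hX.omega_apply hξ (hη.hom_apply hf), hY.omega_apply hη hf]; ring
  have h2 : S.omega (Y (X f)) g = (-1) ^ (η.val * (ξ + α).val) * (-1) ^ (ξ.val * α.val)
      * S.omega f (X (Y g)) := by
    rw [hY.omega_apply hη (hξ.hom_apply hf), hX.omega_apply hξ hf]; ring
  have h3 : ∀ x, NeutralSystem.brk ξ η X Y x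
      = X (Y x) + (-(-1) ^ (ξ.val * η.val) : ℂ) • Y (X x) := fun x => by
    rw [neg_smul, ← sub_eq_add_neg]; rfl
  rw [(hξ.brk hη).conjγ, smul_apply, h3, h3, omega_add_left, omega_smul_left, omega_smul_right,
    omega_add_right, omega_smul_right, h1, h2]
  -- Two applications of invariance reverse the order of X and Y; what remains is that the signs
  -- agree in each of the eight parity cases.
  fin_cases ξ <;> fin_cases η <;> fin_cases α <;> simp <;> ring

theorem γ_mul_P : S.γ * S.P = S.P * S.γ := by
  ext f; exact (S.P_γ f).symm

theorem MemG₂.add {X Y : h →L[ℂ] h} (hX : S.MemG₂ X) (hY : S.MemG₂ Y) : S.MemG₂ (X + Y) := by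
  refine ⟨hX.1.add hY.1, ?_, ?_⟩
  · rw [mul_add, add_mul]; exact hX.2.1.add hY.2.1
  · rw [mul_add, add_mul]; exact hX.2.2.add hY.2.2

theorem MemG₂.smul {X : h →L[ℂ] h} (hX : S.MemG₂ X) (a : ℂ) : S.MemG₂ (a • X) := by
  refine ⟨hX.1.smul a, ?_, ?_⟩
  · rw [mul_smul_comm, smul_mul_assoc]; exact hX.2.1.smul a
  · rw [mul_smul_comm, smul_mul_assoc]; exact hX.2.2.smul a

theorem MemG₂.conjγ_one {X : h →L[ℂ] h} (hX : S.MemG₂ X) : S.MemG₂ (S.conjγ 1 X) := by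
  refine ⟨hX.1.conjγ_one, ?_, ?_⟩
  · have : S.P * S.conjγ 1 X * (1 - S.P) = S.γ * (S.P * X * (1 - S.P)) * S.γ := by
      rw [NeutralSystem.conjγ_one]
      calc _ = S.P * S.γ * X * S.γ - S.P * S.γ * X * (S.γ * S.P) := by noncomm_ring
        _ = S.γ * S.P * X * S.γ - S.γ * S.P * X * (S.P * S.γ) := by rw [γ_mul_P]
        _ = _ := by noncomm_ring
    rw [this]; exact (hX.2.1.mul_left _).mul_right _
  · have : (1 - S.P) * S.conjγ 1 X * S.P = S.γ * ((1 - S.P) * X * S.P) * S.γ := by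
      rw [NeutralSystem.conjγ_one]
      calc _ = S.γ * X * (S.γ * S.P) - S.P * S.γ * X * (S.γ * S.P) := by noncomm_ring
        _ = S.γ * X * (S.P * S.γ) - S.γ * S.P * X * (S.P * S.γ) := by rw [γ_mul_P]
        _ = _ := by noncomm_ring
    rw [this]; exact (hX.2.2.mul_left _).mul_right _

theorem MemG₂.conjγ {X : h →L[ℂ] h} (hX : S.MemG₂ X) (α : Fin 2) : S.MemG₂ (S.conjγ α X) := by
  fin_cases α
  · simpa [conjγ_zero] using hX
  · exact hX.conjγ_one

theorem MemG₂.homPart {X : h →L[ℂ] h} (hX : S.MemG₂ X) (α : Fin 2) :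
    S.MemG₂ (homPart S.P₀ α X) := by
  rw [homPart_P₀]
  exact (hX.add (hX.conjγ_one.smul _)).smul _

/-- Inserting 1 = P + (1-P) between X and Y writes each off-diagonal block of XY as a sum of two
terms, each with one Hilbert–Schmidt factor. -/
theorem MemG₂.brk {ξ η : Fin 2} {X Y : h →L[ℂ] h} (hX : S.MemG₂ X)
    (hY : S.MemG₂ Y) (hξ : S.OpHom ξ X) (hη : S.OpHom η Y) : S.MemG₂ (brk ξ η X Y) := by
  have h1 : ∀ {X Y}, S.MemG₂ X → S.MemG₂ Y → IsHilbertSchmidt (S.P * (X * Y) * (1 - S.P)) := by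
    intro X Y hX hY
    have : S.P * (X * Y) * (1 - S.P)
        = S.P * X * (1 - S.P) * (Y * (1 - S.P)) + (S.P * X) * (S.P * Y * (1 - S.P)) := by
      noncomm_ring
    rw [this]
    exact (hX.2.1.mul_right _).add (hY.2.1.mul_left _)
  have h2 : ∀ {X Y}, S.MemG₂ X → S.MemG₂ Y → IsHilbertSchmidt ((1 - S.P) * (X * Y) * S.P) := by
    intro X Y hX hY
    have : (1 - S.P) * (X * Y) * S.P
        = (1 - S.P) * X * S.P * (Y * S.P) + ((1 - S.P) * X) * ((1 - S.P) * Y * S.P) := by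
      noncomm_ring
    rw [this]
    exact (hX.2.2.mul_right _).add (hY.2.2.mul_left _)
  refine ⟨hX.1.brk hY.1 hξ hη, ?_, ?_⟩
  · rw [NeutralSystem.brk, sub_eq_add_neg (X * Y), ← neg_smul, mul_add, add_mul, mul_smul_comm,
      smul_mul_assoc]
    exact (h1 hX hY).add ((h1 hY hX).smul _)
  · rw [NeutralSystem.brk, sub_eq_add_neg (X * Y), ← neg_smul, mul_add, add_mul, mul_smul_comm,
      smul_mul_assoc]
    exact (h2 hX hY).add ((h2 hY hX).smul _)

variable (S) in
theorem superComm_eq (X Y : h →L[ℂ] h) :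
    superComm S.P₀ X Y
      = ∑ α : Fin 2, ∑ β : Fin 2, brk α β (homPart S.P₀ α X) (homPart S.P₀ β Y) := by
  refine Finset.sum_congr rfl fun α _ => Finset.sum_congr rfl fun β _ => ?_
  rw [brk]
  congr 1
  fin_cases α <;> fin_cases β <;> simp

theorem MemG₂.superComm {X Y : h →L[ℂ] h} (hX : S.MemG₂ X) (hY : S.MemG₂ Y) :
    S.MemG₂ (superComm S.P₀ X Y) := by
  rw [superComm_eq, Fin.sum_univ_two, Fin.sum_univ_two, Fin.sum_univ_two]
  have key := fun α β : Fin 2 => (hX.homPart α).brk (hY.homPart β)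
    (S.opHom_homPart α X) (S.opHom_homPart β Y)
  exact ((key 0 0).add (key 0 1)).add ((key 1 0).add (key 1 1))

end NeutralSystem

end

/-! ### The half space Ph, its coordinates, and the kernels of X. -/

noncomputable section

namespace NeutralSystem

variable {h : Type*} [NormedAddCommGroup h] [InnerProductSpace ℂ h] [CompleteSpace h]
variable {S : NeutralSystem h}

theorem P_coe_half (f : S.half) : S.P (f : h) = f := by
  obtain ⟨f, g, rfl⟩ := f
  exact S.P_P g

theorem coe_toHalf (f : h) : (S.toHalf f : h) = S.P f := rfl

theorem toHalf_coe (f : S.half) : S.toHalf (f : h) = f := Subtype.ext (P_coe_half f)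

theorem inner_toHalf_left (f : h) (g : S.half) : ⟪S.toHalf f, g⟫_ℂ = ⟪f, (g : h)⟫_ℂ := by
  rw [Submodule.coe_inner, coe_toHalf, inner_P_left, P_coe_half]

theorem P_J_of_P {f : h} (hf : S.P f = f) : S.P (S.J f) = 0 := by
  rw [P_J, hf, sub_self]

/-! ### The basis of `h` obtained from a basis of the half space -/

/-- J maps Ph into (1-P)h and is antiunitary, so the Jeₙ are orthonormal and orthogonal to the eₘ.
-/
theorem orthonormal_double {κ : Type*} (e : HilbertBasis κ ℂ S.half) :
    Orthonormal ℂ (Sum.elim (fun n => (e n : h)) fun n => S.J (e n)) := by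
  classical
  rw [orthonormal_iff_ite]
  have h1 := orthonormal_iff_ite.1 e.orthonormal
  have h2 : ∀ m n, ⟪(e m : h), S.J (e n)⟫_ℂ = 0 := fun m n => by
    rw [← P_coe_half (e m), inner_P_left, P_J_of_P (P_coe_half _), inner_zero_right]
  rintro (m | m) (n | n)
  · simpa using h1 m n
  · simpa using h2 m n
  · simpa using (inner_eq_zero_symm.1 (h2 n m))
  · have h3 := h1 n m
    simp only [Sum.elim_inr, Sum.inr.injEq]
    rw [inner_map_map_of_antilinear, ← Submodule.coe_inner, h3]
    simp only [eq_comm]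

/-- The Hilbert basis `(eₙ), (J eₙ)` of `h`. -/
def doubleBasis {κ : Type*} (e : HilbertBasis κ ℂ S.half) : HilbertBasis (κ ⊕ κ) ℂ h :=
  HilbertBasis.mkOfOrthogonalEqBot (orthonormal_double e) (by
    have key : ∀ y : h, (∀ n, ⟪(e n : h), y⟫_ℂ = 0) → S.P y = 0 := fun y hy => by
      have h1 : S.toHalf y = 0 := by
        apply e.repr.injective
        apply lp.ext; funext n
        rw [e.repr_apply_apply, map_zero, ← inner_conj_symm, inner_toHalf_left, inner_conj_symm,
          hy n]
        rfl
      rw [← coe_toHalf, h1]; rfl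
    rw [eq_bot_iff]
    intro x hx
    rw [Submodule.mem_orthogonal] at hx
    have h1 : S.P x = 0 := key x fun n => hx _ (Submodule.subset_span ⟨Sum.inl n, rfl⟩)
    have h2 : S.P (S.J x) = 0 := key _ fun n => by
      have h3 : ⟪S.J (e n), x⟫_ℂ = 0 := hx _ (Submodule.subset_span ⟨Sum.inr n, rfl⟩)
      rw [inner_J_right, ← inner_conj_symm, h3, map_zero]
    rw [P_J, h1, map_zero, sub_zero] at h2
    rw [Submodule.mem_bot, ← S.J_J x, h2, map_zero])

@[simp]
theorem doubleBasis_inl {κ : Type*} (e : HilbertBasis κ ℂ S.half) (n : κ) :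
    doubleBasis e (Sum.inl n) = e n := by
  rw [doubleBasis, HilbertBasis.coe_mkOfOrthogonalEqBot]; rfl

@[simp]
theorem doubleBasis_inr {κ : Type*} (e : HilbertBasis κ ℂ S.half) (n : κ) :
    doubleBasis e (Sum.inr n) = S.J (e n) := by
  rw [doubleBasis, HilbertBasis.coe_mkOfOrthogonalEqBot]; rfl

/-- Evaluate in the doubled basis: 1 - P kills eₙ and fixes Jeₙ. The right side is the square norm
of the pair creation kernel. -/
theorem isHilbertSchmidt_PX_iff {κ : Type*} (e : HilbertBasis κ ℂ S.half) (X : h →L[ℂ] h) :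
    IsHilbertSchmidt (S.P * X * (1 - S.P))
      ↔ Summable fun n => ‖S.P (X (S.J (e n)))‖ ^ 2 := by
  have h1 : ∀ n, (S.P * X * (1 - S.P)) (doubleBasis e (Sum.inl n)) = 0 := fun n => by
    change S.P (X (doubleBasis e (Sum.inl n) - S.P (doubleBasis e (Sum.inl n)))) = 0
    rw [doubleBasis_inl, P_coe_half, sub_self, map_zero, map_zero]
  have h2 : ∀ n, (S.P * X * (1 - S.P)) (doubleBasis e (Sum.inr n))
      = S.P (X (S.J (e n))) := fun n => by
    change S.P (X (doubleBasis e (Sum.inr n) - S.P (doubleBasis e (Sum.inr n)))) = _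
    rw [doubleBasis_inr, P_J_of_P (P_coe_half _), sub_zero]
  have h3 : (Summable fun i => ‖(S.P * X * (1 - S.P)) (doubleBasis e i)‖ ^ 2)
      ↔ Summable fun n => ‖S.P (X (S.J (e n)))‖ ^ 2 := by
    rw [← Sum.inr_injective.summable_iff]
    · simp only [Function.comp_def, h2]
    · rintro (n | n) hn
      · rw [h1, norm_zero, zero_pow two_ne_zero]
      · exact absurd ⟨n, rfl⟩ hn
  exact ⟨fun hs => h3.1 (hs.summable _), fun hs => isHilbertSchmidt_of_summable (h3.2 hs)⟩

theorem isHilbertSchmidt_XP_iff {κ : Type*} (e : HilbertBasis κ ℂ S.half) (X : h →L[ℂ] h) :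
    IsHilbertSchmidt ((1 - S.P) * X * S.P)
      ↔ Summable fun n => ‖S.P (S.γ (S.J (X (e n))))‖ ^ 2 := by
  have hγ : ∀ f, ‖S.γ f‖ = ‖f‖ := fun f => by
    have : ⟪S.γ f, S.γ f⟫_ℂ = ⟪f, f⟫_ℂ := by rw [inner_γ_left, γ_γ]
    rw [inner_self_eq_norm_sq_to_K, inner_self_eq_norm_sq_to_K] at this
    have h2 : ‖S.γ f‖ ^ 2 = ‖f‖ ^ 2 := by exact_mod_cast this
    exact (sq_eq_sq₀ (norm_nonneg _) (norm_nonneg _)).1 h2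
  have h1 : ∀ n, ((1 - S.P) * X * S.P) (doubleBasis e (Sum.inr n)) = 0 := fun n => by
    change X (S.P (doubleBasis e (Sum.inr n))) - S.P (X (S.P (doubleBasis e (Sum.inr n)))) = 0
    rw [doubleBasis_inr, P_J_of_P (P_coe_half _), map_zero, map_zero, sub_zero]
  have h2 : ∀ n, ‖((1 - S.P) * X * S.P) (doubleBasis e (Sum.inl n))‖
      = ‖S.P (S.γ (S.J (X (e n))))‖ := fun n => by
    change ‖X (S.P (doubleBasis e (Sum.inl n))) - S.P (X (S.P (doubleBasis e (Sum.inl n))))‖ = _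
    rw [doubleBasis_inl, P_coe_half, P_γ, hγ, P_J, ← map_sub, S.J.norm_map]
  have h3 : (Summable fun i => ‖((1 - S.P) * X * S.P) (doubleBasis e i)‖ ^ 2)
      ↔ Summable fun n => ‖S.P (S.γ (S.J (X (e n))))‖ ^ 2 := by
    rw [← Sum.inl_injective.summable_iff]
    · simp only [Function.comp_def, h2]
    · rintro (n | n) hn
      · exact absurd ⟨n, rfl⟩ hn
      · rw [h1, norm_zero, zero_pow two_ne_zero]
  exact ⟨fun hs => h3.1 (hs.summable _), fun hs => isHilbertSchmidt_of_summable (h3.2 hs)⟩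

/-! ### Coordinates on the half space -/

variable {ι₀ ι₁ : Type*} (b : S.ModeBasis ι₀ ι₁)

namespace ModeBasis

/-- The one-particle space in coordinates as a subspace of `h`. -/
def emb : OnePart ι₀ ι₁ →ₗᵢ[ℂ] h :=
  S.half.subtypeₗᵢ.comp b.basis.repr.symm.toLinearIsometry

/-- The adjoint of `emb`. -/
def proj : h →L[ℂ] OnePart ι₀ ι₁ :=
  b.basis.repr.toLinearIsometry.toContinuousLinearMap.comp S.toHalf

theorem emb_apply (u : OnePart ι₀ ι₁) : b.emb u = (b.basis.repr.symm u : S.half) := rfl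

theorem proj_apply (f : h) : b.proj f = b.basis.repr (S.toHalf f) := rfl

@[simp]
theorem P_emb (u : OnePart ι₀ ι₁) : S.P (b.emb u) = b.emb u := P_coe_half _

@[simp]
theorem proj_emb (u : OnePart ι₀ ι₁) : b.proj (b.emb u) = u := by
  rw [proj_apply, emb_apply, toHalf_coe, LinearIsometryEquiv.apply_symm_apply]

@[simp]
theorem emb_proj (f : h) : b.emb (b.proj f) = S.P f := by
  rw [proj_apply, emb_apply, LinearIsometryEquiv.symm_apply_apply, coe_toHalf]

@[simp]
theorem proj_P (f : h) : b.proj (S.P f) = b.proj f := by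
  rw [← emb_proj, proj_emb]

theorem norm_proj (f : h) : ‖b.proj f‖ = ‖S.P f‖ := by
  rw [← b.emb.norm_map, emb_proj]

theorem inner_proj_left (f : h) (u : OnePart ι₀ ι₁) : ⟪b.proj f, u⟫_ℂ = ⟪f, b.emb u⟫_ℂ := by
  rw [← b.emb.inner_map_map, emb_proj, inner_P_left, P_emb]

theorem inner_proj_right (f : h) (u : OnePart ι₀ ι₁) : ⟪u, b.proj f⟫_ℂ = ⟪b.emb u, f⟫_ℂ := by
  rw [← inner_conj_symm, inner_proj_left, inner_conj_symm]

@[simp]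
theorem P_J_emb (u : OnePart ι₀ ι₁) : S.P (S.J (b.emb u)) = 0 := P_J_of_P (b.P_emb u)

theorem proj_eq_zero {f : h} (hf : S.P f = 0) : b.proj f = 0 := by
  rw [← proj_P, hf, map_zero]

theorem emb_mode (i : ι₀ ⊕ ι₁) : b.emb (mode i) = (b.basis i : S.half) := by
  classical
  rw [emb_apply, ← b.basis.repr_symm_single, mode]

theorem γ_emb (u : OnePart ι₀ ι₁) : S.γ (b.emb u) = b.emb (twist 1 u) := by
  have h1 := ((hasSum_mode u).mapL b.emb.toContinuousLinearMap).mapL S.γ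
  have h2 := (hasSum_mode u).mapL
    (b.emb.toContinuousLinearMap.comp (twist 1).toContinuousLinearMap)
  refine h1.unique (h2.congr_fun fun i => ?_)
  rw [map_smul, map_smul, map_smul]
  congr 1
  change S.γ (b.emb (mode i)) = b.emb (twist 1 (mode i))
  rw [twist_mode, map_smul, emb_mode, γ_apply]
  rcases i with i | j
  · rw [b.even]; simp [modeSign, modeDeg]
  · rw [b.odd]; simp [modeSign, modeDeg]

theorem proj_γ (f : h) : b.proj (S.γ f) = twist 1 (b.proj f) := by
  apply b.emb.injective
  rw [emb_proj, ← γ_emb, emb_proj, P_γ]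

theorem γ_pow_emb (α : Fin 2) (u : OnePart ι₀ ι₁) :
    (S.γ ^ α.val) (b.emb u) = b.emb (twist α u) := by
  fin_cases α
  · simp [twist_zero]
  · simp [γ_emb]

theorem proj_γ_pow (α : Fin 2) (f : h) :
    b.proj ((S.γ ^ α.val) f) = twist α (b.proj f) := by
  fin_cases α
  · simp [twist_zero]
  · simp [proj_γ]

theorem hom_emb {α : Fin 2} {u : OnePart ι₀ ι₁} (hu : IsHom α u) : S.Hom α (b.emb u) := by
  rw [Hom, γ_emb, hu.twist_eq, map_smul]; simp

theorem isHom_proj {α : Fin 2} {f : h} (hf : S.Hom α f) : IsHom α (b.proj f) := by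
  intro i hi
  have h1 : twist 1 (b.proj f) = ((-1) ^ α.val : ℂ) • b.proj f := by
    rw [← proj_γ, hf, map_smul]
  have h2 := congrArg (fun u : OnePart ι₀ ι₁ => (u i : ℂ)) h1
  simp only [twist_apply, lp.coeFn_smul, Pi.smul_apply, smul_eq_mul, modeSign] at h2
  generalize (b.proj f i : ℂ) = z at h2 ⊢
  generalize modeDeg i = β at h2 hi
  fin_cases α <;> fin_cases β <;> simp at hi h2 ⊢
  · linear_combination (-1 / 2 : ℂ) * h2
  · linear_combination (1 / 2 : ℂ) * h2

/-- The kernel of the `a†a` part. -/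
def kernCA (X : h →L[ℂ] h) : OnePart ι₀ ι₁ →L[ℂ] OnePart ι₀ ι₁ :=
  b.proj ∘L X ∘L b.emb.toContinuousLinearMap

/-- The kernel of the `a†a†` part. -/
def kernCC (X : h →L[ℂ] h) : OnePart ι₀ ι₁ →L⋆[ℂ] OnePart ι₀ ι₁ :=
  (b.proj ∘L X).comp (S.J.toContinuousLinearMap.comp b.emb.toContinuousLinearMap)

/-- The kernel of the `aa` part. -/
def kernAA (X : h →L[ℂ] h) : OnePart ι₀ ι₁ →L⋆[ℂ] OnePart ι₀ ι₁ :=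
  (b.proj ∘L S.γ).comp (S.J.toContinuousLinearMap.comp (X ∘L b.emb.toContinuousLinearMap))

theorem kernCA_apply (X : h →L[ℂ] h) (u : OnePart ι₀ ι₁) :
    b.kernCA X u = b.proj (X (b.emb u)) := rfl

theorem kernCC_apply (X : h →L[ℂ] h) (u : OnePart ι₀ ι₁) :
    b.kernCC X u = b.proj (X (S.J (b.emb u))) := rfl

theorem kernAA_apply (X : h →L[ℂ] h) (u : OnePart ι₀ ι₁) :
    b.kernAA X u = b.proj (S.γ (S.J (X (b.emb u)))) := rfl

theorem γ_pow_J (α : Fin 2) (f : h) : (S.γ ^ α.val) (S.J f) = S.J ((S.γ ^ α.val) f) := by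
  fin_cases α
  · simp
  · simp [J_γ]

theorem inner_γ_pow_left (α : Fin 2) (f g : h) :
    ⟪(S.γ ^ α.val) f, g⟫_ℂ = ⟪f, (S.γ ^ α.val) g⟫_ℂ := by
  fin_cases α
  · simp
  · simp [inner_γ_left]

theorem kernCA_conjγ (α : Fin 2) (X : h →L[ℂ] h) :
    b.kernCA (S.conjγ α X) = conjTwist α (b.kernCA X) := by
  ext1 u
  rw [conjTwist_apply, kernCA_apply, kernCA_apply, conjγ_apply, proj_γ_pow, γ_pow_emb]

theorem kernCC_conjγ (α : Fin 2) (X : h →L[ℂ] h) :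
    b.kernCC (S.conjγ α X) = conjTwistₛ α (b.kernCC X) := by
  ext1 u
  rw [conjTwistₛ_apply, kernCC_apply, kernCC_apply, conjγ_apply, proj_γ_pow, γ_pow_J, γ_pow_emb]

theorem kernAA_conjγ (α : Fin 2) (X : h →L[ℂ] h) :
    b.kernAA (S.conjγ α X) = conjTwistₛ α (b.kernAA X) := by
  ext1 u
  rw [conjTwistₛ_apply, kernAA_apply, kernAA_apply, conjγ_apply, ← γ_pow_J, γ_pow_emb]
  have h1 : ∀ f, S.γ ((S.γ ^ α.val) f) = (S.γ ^ α.val) (S.γ f) := fun f => by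
    change (S.γ * S.γ ^ α.val) f = (S.γ ^ α.val * S.γ) f
    rw [← pow_succ, ← pow_succ']
  rw [h1, proj_γ_pow]

theorem modeHS_kernCC_iff (X : h →L[ℂ] h) :
    ModeHS (b.kernCC X) ↔ IsHilbertSchmidt (S.P * X * (1 - S.P)) := by
  rw [isHilbertSchmidt_PX_iff b.basis, ModeHS]
  simp only [kernCC_apply, norm_proj, emb_mode]

theorem modeHS_kernAA_iff (X : h →L[ℂ] h) :
    ModeHS (b.kernAA X) ↔ IsHilbertSchmidt ((1 - S.P) * X * S.P) := by
  rw [isHilbertSchmidt_XP_iff b.basis, ModeHS]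
  simp only [kernAA_apply, norm_proj, emb_mode]

/-! ### Symmetry of the kernels of self-dual operators -/

theorem γq_emb (u : OnePart ι₀ ι₁) : S.γq (b.emb u) = S.γ (b.emb u) := by
  rw [γq_apply, P_emb, sub_self, sub_zero]

theorem γq_J_emb (u : OnePart ι₀ ι₁) : S.γq (S.J (b.emb u)) = - S.J (b.emb u) := by
  rw [γq_apply, P_J_emb, map_zero, sub_zero, zero_sub]

theorem inner_kernAA_left (X : h →L[ℂ] h) (u v : OnePart ι₀ ι₁) :
    ⟪b.kernAA X u, v⟫_ℂ = ⟪S.γ (S.J (b.emb v)), X (b.emb u)⟫_ℂ := by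
  rw [kernAA_apply, inner_proj_left, inner_γ_left, inner_J_left, J_γ]

theorem inner_kernCC_right (X : h →L[ℂ] h) (u v : OnePart ι₀ ι₁) :
    ⟪u, b.kernCC X v⟫_ℂ = ⟪b.emb u, X (S.J (b.emb v))⟫_ℂ := by
  rw [kernCC_apply, inner_proj_right]

theorem γ_pow_eq_γ {α : Fin 2} {f : h} (hf : S.Hom α f) : (S.γ ^ α.val) f = S.γ f := by
  unfold Hom at hf
  fin_cases α
  · simpa using hf.symm
  · simp

/-- Invariance of ω for two vectors of Ph. The graded symmetry of the kernel matches the exchange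
relation of the two annihilators, so both contractions of aa with a creator agree. -/
theorem kernAA_symm {X : h →L[ℂ] h} (hX : S.IsSelfDual X) {α : Fin 2} {u : OnePart ι₀ ι₁}
    (hu : IsHom α u) (v : OnePart ι₀ ι₁) :
    ⟪b.kernAA X u, v⟫_ℂ = ⟪b.kernAA X (twist α v), u⟫_ℂ := by
  have h1 := (S.isSelfDual_iff X).1 hX α _ (b.hom_emb hu) (b.emb v)
  rw [omega, omega, γq_emb, ← inner_γq_left, γq_J_emb, inner_neg_left, conjγ_apply, γ_pow_emb,
    ← inner_γ_pow_left, γ_pow_eq_γ (Hom.J S (b.hom_emb hu)), inner_J_left, J_γ] at h1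
  rw [inner_kernAA_left, inner_kernAA_left]
  linear_combination h1

/-- Invariance of ω for two vectors of J(Ph) = (1-P)h. -/
theorem kernCC_symm {X : h →L[ℂ] h} (hX : S.IsSelfDual X) {α : Fin 2} {u : OnePart ι₀ ι₁}
    (hu : IsHom α u) (v : OnePart ι₀ ι₁) :
    ⟪u, b.kernCC X v⟫_ℂ = ⟪v, twist α (b.kernCC X u)⟫_ℂ := by
  have h0 := Hom.J S (b.hom_emb hu)
  have h1 := (S.isSelfDual_iff X).1 hX α _ h0 (S.J (b.emb (twist α v)))
  have h2 : S.Hom α (S.γ (b.emb u)) := by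
    have := b.hom_emb hu
    rw [Hom] at this ⊢
    rw [this, map_smul, this]
  rw [omega, omega, γq_J_emb, inner_neg_right, inner_map_map_of_antilinear, S.J_J,
    ← inner_γq_left, γq_emb, conjγ_apply, γ_pow_J, γ_pow_emb, twist_twist, ← inner_γ_pow_left,
    γ_pow_eq_γ h2, γ_γ] at h1
  rw [← inner_twist_left, inner_kernCC_right, inner_kernCC_right]
  linear_combination h1

/-- Invariance of ω for one vector in each half. It identifies the adjoint of the twisted PXP with
the block (1-P)X(1-P) carried over to Ph by γJ, so the commutator of the a†a part with an
annihilator sees that block. -/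
theorem kernCA_symm {X : h →L[ℂ] h} (hX : S.IsSelfDual X) {α : Fin 2} {u : OnePart ι₀ ι₁}
    (hu : IsHom α u) (v : OnePart ι₀ ι₁) :
    ⟪u, conjTwist α (b.kernCA X) v⟫_ℂ
      = ⟪-b.proj (S.γ (S.J (X (S.J (S.γ (b.emb u)))))), v⟫_ℂ := by
  have h2 : S.Hom α (S.γ (b.emb u)) := by
    have := b.hom_emb hu
    rw [Hom] at this ⊢
    rw [this, map_smul, this]
  have h1 := (S.isSelfDual_iff X).1 hX α _ (Hom.J S h2) (b.emb v)
  rw [omega, omega, γq_emb, S.J_J, ← inner_γq_left, γq_γ, γq_emb, γ_γ, ← inner_γ_left] at h1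
  rw [← kernCA_conjγ, kernCA_apply, inner_proj_right, inner_neg_left, inner_proj_left]
  linear_combination h1

/-! ### The currents -/

variable [LinearOrder ι₁]

/-- `dΓ̂(X)` on the finite-particle vectors. -/
def dGamma (X : h →L[ℂ] h) : Module.End ℂ (finPart ι₀ ι₁) :=
  quadCA (b.kernCA X) + (1 / 2 : ℂ) • quadCC (b.kernCC X) - (1 / 2 : ℂ) • quadAA (b.kernAA X)

theorem BDag_eq (f : h) : b.BDag f = cre (b.proj f) - ann (b.proj (S.γ (S.J f))) := by
  have h1 : S.toHalf (S.γ (S.J (f - S.P f))) = S.toHalf (S.γ (S.J f)) := by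
    apply Subtype.ext
    rw [coe_toHalf, coe_toHalf, P_γ, P_γ, map_sub, ← P_J, P_P]
  rw [BDag, h1]; rfl

theorem BDag_add (f g : h) : b.BDag (f + g) = b.BDag f + b.BDag g := by
  simp only [BDag_eq, map_add, cre_add, ann_add]; abel

theorem BDag_smul (a : ℂ) (f : h) : b.BDag (a • f) = a • b.BDag f := by
  simp only [BDag_eq, map_smul, map_smulₛₗ, cre_smul, ann_smul, Complex.conj_conj, smul_sub]

theorem BDag_emb (u : OnePart ι₀ ι₁) : b.BDag (b.emb u) = cre u := by
  rw [BDag_eq, proj_emb, b.proj_eq_zero (f := S.γ (S.J (b.emb u)))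
    (by rw [P_γ, P_J_emb, map_zero])]
  have : ann (0 : OnePart ι₀ ι₁) = 0 := by
    have := ann_smul (0 : ℂ) (0 : OnePart ι₀ ι₁)
    simpa using this
  rw [this, sub_zero]

theorem BDag_J_emb (u : OnePart ι₀ ι₁) : b.BDag (S.J (S.γ (b.emb u))) = - ann u := by
  rw [BDag_eq, S.J_J, γ_γ, proj_emb, J_γ, b.proj_eq_zero (f := S.γ (S.J (b.emb u)))
    (by rw [P_γ, P_J_emb, map_zero])]
  have : cre (0 : OnePart ι₀ ι₁) = 0 := by
    have := cre_smul (0 : ℂ) (0 : OnePart ι₀ ι₁)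
    simpa using this
  rw [this, zero_sub]

theorem secBdd_dGamma {X : h →L[ℂ] h} (hX : S.MemG₂ X) : SecBdd (b.dGamma X) :=
  ((goodSeries_quadCA _).secBdd.add
    ((goodSeries_quadCC ((b.modeHS_kernCC_iff X).2 hX.2.1)).secBdd.smul _)).sub
    ((goodSeries_quadAA ((b.modeHS_kernAA_iff X).2 hX.2.2)).secBdd.smul _)

theorem dGamma_apply (X : h →L[ℂ] h) (φ : finPart ι₀ ι₁) :
    b.dGamma X φ = quadCA (b.kernCA X) φ + (1 / 2 : ℂ) • quadCC (b.kernCC X) φ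
      - (1 / 2 : ℂ) • quadAA (b.kernAA X) φ := rfl

/-- The a†a part contributes a†(PXu). The two contractions of the aa part coincide by `kernAA_symm`,
which cancels the ½ and leaves -a(PγJXu). Together they are B̂†(Xu). -/
theorem dGamma_cre {X : h →L[ℂ] h} (hX : S.MemG₂ X) {α : Fin 2} {u : OnePart ι₀ ι₁}
    (hu : IsHom α u) (φ : finPart ι₀ ι₁) :
    b.dGamma X (cre u φ) = b.BDag (X (b.emb u)) φ + cre u (b.dGamma (S.conjγ α X) φ) := by
  have hg : ∀ v, ⟪b.kernAA X v, u⟫_ℂ = ⟪twist α (b.kernAA X u), v⟫_ℂ := fun v => by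
    rw [inner_twist_left, b.kernAA_symm hX.1 hu, twist_twist]
  rw [dGamma_apply, dGamma_apply, quadCA_cre hu,
    quadCC_cre hu ((b.modeHS_kernCC_iff X).2 hX.2.1),
    quadAA_cre hu ((b.modeHS_kernAA_iff X).2 hX.2.2) hg, twist_twist, BDag_eq, kernCA_conjγ,
    kernCC_conjγ, kernAA_conjγ, map_sub, map_add, map_smul, map_smul, LinearMap.sub_apply,
    ← kernCA_apply, ← kernAA_apply]
  module

/-- As for creators, but now the a†a† part has the two contractions, equal by `kernCC_symm`, and the
a†a part is evaluated with `kernCA_symm`. -/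
theorem dGamma_ann {X : h →L[ℂ] h} (hX : S.MemG₂ X) {α : Fin 2} {u : OnePart ι₀ ι₁}
    (hu : IsHom α u) (φ : finPart ι₀ ι₁) :
    b.dGamma X (ann u φ)
      = - b.BDag (X (S.J (S.γ (b.emb u)))) φ + ann u (b.dGamma (S.conjγ α X) φ) := by
  have hg : ∀ v, ⟪u, conjTwistₛ α (b.kernCC X) v⟫_ℂ = ⟪v, b.kernCC X (twist α u)⟫_ℂ := fun v => by
    rw [← kernCC_conjγ, b.kernCC_symm (hX.conjγ α).1 hu, kernCC_conjγ, conjTwistₛ_apply,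
      twist_twist]
  have h1 : b.proj (X (S.J (S.γ (b.emb u)))) = b.kernCC X (twist α u) := by
    rw [kernCC_apply, ← γ_pow_emb, γ_pow_eq_γ (b.hom_emb hu)]
  have h2 : ∀ v : OnePart ι₀ ι₁, ann (-v) = - ann v := fun v => by
    refine LinearMap.ext fun ψ => ?_
    rw [← neg_one_smul ℂ v, ann_smul, LinearMap.smul_apply, LinearMap.neg_apply, map_neg, map_one,
      neg_one_smul]
  rw [dGamma_apply, dGamma_apply, quadCA_ann hu _ (b.kernCA_symm hX.1 hu),
    quadCC_ann hu ((b.modeHS_kernCC_iff X).2 hX.2.1) hg,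
    quadAA_ann hu ((b.modeHS_kernAA_iff X).2 hX.2.2), BDag_eq, kernCA_conjγ,
    kernCC_conjγ, kernAA_conjγ, map_sub, map_add, map_smul, map_smul, LinearMap.sub_apply, h1,
    h2, LinearMap.neg_apply]
  module

theorem dGamma_BDag {X : h →L[ℂ] h} (hX : S.MemG₂ X) {α : Fin 2} {f : h} (hf : S.Hom α f)
    (φ : finPart ι₀ ι₁) :
    b.dGamma X (b.BDag f φ) = b.BDag (X f) φ + b.BDag f (b.dGamma (S.conjγ α X) φ) := by
  -- The component (1-P)f is Jγv with v = PγJf in Ph, so B̂†(f) = a†(Pf) - a(v) and both commutators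
  -- are known.
  have h1 : f = b.emb (b.proj f) + S.J (S.γ (b.emb (b.proj (S.γ (S.J f))))) := by
    rw [emb_proj, emb_proj, P_γ, γ_γ, S.J_P, S.J_J]; abel
  have h2 : IsHom α (b.proj (S.γ (S.J f))) := by
    refine b.isHom_proj ?_
    have := Hom.J S hf
    rw [Hom] at this ⊢
    rw [this, map_smul, this]
  have h3 := b.dGamma_cre hX (b.isHom_proj hf) φ
  have h4 := b.dGamma_ann hX h2 φ
  have h5 : b.BDag f = cre (b.proj f) - ann (b.proj (S.γ (S.J f))) := b.BDag_eq f
  have h6 : b.BDag (X f) = b.BDag (X (b.emb (b.proj f)))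
      + b.BDag (X (S.J (S.γ (b.emb (b.proj (S.γ (S.J f))))))) := by
    rw [← BDag_add, ← map_add, ← h1]
  rw [h5, h6, LinearMap.sub_apply, map_sub, h3, h4, LinearMap.add_apply, LinearMap.sub_apply]
  abel

end ModeBasis

end NeutralSystem

end

/-! ### Grading of the currents, the Schwinger term and the commutator of two currents. -/

noncomputable section

theorem homPart_add {R : Type*} [Ring R] (p : R) (α : Fin 2) (x y : R) :
    homPart p α (x + y) = homPart p α x + homPart p α y := by
  unfold homPart
  split_ifs <;> noncomm_ring

theorem superComm_add_right {R : Type*} [Ring R] (p x y z : R) :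
    superComm p x (y + z) = superComm p x y + superComm p x z := by
  simp only [superComm, homPart_add, ← Finset.sum_add_distrib]
  refine Finset.sum_congr rfl fun α _ => Finset.sum_congr rfl fun β _ => ?_
  noncomm_ring

theorem homPart_fockEven {ι₀ ι₁ : Type*} (α : Fin 2) (T : Module.End ℂ (finPart ι₀ ι₁)) :
    homPart fockEven α T
      = (1 / 2 : ℂ) • (T + ((-1) ^ α.val : ℂ) • (parity ι₀ ι₁ * T * parity ι₀ ι₁)) := by
  have : parity ι₀ ι₁ = fockEven - (1 - fockEven) := by
    rw [parity]; module
  rw [homPart_eq, this]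

theorem vacCoeff_parity {ι₀ ι₁ : Type*} (φ : finPart ι₀ ι₁) : vacCoeff (parity ι₀ ι₁ φ) = vacCoeff φ := by
  rw [vacCoeff, parity_apply]; simp [configSign, vacCoeff]

namespace NeutralSystem

variable {h : Type*} [NormedAddCommGroup h] [InnerProductSpace ℂ h] [CompleteSpace h]
variable {S : NeutralSystem h}
variable {ι₀ ι₁ : Type*} (b : S.ModeBasis ι₀ ι₁)

theorem MemG₂.modeHS_kernCC {X : h →L[ℂ] h} (hX : S.MemG₂ X) : ModeHS (b.kernCC X) :=
  (b.modeHS_kernCC_iff X).2 hX.2.1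

theorem MemG₂.modeHS_kernAA {X : h →L[ℂ] h} (hX : S.MemG₂ X) : ModeHS (b.kernAA X) :=
  (b.modeHS_kernAA_iff X).2 hX.2.2

namespace ModeBasis

variable [LinearOrder ι₁]

/-! ### Linearity and grading -/

theorem dGamma_add {X Y : h →L[ℂ] h} (hX : S.MemG₂ X) (hY : S.MemG₂ Y) :
    b.dGamma (X + Y) = b.dGamma X + b.dGamma Y := by
  have h1 : b.kernCA (X + Y) = b.kernCA X + b.kernCA Y := by
    ext1 u; simp [kernCA_apply]
  have h2 : b.kernCC (X + Y) = b.kernCC X + b.kernCC Y := by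
    ext1 u; simp [kernCC_apply]
  have h3 : b.kernAA (X + Y) = b.kernAA X + b.kernAA Y := by
    ext1 u; simp [kernAA_apply]
  rw [dGamma, h1, h2, h3, quadCA_add, quadCC_add (hX.modeHS_kernCC b) (hY.modeHS_kernCC b),
    quadAA_add (hX.modeHS_kernAA b) (hY.modeHS_kernAA b), dGamma, dGamma]
  module

theorem dGamma_smul (a : ℂ) {X : h →L[ℂ] h} (hX : S.MemG₂ X) :
    b.dGamma (a • X) = a • b.dGamma X := by
  have h1 : b.kernCA (a • X) = a • b.kernCA X := by
    ext1 u; simp [kernCA_apply]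
  have h2 : b.kernCC (a • X) = a • b.kernCC X := by
    ext1 u; simp [kernCC_apply]
  have h3 : b.kernAA (a • X) = conj a • b.kernAA X := by
    ext1 u
    rw [kernAA_apply, smul_apply, map_smulₛₗ, map_smul, map_smul]; rfl
  rw [dGamma, h1, h2, h3, quadCA_smul, quadCC_smul _ (hX.modeHS_kernCC b),
    quadAA_smul _ (hX.modeHS_kernAA b), dGamma]
  module

theorem parity_dGamma {X : h →L[ℂ] h} (hX : S.MemG₂ X) (φ : finPart ι₀ ι₁) :
    parity ι₀ ι₁ (b.dGamma X φ) = b.dGamma (S.conjγ 1 X) (parity ι₀ ι₁ φ) := by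
  rw [dGamma_apply, dGamma_apply, map_sub, map_add, map_smul, map_smul, parity_quadCA,
    parity_quadCC (hX.modeHS_kernCC b), parity_quadAA (hX.modeHS_kernAA b), kernCA_conjγ,
    kernCC_conjγ, kernAA_conjγ]

theorem parity_BDag (f : h) (φ : finPart ι₀ ι₁) :
    parity ι₀ ι₁ (b.BDag f φ) = b.BDag (S.γ f) (parity ι₀ ι₁ φ) := by
  rw [BDag_eq, BDag_eq, LinearMap.sub_apply, LinearMap.sub_apply, map_sub, parity_cre, parity_ann,
    J_γ, ← proj_γ, ← proj_γ]

theorem homPart_dGamma (α : Fin 2) {X : h →L[ℂ] h} (hX : S.MemG₂ X) :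
    homPart fockEven α (b.dGamma X) = b.dGamma (homPart S.P₀ α X) := by
  have h1 : parity ι₀ ι₁ * b.dGamma X * parity ι₀ ι₁ = b.dGamma (S.conjγ 1 X) :=
    LinearMap.ext fun φ => by
      rw [Module.End.mul_apply, Module.End.mul_apply, b.parity_dGamma hX, parity_parity]
  rw [homPart_fockEven, h1, homPart_P₀,
    b.dGamma_smul _ (hX.add (hX.conjγ_one.smul _)), b.dGamma_add hX (hX.conjγ_one.smul _),
    b.dGamma_smul _ hX.conjγ_one]

theorem homPart_BDag {α : Fin 2} {f : h} (hf : S.Hom α f) (β : Fin 2) :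
    homPart fockEven β (b.BDag f) = if β = α then b.BDag f else 0 := by
  have h1 : parity ι₀ ι₁ * b.BDag f * parity ι₀ ι₁ = ((-1) ^ α.val : ℂ) • b.BDag f :=
    LinearMap.ext fun φ => by
      rw [Module.End.mul_apply, Module.End.mul_apply, b.parity_BDag, parity_parity, hf, BDag_smul]
  rw [homPart_fockEven, h1]
  fin_cases α <;> fin_cases β <;> (simp; module)

theorem dGamma_mul_BDag {ξ : Fin 2} {X : h →L[ℂ] h} (hX : S.MemG₂ X) (hξ : S.OpHom ξ X)
    {α : Fin 2} {f : h} (hf : S.Hom α f) :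
    b.dGamma X * b.BDag f
      = b.BDag (X f) + ((-1) ^ (ξ.val * α.val) : ℂ) • (b.BDag f * b.dGamma X) := by
  refine LinearMap.ext fun φ => ?_
  rw [Module.End.mul_apply, b.dGamma_BDag hX hf, hξ.conjγ, b.dGamma_smul _ hX,
    LinearMap.smul_apply, map_smul]
  rfl

theorem superComm_dGamma_BDag {X : h →L[ℂ] h} (hX : S.MemG₂ X) (f : h) :
    superComm fockEven (b.dGamma X) (b.BDag f) = b.BDag (X f) := by
  have key : ∀ {α : Fin 2} {f : h}, S.Hom α f →
      superComm fockEven (b.dGamma X) (b.BDag f) = b.BDag (X f) := by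
    intro α f hf
    have h1 : ∀ ξ : Fin 2, (∑ β : Fin 2, (homPart fockEven ξ (b.dGamma X)
        * homPart fockEven β (b.BDag f) - (-1) ^ (ξ.val * β.val)
          * (homPart fockEven β (b.BDag f) * homPart fockEven ξ (b.dGamma X))))
        = b.BDag (homPart S.P₀ ξ X f) := fun ξ => by
      rw [Finset.sum_eq_single α]
      · rw [b.homPart_dGamma ξ hX, b.homPart_BDag hf, if_pos rfl,
          b.dGamma_mul_BDag (hX.homPart ξ) (S.opHom_homPart ξ X) hf]
        have h2 : ((-1) ^ (ξ.val * α.val) : Module.End ℂ (finPart ι₀ ι₁))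
            = ((-1) ^ (ξ.val * α.val) : ℂ) • 1 := by
          fin_cases ξ <;> fin_cases α <;> simp
          module
        rw [h2, smul_mul_assoc, one_mul, add_sub_cancel_right]
      · intro β _ hβ
        rw [b.homPart_BDag hf, if_neg hβ]; simp
      · simp
    rw [superComm, Finset.sum_congr rfl fun ξ _ => h1 ξ, Fin.sum_univ_two, ← BDag_add,
      ← add_apply, homPart_add_homPart]
  obtain ⟨f₀, f₁, h0, h1, rfl⟩ := S.exists_hom_decomposition f
  rw [BDag_add, superComm_add_right, key h0, key h1, map_add, BDag_add]

/-! ### The vacuum expectation of a product of currents -/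

theorem dGamma_vacuum {X : h →L[ℂ] h} (hX : S.MemG₂ X) :
    b.dGamma X vacuum = (1 / 2 : ℂ) • quadCC (b.kernCC X) vacuum := by
  rw [dGamma_apply, quadCA_vacuum, quadAA_vacuum (hX.modeHS_kernAA b), zero_add, smul_zero,
    sub_zero]

theorem vacCoeff_dGamma_vacuum {X : h →L[ℂ] h} (hX : S.MemG₂ X) :
    vacCoeff (b.dGamma X vacuum) = 0 := by
  have h1 := hasSum_finPart_apply ((goodSeries_quadCC (hX.modeHS_kernCC b)).hasSum vacuum) (0, ∅)
  have h2 : vacCoeff (quadCC (b.kernCC X) vacuum) = 0 :=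
    h1.unique (hasSum_zero.congr_fun fun i => vacCoeff_cre _ _)
  rw [b.dGamma_vacuum hX, vacCoeff_smul, h2, mul_zero]

theorem vacCoeff_ann_cre_mode (u : OnePart ι₀ ι₁) (i : ι₀ ⊕ ι₁) :
    vacCoeff (ann u (cre (mode i) vacuum)) = ⟪u, mode i⟫_ℂ := by
  rw [ann_cre (isHom_mode i), ann_vacuum, map_zero, add_zero, vacCoeff_smul, vacCoeff_vacuum,
    mul_one]

/-- Moving dΓ̂(X) past a†(f) leaves B̂†(Xf) and a term beginning with a†(f). No vector in the range
of a creator has a vacuum component, so only the annihilation part of B̂†(Xf) counts. -/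
theorem vacCoeff_dGamma_cre_cre {X : h →L[ℂ] h} (hX : S.MemG₂ X) (f : OnePart ι₀ ι₁)
    (i : ι₀ ⊕ ι₁) :
    vacCoeff (b.dGamma X (cre f (cre (mode i) vacuum))) = - ⟪b.kernAA X f, mode i⟫_ℂ := by
  have key : ∀ {α : Fin 2} {f : OnePart ι₀ ι₁}, IsHom α f →
      vacCoeff (b.dGamma X (cre f (cre (mode i) vacuum))) = - ⟪b.kernAA X f, mode i⟫_ℂ := by
    intro α f hf
    rw [b.dGamma_cre hX hf, vacCoeff_add, vacCoeff_cre, BDag_eq, LinearMap.sub_apply, vacCoeff_sub,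
      vacCoeff_cre, vacCoeff_ann_cre_mode, ← kernAA_apply]
    ring
  have h1 : f = (1 / 2 : ℂ) • (f + twist 1 f) + (1 / 2 : ℂ) • (f - twist 1 f) := by module
  have h2 := key (isHom_add_twist f)
  have h3 := key (isHom_sub_twist f)
  rw [h1]
  generalize f + twist 1 f = f₀ at h2 ⊢
  generalize f - twist 1 f = f₁ at h3 ⊢
  rw [cre_add, cre_smul, cre_smul, LinearMap.add_apply, LinearMap.smul_apply, LinearMap.smul_apply,
    map_add, map_smul, map_smul, vacCoeff_add, vacCoeff_smul, vacCoeff_smul, h2, h3, map_add,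
    map_smulₛₗ, map_smulₛₗ, inner_add_left, inner_smul_left, inner_smul_left, Complex.conj_conj]
  ring

/-- The diagonal part of γ(1-P)XPY is the product of the Hilbert–Schmidt operators γ(1-P)XP and
PY(1-P), so one basis suffices for the trace. In the doubled basis the vectors of Ph contribute
nothing, and the term at J of the i-th basis vector is minus the vacuum component of dΓ̂(X) on the
i-th summand of the a†a† series of Y at Ω. The ½ in dΓ̂(Y)Ω accounts for the factor -2. -/
theorem hasStr_mul {X Y : h →L[ℂ] h} (hX : S.MemG₂ X) (hY : S.MemG₂ Y) :
    S.HasStr ((1 - S.P) * X * S.P * Y) (-2 * vacCoeff (b.dGamma X (b.dGamma Y vacuum))) := by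
  have hP : S.P * S.P = S.P := S.P_proj.isIdempotentElem
  have h0 : S.P * (S.γ * ((1 - S.P) * X * S.P * Y)) * S.P
      + (1 - S.P) * (S.γ * ((1 - S.P) * X * S.P * Y)) * (1 - S.P)
      = (S.γ * ((1 - S.P) * X * S.P)) * (S.P * Y * (1 - S.P)) := by
    have h1 : S.P * S.γ * (1 - S.P) = 0 := by
      rw [← γ_mul_P, mul_sub, mul_one, mul_assoc, hP, sub_self]
    have h2 : (1 - S.P) * S.γ * (1 - S.P) = S.γ * (1 - S.P) := by
      rw [sub_mul, one_mul, sub_mul, h1, sub_zero]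
    calc _ = (S.P * S.γ * (1 - S.P)) * (X * S.P * Y * S.P)
          + ((1 - S.P) * S.γ * (1 - S.P)) * (X * S.P * Y * (1 - S.P)) := by noncomm_ring
      _ = S.γ * (1 - S.P) * X * (S.P * S.P) * Y * (1 - S.P) := by
        rw [h1, h2, hP]; noncomm_ring
      _ = _ := by noncomm_ring
  rw [HasStr, h0]
  refine hasTrace_mul (hX.2.2.mul_left _) hY.2.1 (doubleBasis b.basis) ?_
  have h3 := hasSum_finPart_apply
    ((goodSeries_quadCC (hY.modeHS_kernCC b)).hasSum_map (b.secBdd_dGamma hX) vacuum) (0, ∅)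
  have h4 : vacCoeff (b.dGamma X (b.dGamma Y vacuum))
      = (1 / 2 : ℂ) * vacCoeff (b.dGamma X (quadCC (b.kernCC Y) vacuum)) := by
    rw [b.dGamma_vacuum hY, map_smul, vacCoeff_smul]
  have h5 := h3.neg
  have h6 : -2 * vacCoeff (b.dGamma X (b.dGamma Y vacuum))
      = -(b.dGamma X (quadCC (b.kernCC Y) vacuum)).1 (0, ∅) := by
    rw [h4, vacCoeff]; ring
  rw [h6, ← Sum.inr_injective.hasSum_iff]
  · refine h5.congr_fun fun i => ?_
    have h7 := b.vacCoeff_dGamma_cre_cre hX (b.kernCC Y (mode i)) i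
    rw [vacCoeff] at h7
    rw [Module.End.mul_apply, h7, neg_neg, inner_kernAA_left, kernCC_apply, emb_proj, emb_mode]
    change ⟪doubleBasis b.basis (Sum.inr i), S.γ ((1 - S.P) (X (S.P (S.P (Y
      (doubleBasis b.basis (Sum.inr i) - S.P (doubleBasis b.basis (Sum.inr i))))))))⟫_ℂ = _
    rw [doubleBasis_inr, P_J_of_P (P_coe_half _), sub_zero, P_P, ← inner_γ_left]
    change ⟪_, X _ - S.P (X _)⟫_ℂ = _
    rw [inner_sub_right, ← inner_P_left, P_γ, P_J_of_P (P_coe_half _), map_zero, inner_zero_left,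
      sub_zero]
  · rintro (n | n) hn
    · change ⟪doubleBasis b.basis (Sum.inl n), S.γ ((1 - S.P) (X (S.P (S.P (Y
        (doubleBasis b.basis (Sum.inl n) - S.P (doubleBasis b.basis (Sum.inl n))))))))⟫_ℂ = _
      rw [doubleBasis_inl, P_coe_half, sub_self]; simp
    · exact absurd ⟨n, rfl⟩ hn

/-! ### The commutator of two currents -/

/-- A sector-bounded operator that supercommutes with all `B̂†(f)` is zero if its vacuum
expectation vanishes. -/
theorem eq_zero_of_mul_BDag {T : Module.End ℂ (finPart ι₀ ι₁)} (hT : SecBdd T)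
    (h0 : vacCoeff (T vacuum) = 0)
    (h1 : ∀ (α : Fin 2) (f : h), S.Hom α f → ∃ s : ℂ, s ≠ 0 ∧
      ∀ φ, T (b.BDag f φ) = s • b.BDag f (T φ)) : T = 0 := by
  refine hT.eq_zero ?_ fun i φ hφ => ?_
  -- Since T commutes with annihilators up to nonzero factors, TΩ is annihilated by all modes; hence
  -- it is a multiple of Ω, and the multiple is zero by assumption.
  · rw [eq_smul_vacuum (φ := T vacuum), h0, zero_smul]
    intro i
    obtain ⟨s, hs, h2⟩ := h1 (modeDeg i) (S.J (S.γ (b.emb (mode i)))) (by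
      refine Hom.J S ?_
      have := b.hom_emb (isHom_mode i)
      rw [Hom] at this ⊢
      rw [this, map_smul, this])
    have h3 := h2 vacuum
    rw [BDag_J_emb, LinearMap.neg_apply, ann_vacuum, neg_zero, map_zero, LinearMap.neg_apply] at h3
    have h4 := (smul_eq_zero.1 h3.symm).resolve_left hs
    exact neg_eq_zero.1 h4
  · obtain ⟨s, -, h2⟩ := h1 (modeDeg i) (b.emb (mode i)) (b.hom_emb (isHom_mode i))
    have h3 := h2 φ
    rwa [BDag_emb, hφ, map_zero, smul_zero] at h3

theorem parity_vacuum : parity ι₀ ι₁ vacuum = vacuum := by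
  refine (eq_smul_vacuum fun i => ?_).trans (by rw [vacCoeff_parity, vacCoeff_vacuum, one_smul])
  have h1 := parity_ann (twist 1 (mode i)) (vacuum : finPart ι₀ ι₁)
  rwa [ann_vacuum, map_zero, twist_twist, eq_comm] at h1

/-- The product is odd and the vacuum is even. Thus the scalar in the commutator occurs only in even
total degree. -/
theorem vacCoeff_dGamma_dGamma_of_ne {ξ η : Fin 2} {X Y : h →L[ℂ] h} (hX : S.MemG₂ X)
    (hY : S.MemG₂ Y) (hξ : S.OpHom ξ X) (hη : S.OpHom η Y) (hne : ξ ≠ η) :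
    vacCoeff (b.dGamma X (b.dGamma Y vacuum)) = 0 := by
  have h1 := vacCoeff_parity (b.dGamma X (b.dGamma Y vacuum))
  rw [b.parity_dGamma hX, b.parity_dGamma hY, parity_vacuum, hξ, hη, b.dGamma_smul _ hX,
    b.dGamma_smul _ hY, LinearMap.smul_apply, LinearMap.smul_apply, map_smul, vacCoeff_smul,
    vacCoeff_smul, ← mul_assoc] at h1
  have h2 : ((-1) ^ ξ.val * (-1) ^ η.val : ℂ) = -1 := by
    fin_cases ξ <;> fin_cases η <;> simp at hne ⊢
  rw [h2] at h1
  linear_combination (-1 / 2 : ℂ) * h1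

/-- By the graded Jacobi identity the commutator of the currents and dΓ̂ of the bracket have the
same supercommutator with every field. Their difference is therefore a scalar by irreducibility; as
dΓ̂ of the bracket has zero vacuum expectation, the scalar is the vacuum expectation of the
commutator. -/
theorem dGamma_brk {ξ η : Fin 2} {X Y : h →L[ℂ] h} (hX : S.MemG₂ X) (hY : S.MemG₂ Y)
    (hξ : S.OpHom ξ X) (hη : S.OpHom η Y) :
    b.dGamma X * b.dGamma Y - ((-1) ^ (ξ.val * η.val) : ℂ) • (b.dGamma Y * b.dGamma X)
      = b.dGamma (brk ξ η X Y)
        + (vacCoeff (b.dGamma X (b.dGamma Y vacuum))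
          - (-1) ^ (ξ.val * η.val) * vacCoeff (b.dGamma Y (b.dGamma X vacuum))) • 1 := by
  have hZ := hX.brk hY hξ hη
  have hζ := hξ.brk hη
  set k := vacCoeff (b.dGamma X (b.dGamma Y vacuum))
          - (-1) ^ (ξ.val * η.val) * vacCoeff (b.dGamma Y (b.dGamma X vacuum)) with hk
  rw [← sub_eq_zero]
  have sX := b.secBdd_dGamma hX
  have sY := b.secBdd_dGamma hY
  refine b.eq_zero_of_mul_BDag
    (((sX.mul sY).sub ((sY.mul sX).smul _)).sub
      ((b.secBdd_dGamma hZ).add (SecBdd.one.smul _))) ?_ ?_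
  · simp only [LinearMap.sub_apply, LinearMap.add_apply, LinearMap.smul_apply, Module.End.mul_apply,
      Module.End.one_apply, vacCoeff_sub, vacCoeff_add, vacCoeff_smul, vacCoeff_vacuum,
      b.vacCoeff_dGamma_vacuum hZ]
    rw [hk]; ring
  · intro α f hf
    -- The sign of passing an operator of degree ξ + η across a field of degree α.
    refine ⟨(-1) ^ (ξ.val * α.val) * (-1) ^ (η.val * α.val), by simp, fun φ => ?_⟩
    have mulB : ∀ {ζ : Fin 2} {Z : h →L[ℂ] h}, S.MemG₂ Z → S.OpHom ζ Z → ∀ {β : Fin 2} {g : h},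
        S.Hom β g → ∀ ψ, b.dGamma Z (b.BDag g ψ)
          = b.BDag (Z g) ψ + ((-1) ^ (ζ.val * β.val) : ℂ) • b.BDag g (b.dGamma Z ψ) :=
      fun hZ hζ _ _ hg ψ => DFunLike.congr_fun (b.dGamma_mul_BDag hZ hζ hg) ψ
    have hs : ∀ β γ δ : Fin 2, ((-1) ^ (β.val * (γ + δ).val) : ℂ)
        = (-1) ^ (β.val * γ.val) * (-1) ^ (β.val * δ.val) := fun β γ δ => by
      fin_cases β <;> simp [neg_one_pow_add_val]
    have hc : ∀ β γ : Fin 2, ((-1) ^ (β.val * γ.val) : ℂ) = (-1) ^ (γ.val * β.val) :=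
      fun β γ => by rw [mul_comm]
    have ha : ((-1) ^ (ξ.val * η.val) : ℂ) * (-1) ^ (ξ.val * η.val) = 1 := by
      rw [← mul_pow]; simp
    have e1 : b.dGamma X (b.dGamma Y (b.BDag f φ))
        = b.BDag (X (Y f)) φ
          + ((-1) ^ (ξ.val * η.val) * (-1) ^ (ξ.val * α.val) : ℂ) • b.BDag (Y f) (b.dGamma X φ)
          + ((-1) ^ (η.val * α.val) : ℂ) • (b.BDag (X f) (b.dGamma Y φ)
            + ((-1) ^ (ξ.val * α.val) : ℂ) • b.BDag f (b.dGamma X (b.dGamma Y φ))) := by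
      rw [mulB hY hη hf, map_add, map_smul, mulB hX hξ (hη.hom_apply hf), mulB hX hξ hf, hs]
    have e2 : b.dGamma Y (b.dGamma X (b.BDag f φ))
        = b.BDag (Y (X f)) φ
          + ((-1) ^ (ξ.val * η.val) * (-1) ^ (η.val * α.val) : ℂ) • b.BDag (X f) (b.dGamma Y φ)
          + ((-1) ^ (ξ.val * α.val) : ℂ) • (b.BDag (Y f) (b.dGamma X φ)
            + ((-1) ^ (η.val * α.val) : ℂ) • b.BDag f (b.dGamma Y (b.dGamma X φ))) := by
      rw [mulB hX hξ hf, map_add, map_smul, mulB hY hη (hξ.hom_apply hf), mulB hY hη hf, hs, hc η ξ]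
    have e3 : b.dGamma (brk ξ η X Y) (b.BDag f φ) = b.BDag (brk ξ η X Y f) φ
        + ((-1) ^ (ξ.val * α.val) * (-1) ^ (η.val * α.val) : ℂ)
          • b.BDag f (b.dGamma (brk ξ η X Y) φ) := by
      rw [mulB hZ hζ hf, hc, hs, hc α, hc α]
    have e4 : b.BDag (brk ξ η X Y f)
        = b.BDag (X (Y f)) - ((-1) ^ (ξ.val * η.val) : ℂ) • b.BDag (Y (X f)) := by
      have : brk ξ η X Y f = X (Y f) + (-(-1) ^ (ξ.val * η.val) : ℂ) • Y (X f) := by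
        rw [neg_smul, ← sub_eq_add_neg]; rfl
      rw [this, BDag_add, BDag_smul]; module
    simp only [LinearMap.sub_apply, LinearMap.add_apply, LinearMap.smul_apply, Module.End.mul_apply,
      Module.End.one_apply, map_sub, map_add, map_smul]
    rw [e1, e2, e3, e4, LinearMap.sub_apply, LinearMap.smul_apply]
    -- A scalar commutes with the field without a sign, so it fits only if that sign is 1 or k
    -- vanishes: the sign is 1 for ξ = η, and k = 0 for ξ ≠ η.
    have h6 : (k * (1 - (-1) ^ (ξ.val * α.val) * (-1) ^ (η.val * α.val))) • b.BDag f φ = 0 := by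
      by_cases hne : ξ = η
      · rw [hne, ← mul_pow]; simp
      · rw [hk, b.vacCoeff_dGamma_dGamma_of_ne hX hY hξ hη hne,
          b.vacCoeff_dGamma_dGamma_of_ne hY hX hη hξ (Ne.symm hne), mul_zero, sub_zero, zero_mul,
          zero_smul]
    clear_value k
    generalize ((-1) ^ (ξ.val * η.val) : ℂ) = a at *
    generalize ((-1) ^ (ξ.val * α.val) : ℂ) = p at *
    generalize ((-1) ^ (η.val * α.val) : ℂ) = r at *
    -- The mixed terms with one field and one current cancel between the two orders because the
    -- exchange sign a squares to 1.
    have h5 : (1 - a * a) • r • b.BDag (X f) (b.dGamma Y φ) = 0 := by rw [ha, sub_self, zero_smul]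
    linear_combination (norm := module) h5 - h6

theorem dGamma_superComm {X Y : h →L[ℂ] h} (hX : S.MemG₂ X) (hY : S.MemG₂ Y) :
    b.dGamma (superComm S.P₀ X Y) = ∑ α : Fin 2, ∑ β : Fin 2,
      b.dGamma (brk α β (homPart S.P₀ α X) (homPart S.P₀ β Y)) := by
  have key := fun α β : Fin 2 => (hX.homPart α).brk (hY.homPart β)
    (S.opHom_homPart α X) (S.opHom_homPart β Y)
  rw [superComm_eq]
  simp only [Fin.sum_univ_two]
  rw [b.dGamma_add ((key 0 0).add (key 0 1)) ((key 1 0).add (key 1 1)),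
    b.dGamma_add (key 0 0) (key 0 1), b.dGamma_add (key 1 0) (key 1 1)]

theorem exists_superComm_dGamma {X Y : h →L[ℂ] h} (hX : S.MemG₂ X) (hY : S.MemG₂ Y) :
    ∃ c : ℂ, S.HasStr (S.schwingerOp X Y) c ∧
      superComm fockEven (b.dGamma X) (b.dGamma Y)
        = b.dGamma (superComm S.P₀ X Y) - (c / 2) • 1 := by
  let v : (h →L[ℂ] h) → (h →L[ℂ] h) → ℂ := fun X Y => vacCoeff (b.dGamma X (b.dGamma Y vacuum))
  let w : Fin 2 → Fin 2 → ℂ := fun α β => v (homPart S.P₀ α X) (homPart S.P₀ β Y)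
    - (-1) ^ (α.val * β.val) * v (homPart S.P₀ β Y) (homPart S.P₀ α X)
  have hadd : ∀ {A B : h →L[ℂ] h} {s t : ℂ}, S.HasStr A s → S.HasStr B t →
      S.HasStr (A + B) (s + t) := fun hA hB => by
    rw [HasStr] at *
    convert hA.add hB using 1
    noncomm_ring
  have hsmul : ∀ {A : h →L[ℂ] h} {s : ℂ} (a : ℂ), S.HasStr A s → S.HasStr (a • A) (a * s) :=
    fun a hA => by
    rw [HasStr] at *
    convert hA.smul a using 1
    simp only [mul_smul_comm, smul_mul_assoc, smul_add]
  have h1 : ∀ α β : Fin 2, S.HasStr ((1 - S.P) * homPart S.P₀ α X * S.P * homPart S.P₀ β Y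
      - (-1) ^ (α.val * β.val)
        * ((1 - S.P) * homPart S.P₀ β Y * S.P * homPart S.P₀ α X)) (-2 * w α β) := fun α β => by
    have e1 := hadd (b.hasStr_mul (hX.homPart α) (hY.homPart β))
      (hsmul (-(-1) ^ (α.val * β.val)) (b.hasStr_mul (hY.homPart β) (hX.homPart α)))
    convert e1 using 1
    · rw [neg_smul, sub_eq_add_neg]
      congr 2
      fin_cases α <;> fin_cases β <;> simp
    · ring
  have h2 : ∀ α β : Fin 2, homPart fockEven α (b.dGamma X) * homPart fockEven β (b.dGamma Y)
      - (-1) ^ (α.val * β.val)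
        * (homPart fockEven β (b.dGamma Y) * homPart fockEven α (b.dGamma X))
      = b.dGamma (brk α β (homPart S.P₀ α X) (homPart S.P₀ β Y)) + w α β • 1 := fun α β => by
    rw [b.homPart_dGamma α hX, b.homPart_dGamma β hY, ← b.dGamma_brk (hX.homPart α) (hY.homPart β)
      (S.opHom_homPart α X) (S.opHom_homPart β Y)]
    congr 1
    have h2 : ((-1) ^ (α.val * β.val) : Module.End ℂ (finPart ι₀ ι₁))
        = ((-1) ^ (α.val * β.val) : ℂ) • 1 := by
      fin_cases α <;> fin_cases β <;> simp
      module
    rw [h2, smul_mul_assoc, one_mul]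
  refine ⟨-2 * w 0 0 + -2 * w 0 1 + (-2 * w 1 0 + -2 * w 1 1), ?_, ?_⟩
  · simp only [schwingerOp, Fin.sum_univ_two]
    exact hadd (hadd (h1 0 0) (h1 0 1)) (hadd (h1 1 0) (h1 1 1))
  · rw [b.dGamma_superComm hX hY, superComm]
    simp only [Fin.sum_univ_two]
    rw [h2, h2, h2, h2]
    module

end ModeBasis

end NeutralSystem

end

/-! ### The series of the definition in coordinates, and closability. -/

noncomputable section

section Fock

variable {ι₀ ι₁ : Type*}

theorem hasSum_inner_left {κ : Type*} {x : κ → finPart ι₀ ι₁} {y : finPart ι₀ ι₁}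
    (hx : HasSum x y) (φ : finPart ι₀ ι₁) : HasSum (fun n => ⟪x n, φ⟫_ℂ) ⟪y, φ⟫_ℂ :=
  hx.mapL (innerSLFlip ℂ φ)

theorem hasSum_inner_right {κ : Type*} {x : κ → finPart ι₀ ι₁} {y : finPart ι₀ ι₁}
    (hx : HasSum x y) (φ : finPart ι₀ ι₁) : HasSum (fun n => ⟪φ, x n⟫_ℂ) ⟪φ, y⟫_ℂ :=
  hx.mapL (innerSL ℂ φ)

theorem inner_configVec_left (c : Config ι₀ ι₁) (y : Fock ι₀ ι₁) :
    ⟪(configVec c : finPart ι₀ ι₁).1, y⟫_ℂ = y c := by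
  classical
  have h1 : (configVec c : finPart ι₀ ι₁).1
      = lp.single (E := fun _ : Config ι₀ ι₁ => ℂ) 2 c 1 := by
    apply lp.ext; funext d
    rw [configVec_apply, lp.single_apply, Pi.single_apply]
  rw [h1, lp.inner_single_left]; simp

end Fock

namespace NeutralSystem

variable {h : Type*} [NormedAddCommGroup h] [InnerProductSpace ℂ h] [CompleteSpace h]
variable {S : NeutralSystem h}

instance : CompleteSpace S.half := by
  have h1 : (S.half : Set h) = {f | S.P f = f} :=
    Set.ext fun f => ⟨fun hf => P_coe_half ⟨f, hf⟩, fun hf => ⟨f, hf⟩⟩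
  have h2 : IsClosed (S.half : Set h) := h1 ▸ isClosed_eq S.P.continuous continuous_id
  exact h2.completeSpace_coe

/-! ### Coordinates for the series defining the currents -/

namespace HalfConj

variable (C : S.HalfConj)

theorem toMap_γ (f : S.half) : C.toMap (S.toHalf (S.γ f)) = S.toHalf (S.γ (C.toMap f)) := by
  have h1 : S.toHalf (S.γ f) = S.toHalf (S.P₀ f) - (f - S.toHalf (S.P₀ f)) := by
    rw [γ_apply, map_sub, map_sub, toHalf_coe]
  apply Subtype.ext
  rw [h1, map_sub, map_sub, coe_toHalf, P_γ, P_coe_half, γ_apply]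
  change (C.toMap (S.toHalf (S.P₀ f)) : h) - ((C.toMap f : h) - C.toMap (S.toHalf (S.P₀ f))) = _
  rw [C.even]

/-- The image of a Hilbert basis under the conjugation. -/
def mapBasis {κ : Type*} (e : HilbertBasis κ ℂ S.half) : HilbertBasis κ ℂ S.half :=
  HilbertBasis.mkOfOrthogonalEqBot (v := fun n => C.toMap (e n))
    (by
      classical
      rw [orthonormal_iff_ite]
      intro m n
      rw [inner_map_map_of_antilinear, orthonormal_iff_ite.1 e.orthonormal]
      simp only [eq_comm])
    (by
      rw [eq_bot_iff]
      intro x hx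
      rw [Submodule.mem_orthogonal] at hx
      have h1 : C.toMap x = 0 := by
        apply e.repr.injective
        apply lp.ext; funext n
        have h2 : ⟪C.toMap (e n), x⟫_ℂ = 0 := hx _ (Submodule.subset_span ⟨n, rfl⟩)
        rw [e.repr_apply_apply, map_zero, ← inner_map_map_of_antilinear C.toMap, C.involutive,
          ← inner_conj_symm, h2, map_zero]
        rfl
      rw [Submodule.mem_bot, ← C.involutive x, h1, map_zero])

@[simp]
theorem mapBasis_apply {κ : Type*} (e : HilbertBasis κ ℂ S.half) (n : κ) :
    C.mapBasis e n = C.toMap (e n) := by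
  rw [mapBasis, HilbertBasis.coe_mkOfOrthogonalEqBot]

end HalfConj

variable {ι₀ ι₁ : Type*} (b : S.ModeBasis ι₀ ι₁)

namespace ModeBasis

/-- A Hilbert basis of the half space in coordinates. -/
def coordBasis {κ : Type*} (e : HilbertBasis κ ℂ S.half) : HilbertBasis κ ℂ (OnePart ι₀ ι₁) :=
  HilbertBasis.ofRepr (b.basis.repr.symm.trans e.repr)

theorem coordBasis_apply {κ : Type*} (e : HilbertBasis κ ℂ S.half) (n : κ) :
    b.coordBasis e n = b.basis.repr (e n) := by
  classical
  rw [← HilbertBasis.repr_symm_single, ← HilbertBasis.repr_symm_single]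
  rfl

theorem emb_coordBasis {κ : Type*} (e : HilbertBasis κ ℂ S.half) (n : κ) :
    b.emb (b.coordBasis e n) = (e n : h) := by
  rw [coordBasis_apply, emb_apply, LinearIsometryEquiv.symm_apply_apply]

theorem kernCA_coordBasis {κ : Type*} (e : HilbertBasis κ ℂ S.half) (X : h →L[ℂ] h) (n : κ) :
    b.kernCA X (b.coordBasis e n) = b.basis.repr (S.compPP X (e n)) := by
  rw [kernCA_apply, emb_coordBasis]; rfl

/-- The conjugation merely replaces the basis (eₙ) by (J̃eₙ), with the kernel unchanged.
Independence of J̃ thus reduces to independence of the basis. -/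
theorem kernCC_coordBasis {κ : Type*} (C : S.HalfConj) (e : HilbertBasis κ ℂ S.half)
    (X : h →L[ℂ] h) (n : κ) :
    b.kernCC X (b.coordBasis (C.mapBasis e) n) = b.basis.repr (compDagDag C X (e n)) := by
  rw [kernCC_apply, emb_coordBasis, C.mapBasis_apply]; rfl

/-- The J̃ of the series cancels the J̃ in the kernel, as J̃ is an involution commuting with γ. -/
theorem kernAA_coordBasis {κ : Type*} (C : S.HalfConj) (e : HilbertBasis κ ℂ S.half)
    (X : h →L[ℂ] h) (n : κ) :
    b.kernAA X (b.coordBasis e n) = b.basis.repr (C.toMap (compAA C X (e n))) := by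
  have h1 : compAA C X (e n) = S.toHalf (S.γ (C.toMap (S.toHalf (S.J (X (e n)))))) := rfl
  rw [kernAA_apply, emb_coordBasis, proj_apply, h1, C.toMap_γ, C.involutive]
  congr 1
  apply Subtype.ext
  rw [coe_toHalf, coe_toHalf, coe_toHalf, P_γ, P_γ, P_P]

theorem summable_kernCC_coordBasis {κ : Type*} {X : h →L[ℂ] h}
    (hX : IsHilbertSchmidt (S.P * X * (1 - S.P))) (e : HilbertBasis κ ℂ S.half) : Summable fun n => ‖b.kernCC X (b.coordBasis e n)‖ ^ 2 := by
  refine ((isHilbertSchmidt_PX_iff e X).1 hX).congr fun n => ?_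
  rw [kernCC_apply, norm_proj, emb_coordBasis]

theorem summable_kernAA_coordBasis {κ : Type*} {X : h →L[ℂ] h}
    (hX : IsHilbertSchmidt ((1 - S.P) * X * S.P)) (e : HilbertBasis κ ℂ S.half) : Summable fun n => ‖b.kernAA X (b.coordBasis e n)‖ ^ 2 := by
  refine ((isHilbertSchmidt_XP_iff e X).1 hX).congr fun n => ?_
  rw [kernAA_apply, norm_proj, emb_coordBasis]

theorem seriesAt_of_hasSum {T : ℕ → Module.End ℂ (finPart ι₀ ι₁)} {φ ψ : finPart ι₀ ι₁}
    (hT : HasSum (fun n => T n φ) ψ) : SeriesAt T φ (ψ : Fock ι₀ ι₁) := by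
  have h1 := (continuous_subtype_val.tendsto ψ).comp hT.tendsto_sum_nat
  refine h1.congr fun N => ?_
  rw [Function.comp_apply, LinearMap.sum_apply]

variable [LinearOrder ι₁]

theorem quadDagA_eq (e : HilbertBasis ℕ ℂ S.half) (X : h →L[ℂ] h) :
    b.QuadDagA e (S.compPP X)
      = SeriesAt fun n => cre (b.kernCA X (b.coordBasis e n)) * ann (b.coordBasis e n) := by
  refine congrArg SeriesAt (funext fun n => ?_)
  rw [kernCA_coordBasis, coordBasis_apply]; rfl

theorem quadDagDag_eq (C : S.HalfConj) (e : HilbertBasis ℕ ℂ S.half) (X : h →L[ℂ] h) :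
    b.QuadDagDag C e (compDagDag C X)
      = SeriesAt fun n => cre (b.kernCC X (b.coordBasis (C.mapBasis e) n))
          * cre (b.coordBasis (C.mapBasis e) n) := by
  refine congrArg SeriesAt (funext fun n => ?_)
  rw [kernCC_coordBasis, coordBasis_apply, C.mapBasis_apply]; rfl

theorem quadAA_eq (C : S.HalfConj) (e : HilbertBasis ℕ ℂ S.half) (X : h →L[ℂ] h) :
    b.QuadAA C e (compAA C X)
      = SeriesAt fun n => ann (b.kernAA X (b.coordBasis e n)) * ann (b.coordBasis e n) := by
  refine congrArg SeriesAt (funext fun n => ?_)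
  rw [kernAA_coordBasis b C, coordBasis_apply]; rfl

theorem current_dGamma {X : h →L[ℂ] h} (hX : S.MemG₂ X) (C : S.HalfConj)
    (e : HilbertBasis ℕ ℂ S.half) (φ : finPart ι₀ ι₁) : b.Current C e X φ (b.dGamma X φ) := by
  refine ⟨_, _, _, ?_, ?_, ?_, rfl⟩
  · rw [quadDagA_eq]
    exact seriesAt_of_hasSum (hasSum_quadCA _ _ φ)
  · rw [quadDagDag_eq]
    exact seriesAt_of_hasSum (hasSum_quadCC _ (hX.modeHS_kernCC b)
      (b.summable_kernCC_coordBasis hX.2.1 _) φ)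
  · rw [quadAA_eq]
    exact seriesAt_of_hasSum (hasSum_quadAA _ (hX.modeHS_kernAA b)
      (b.summable_kernAA_coordBasis hX.2.2 _) φ)

/-! ### Closability -/

/-- The term-by-term adjoints of the three series again satisfy the hypotheses of the convergence
lemmas, so the adjoint is defined on every finite-particle vector. -/
theorem exists_formal_adjoint {X : h →L[ℂ] h} (hX : S.MemG₂ X) (ψ : finPart ι₀ ι₁) :
    ∃ χ : finPart ι₀ ι₁, ∀ φ, ⟪ψ, b.dGamma X φ⟫_ℂ = ⟪χ, φ⟫_ℂ := by
  have hm := (orthonormal_mode (ι₀ := ι₀) (ι₁ := ι₁)).isBessel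
  have hCA := (goodSeries_cre_ann hm zero_le_one (hm.map zero_le_one (b.kernCA X))
    (by positivity)).hasSum ψ
  -- The adjoint term a(δᵢ)a(Kδᵢ) has its square summable factor inside; exchanging the
  -- annihilators, at the price of a twist, brings it to the form required.
  have hCC := (goodSeries_ann_ann hm zero_le_one
    (f := fun i => twist (modeDeg i) (b.kernCC X (mode i)))
    (Summable.congr (hX.modeHS_kernCC b) fun i => by rw [LinearIsometry.norm_map])).hasSum ψ
  have hAA := (goodSeries_cre_cre hm zero_le_one (hX.modeHS_kernAA b)).hasSum ψ
  refine ⟨opSum (fun i : ι₀ ⊕ ι₁ => cre (mode i) * ann (b.kernCA X (mode i))) ψ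
      + (1 / 2 : ℂ) • opSum (fun i : ι₀ ⊕ ι₁ =>
        ann (twist (modeDeg i) (b.kernCC X (mode i))) * ann (mode i)) ψ
      - (1 / 2 : ℂ) • opSum (fun i : ι₀ ⊕ ι₁ => cre (mode i) * cre (b.kernAA X (mode i))) ψ,
    fun φ => ?_⟩
  have e1 : ⟪ψ, quadCA (b.kernCA X) φ⟫_ℂ
      = ⟪opSum (fun i : ι₀ ⊕ ι₁ => cre (mode i) * ann (b.kernCA X (mode i))) ψ, φ⟫_ℂ := by
    refine (hasSum_inner_right ((goodSeries_quadCA _).hasSum φ) ψ).unique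
      ((hasSum_inner_left hCA φ).congr_fun fun i => ?_)
    rw [Module.End.mul_apply, Module.End.mul_apply, inner_cre_left, inner_ann_left]
  have e2 : ⟪ψ, quadCC (b.kernCC X) φ⟫_ℂ = ⟪opSum (fun i : ι₀ ⊕ ι₁ =>
      ann (twist (modeDeg i) (b.kernCC X (mode i))) * ann (mode i)) ψ, φ⟫_ℂ := by
    refine (hasSum_inner_right ((goodSeries_quadCC (hX.modeHS_kernCC b)).hasSum φ) ψ).unique
      ((hasSum_inner_left hCC φ).congr_fun fun i => ?_)
    rw [Module.End.mul_apply, Module.End.mul_apply, ann_ann (isHom_mode i), twist_twist,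
      inner_ann_left, inner_ann_left]
  have e3 : ⟪ψ, quadAA (b.kernAA X) φ⟫_ℂ
      = ⟪opSum (fun i : ι₀ ⊕ ι₁ => cre (mode i) * cre (b.kernAA X (mode i))) ψ, φ⟫_ℂ := by
    refine (hasSum_inner_right ((goodSeries_quadAA (hX.modeHS_kernAA b)).hasSum φ) ψ).unique
      ((hasSum_inner_left hAA φ).congr_fun fun i => ?_)
    rw [Module.End.mul_apply, Module.End.mul_apply, inner_cre_left, inner_cre_left]
  have e4 : ∀ x y z w : finPart ι₀ ι₁, ⟪w, x + (1 / 2 : ℂ) • y - (1 / 2 : ℂ) • z⟫_ℂ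
      = ⟪w, x⟫_ℂ + 1 / 2 * ⟪w, y⟫_ℂ - 1 / 2 * ⟪w, z⟫_ℂ := fun x y z w => by
    change ⟪w.1, x.1 + (1 / 2 : ℂ) • y.1 - (1 / 2 : ℂ) • z.1⟫_ℂ = _
    rw [inner_sub_right, inner_add_right, inner_smul_right, inner_smul_right]; rfl
  have e5 : ∀ x y z w : finPart ι₀ ι₁, ⟪x + (1 / 2 : ℂ) • y - (1 / 2 : ℂ) • z, w⟫_ℂ
      = ⟪x, w⟫_ℂ + 1 / 2 * ⟪y, w⟫_ℂ - 1 / 2 * ⟪z, w⟫_ℂ := fun x y z w => by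
    change ⟪x.1 + (1 / 2 : ℂ) • y.1 - (1 / 2 : ℂ) • z.1, w.1⟫_ℂ = _
    rw [inner_sub_left, inner_add_left, inner_smul_left, inner_smul_left]
    simp only [map_div₀, map_one, map_ofNat]; rfl
  rw [dGamma_apply, e4, e5, e1, e2, e3]

/-- `dΓ̂(X)` as an operator with domain the span of the vectors `â†(f₁) ⋯ â†(f_N) Ω`. -/
def dGammaPMap (X : h →L[ℂ] h) : Fock ι₀ ι₁ →ₗ.[ℂ] Fock ι₀ ι₁ where
  domain := b.algSpan.map (finPart ι₀ ι₁).subtype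
  toFun := (finPart ι₀ ι₁).subtype ∘ₗ b.dGamma X
    ∘ₗ Submodule.inclusion (Submodule.map_subtype_le _ _)

/-- The adjoint relation against a configuration vector is a closed condition on pairs, so it holds
on the closure of the graph; for (0, y) it says that every component of y vanishes. -/
theorem dGammaPMap_isClosable {X : h →L[ℂ] h} (hX : S.MemG₂ X) : (b.dGammaPMap X).IsClosable := by
  refine ⟨_, (Submodule.toLinearPMap_graph_eq _ ?_).symm⟩
  rintro ⟨x, y⟩ hxy rfl
  apply lp.ext; funext c
  rw [← inner_configVec_left]
  obtain ⟨χ, hχ⟩ := b.exists_formal_adjoint hX (configVec c)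
  have h1 : ∀ p ∈ (b.dGammaPMap X).graph.topologicalClosure,
      ⟪(configVec c : finPart ι₀ ι₁).1, p.2⟫_ℂ = ⟪χ.1, p.1⟫_ℂ := by
    intro p hp
    have hcl : IsClosed {p : Fock ι₀ ι₁ × Fock ι₀ ι₁ |
        ⟪(configVec c : finPart ι₀ ι₁).1, p.2⟫_ℂ = ⟪χ.1, p.1⟫_ℂ} :=
      isClosed_eq (continuous_const.inner continuous_snd) (continuous_const.inner continuous_fst)
    refine closure_minimal ?_ hcl hp
    rintro ⟨x, y⟩ hg
    obtain ⟨z, rfl, rfl⟩ := (LinearPMap.mem_graph_iff _).1 hg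
    exact hχ _
  rw [h1 _ hxy, inner_zero_right]; rfl

theorem currentClosable_of_memG₂ {X : h →L[ℂ] h} (hX : S.MemG₂ X) (C : S.HalfConj)
    (e : HilbertBasis ℕ ℂ S.half) : b.CurrentClosable C e X :=
  ⟨b.dGammaPMap X, rfl, b.dGammaPMap_isClosable hX, fun φ _ => b.current_dGamma hX C e φ⟩

theorem currentDefined_of_memG₂ {X : h →L[ℂ] h} (hX : S.MemG₂ X) (C : S.HalfConj)
    (e : HilbertBasis ℕ ℂ S.half) : b.CurrentDefined C e X :=
  fun φ => ⟨_, b.current_dGamma hX C e φ⟩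

end ModeBasis

end NeutralSystem

end

noncomputable section

section Fock

/-! ### Convergence of pair creation and annihilation forces Hilbert–Schmidt kernels -/

variable {ι₀ ι₁ : Type*}

theorem modeHS_of_sum_le {K : OnePart ι₀ ι₁ →L⋆[ℂ] OnePart ι₀ ι₁} {M : ℝ}
    (hM : ∀ s : Finset (ι₀ ⊕ ι₁), ∑ i ∈ s, ∑ j ∈ s, ‖K (mode i) j‖ ^ 2 ≤ M) : ModeHS K := by
  classical
  have h1 : Summable fun p : (ι₀ ⊕ ι₁) × (ι₀ ⊕ ι₁) => ‖K (mode p.1) p.2‖ ^ 2 := by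
    refine summable_of_sum_le (c := M) (fun _ => sq_nonneg _) fun u => ?_
    let s := u.image Prod.fst ∪ u.image Prod.snd
    have hs : u ⊆ s ×ˢ s := fun p hp => Finset.mem_product.2
      ⟨Finset.mem_union_left _ (Finset.mem_image_of_mem _ hp),
        Finset.mem_union_right _ (Finset.mem_image_of_mem _ hp)⟩
    refine (Finset.sum_le_sum_of_subset_of_nonneg hs fun _ _ _ => sq_nonneg _).trans ?_
    rw [Finset.sum_product]
    exact hM s
  refine ((summable_prod_of_nonneg fun _ => sq_nonneg _).1 h1).2.congr fun i => ?_
  rw [lp_norm_sq]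

theorem norm_vacCoeff_le (φ : finPart ι₀ ι₁) : ‖vacCoeff φ‖ ≤ ‖φ‖ :=
  lp.norm_apply_le_norm (by norm_num) φ.1 _

theorem SecBdd.zero : SecBdd (0 : Module.End ℂ (finPart ι₀ ι₁)) := by
  simpa using (SecBdd.one (ι₀ := ι₀) (ι₁ := ι₁)).smul 0

theorem SecBdd.sum {κ : Type*} {T : κ → Module.End ℂ (finPart ι₀ ι₁)} (s : Finset κ)
    (hT : ∀ n, SecBdd (T n)) : SecBdd (∑ n ∈ s, T n) := by
  classical
  induction s using Finset.induction_on with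
  | empty => simpa using SecBdd.zero
  | insert n s hn ih => rw [Finset.sum_insert hn]; exact (hT n).add ih

theorem norm_vacuum : ‖(vacuum : finPart ι₀ ι₁)‖ = 1 := by
  have h1 : ⟪(vacuum : finPart ι₀ ι₁).1, (vacuum : finPart ι₀ ι₁).1⟫_ℂ = 1 := by
    rw [← configVec_zero, inner_configVec_left, configVec_zero]
    exact vacCoeff_vacuum
  have h2 := inner_self_eq_norm_sq (𝕜 := ℂ) (vacuum : finPart ι₀ ι₁).1
  rw [h1, RCLike.one_re] at h2
  change ‖(vacuum : finPart ι₀ ι₁).1‖ = 1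
  nlinarith [norm_nonneg (vacuum : finPart ι₀ ι₁).1]

variable [LinearOrder ι₁]

theorem ann_mode_cre (i : ι₀ ⊕ ι₁) (f : OnePart ι₀ ι₁) (φ : finPart ι₀ ι₁) :
    ann (mode i) (cre f φ)
      = (f i : ℂ) • φ + cre (twist (modeDeg i) f) (ann (mode i) φ) := by
  rw [cre_ann (isHom_mode i), twist_twist, inner_mode_left]; abel

theorem vacCoeff_ann_ann_cre_cre (i j : ι₀ ⊕ ι₁) (f g : OnePart ι₀ ι₁) :
    vacCoeff (ann (mode j) (ann (mode i) (cre f (cre g vacuum))))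
      = f i * g j + modeSign (modeDeg i) j * (f j * g i) := by
  simp only [ann_mode_cre, map_add, map_smul, ann_vacuum, map_zero, add_zero,
    vacCoeff_add, vacCoeff_smul, vacCoeff_vacuum, twist_apply, mul_one]
  ring

theorem ann_ann_cre_cre_mode (u v : OnePart ι₀ ι₁) (i j : ι₀ ⊕ ι₁) :
    ann u (ann v (cre (mode i) (cre (mode j) vacuum)))
      = (⟪v, mode i⟫_ℂ * ⟪u, mode j⟫_ℂ
        + ⟪twist (modeDeg i) v, mode j⟫_ℂ * ⟪u, mode i⟫_ℂ) • vacuum := by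
  rw [ann_cre (isHom_mode i), ann_cre (isHom_mode j), ann_vacuum, map_zero, add_zero, map_smul,
    map_add, map_smul, map_smul, ann_cre (isHom_mode i), ann_cre (isHom_mode j), ann_vacuum,
    ann_vacuum, map_zero, map_zero, add_zero, add_zero]
  module

/-- The two-particle vector `∑ᵢⱼ (W δᵢ)ⱼ a†ᵢ a†ⱼ Ω`, on which pair annihilation with kernel `W`
takes the largest value. -/
def testVec (W : OnePart ι₀ ι₁ →L⋆[ℂ] OnePart ι₀ ι₁) (s : Finset (ι₀ ⊕ ι₁)) : finPart ι₀ ι₁ :=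
  ∑ i ∈ s, cre (mode i) (∑ j ∈ s, cre (mode j) ((W (mode i) j : ℂ) • vacuum))

theorem cre_vacuum_mem_sector (i : ι₀ ⊕ ι₁) (a : ℂ) :
    (cre (mode i) (a • (vacuum : finPart ι₀ ι₁))).1 ∈ sector ι₀ ι₁ 1 :=
  cre_mem_sector _ ((sector ι₀ ι₁ 0).smul_mem _ vacuum_mem_sector)

theorem testVec_mem_sector (W : OnePart ι₀ ι₁ →L⋆[ℂ] OnePart ι₀ ι₁) (s : Finset (ι₀ ⊕ ι₁)) :
    (testVec W s).1 ∈ sector ι₀ ι₁ 2 :=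
  sum_mem_sector fun _ _ => cre_mem_sector _ (sum_mem_sector fun _ _ => cre_vacuum_mem_sector _ _)

theorem norm_testVec_sq_le (W : OnePart ι₀ ι₁ →L⋆[ℂ] OnePart ι₀ ι₁) (s : Finset (ι₀ ⊕ ι₁)) :
    ‖testVec W s‖ ^ 2 ≤ 2 * ∑ i ∈ s, ∑ j ∈ s, ‖W (mode i) j‖ ^ 2 := by
  have hm := (orthonormal_mode (ι₀ := ι₀) (ι₁ := ι₁)).isBessel
  refine (norm_sum_cre_sq_le hm zero_le_one (N := 1) s fun i _ =>
    sum_mem_sector fun _ _ => cre_vacuum_mem_sector _ _).trans ?_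
  rw [Nat.cast_one, one_mul, one_add_one_eq_two]
  gcongr with i _
  refine (norm_sum_cre_sq_le hm zero_le_one (N := 0) s fun j _ =>
    (sector ι₀ ι₁ 0).smul_mem _ vacuum_mem_sector).trans (le_of_eq ?_)
  simp only [norm_smul, norm_vacuum, mul_one, one_mul, Nat.cast_zero, zero_add]

/-- The pair annihilation series at the test vector. -/
theorem hasSum_ann_ann_testVec (e : HilbertBasis ℕ ℂ (OnePart ι₀ ι₁))
    {W : OnePart ι₀ ι₁ →L⋆[ℂ] OnePart ι₀ ι₁}
    (hW : ∀ i v, ⟪W (mode i), v⟫_ℂ = ⟪W (twist (modeDeg i) v), mode i⟫_ℂ)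
    (s : Finset (ι₀ ⊕ ι₁)) :
    HasSum (fun n => ann (W (e n)) (ann (e n) (testVec W s)))
      ((((2 * ∑ i ∈ s, ∑ j ∈ s, ‖W (mode i) j‖ ^ 2 : ℝ) : ℂ)) • vacuum) := by
  have h0 : ∀ f g : OnePart ι₀ ι₁, HasSum (fun n => ⟪e n, f⟫_ℂ * ⟪W (e n), g⟫_ℂ) ⟪W f, g⟫_ℂ := by
    intro f g
    have h1 := ((e.hasSum_repr f).mapL W).mapL (innerSLFlip ℂ g)
    refine h1.congr_fun fun n => ?_
    rw [map_smulₛₗ, map_smulₛₗ, e.repr_apply_apply]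
    simp
  have h1 : ∀ i j : ι₀ ⊕ ι₁, HasSum (fun n => ann (W (e n)) (ann (e n)
      (cre (mode i) (cre (mode j) vacuum)))) ((2 * conj (W (mode i) j : ℂ)) • vacuum) := by
    intro i j
    have h2 := (h0 (mode i) (mode j)).add (h0 (twist (modeDeg i) (mode j)) (mode i))
    -- The graded symmetry of W makes the two contractions equal, hence the factor 2.
    rw [← hW, ← two_mul, inner_mode_right] at h2
    refine (h2.smul_const (vacuum : finPart ι₀ ι₁)).congr_fun fun n => ?_
    rw [ann_ann_cre_cre_mode, inner_twist_left]
  have h3 : HasSum (fun n => ∑ i ∈ s, ∑ j ∈ s, (W (mode i) j : ℂ) • ann (W (e n)) (ann (e n)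
      (cre (mode i) (cre (mode j) vacuum)))) (∑ i ∈ s, ∑ j ∈ s, (W (mode i) j : ℂ) •
        (2 * conj (W (mode i) j : ℂ)) • (vacuum : finPart ι₀ ι₁)) :=
    hasSum_sum fun i _ => hasSum_sum fun j _ => (h1 i j).const_smul _
  convert h3 using 1
  · funext n
    simp only [testVec, map_sum, map_smul]
  · push_cast
    rw [Finset.mul_sum, Finset.sum_smul]
    refine Finset.sum_congr rfl fun i _ => ?_
    rw [Finset.mul_sum, Finset.sum_smul]
    refine Finset.sum_congr rfl fun j _ => ?_
    rw [smul_smul, ← Complex.mul_conj']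
    congr 1; ring

/-- If the pair annihilation series is bounded on the test vectors, its kernel is
Hilbert–Schmidt. -/
theorem modeHS_of_bound {W : OnePart ι₀ ι₁ →L⋆[ℂ] OnePart ι₀ ι₁} {M : ℝ}
    (hM : ∀ s : Finset (ι₀ ⊕ ι₁),
      2 * ∑ i ∈ s, ∑ j ∈ s, ‖W (mode i) j‖ ^ 2 ≤ M * ‖testVec W s‖) : ModeHS W := by
  refine modeHS_of_sum_le (M := M ^ 2) fun s => ?_
  have h1 := hM s
  have h2 := norm_testVec_sq_le W s
  have h3 : 0 ≤ ∑ i ∈ s, ∑ j ∈ s, ‖W (mode i) j‖ ^ 2 := by positivity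
  set Q := ∑ i ∈ s, ∑ j ∈ s, ‖W (mode i) j‖ ^ 2
  -- From 2Q ≤ M‖t‖ and ‖t‖² ≤ 2Q: since M‖t‖ ≤ (M² + ‖t‖²)/2 ≤ M²/2 + Q, it follows that Q ≤ M²/2.
  nlinarith [sq_nonneg (M - ‖testVec W s‖), sq_nonneg (M + ‖testVec W s‖), sq_nonneg M]

/-- Pair creation at the vacuum forces the kernel to be Hilbert–Schmidt. -/
theorem modeHS_of_tendsto (e : HilbertBasis ℕ ℂ (OnePart ι₀ ι₁))
    {K : OnePart ι₀ ι₁ →L⋆[ℂ] OnePart ι₀ ι₁}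
    (hK : ∀ i v, ⟪mode i, K v⟫_ℂ = ⟪v, twist (modeDeg i) (K (mode i))⟫_ℂ) {Ψ : Fock ι₀ ι₁}
    (hΨ : Tendsto (fun N => ((∑ n ∈ Finset.range N, cre (K (e n)) (cre (e n) vacuum) :
      finPart ι₀ ι₁) : Fock ι₀ ι₁)) atTop (𝓝 Ψ)) : ModeHS K := by
  have hsec : ∀ N, (∑ n ∈ Finset.range N, cre (K (e n)) (cre (e n) vacuum) : finPart ι₀ ι₁).1
      ∈ sector ι₀ ι₁ 2 := fun N =>
    sum_mem_sector fun n _ => cre_mem_sector _ (cre_mem_sector _ vacuum_mem_sector)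
  have hΨ2 : Ψ ∈ sector ι₀ ι₁ 2 :=
    (isClosed_sector 2).mem_of_tendsto hΨ (Eventually.of_forall hsec)
  let χ : finPart ι₀ ι₁ := ⟨Ψ, mem_finPart_of_mem_sector hΨ2⟩
  have hχ : Tendsto (fun N => (∑ n ∈ Finset.range N, cre (K (e n)) (cre (e n) vacuum) :
      finPart ι₀ ι₁)) atTop (𝓝 χ) := tendsto_subtype_rng.2 hΨ
  -- The two-particle amplitudes of the limit are read off by continuity of aⱼaᵢ on the sector; the
  -- two orders of contraction coincide by the symmetry of K.
  have key : ∀ i j, vacCoeff (ann (mode j) (ann (mode i) χ)) = 2 * K (mode j) i := by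
    intro i j
    have h1 := ((secBdd_ann (mode j)).mul (secBdd_ann (mode i))).tendsto hsec hχ
    have h2 := ((continuous_fock_apply ((0, ∅) : Config ι₀ ι₁)).tendsto _).comp
      ((continuous_subtype_val.tendsto _).comp h1)
    have h3 := ((hasSum_mul_apply e K i j).add
      ((hasSum_mul_apply e K j i).mul_left (modeSign (modeDeg i) j))).tendsto_sum_nat
    have h4 : modeSign (modeDeg i) j * K (mode i) j = K (mode j) i := by
      have := hK i (mode j)
      rw [inner_mode_left, inner_mode_left, twist_apply] at this
      exact this.symm
    rw [h4, ← two_mul] at h3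
    refine tendsto_nhds_unique h2 (h3.congr fun N => ?_)
    change _ = vacCoeff ((ann (mode j) * ann (mode i))
      (∑ n ∈ Finset.range N, cre (K (e n)) (cre (e n) vacuum)))
    have h5 : ∀ (s : Finset ℕ) (x : ℕ → finPart ι₀ ι₁),
        vacCoeff (∑ n ∈ s, x n) = ∑ n ∈ s, vacCoeff (x n) := fun s x => by
      classical
      induction s using Finset.induction_on with
      | empty => rfl
      | insert n s hn ih => rw [Finset.sum_insert hn, Finset.sum_insert hn, vacCoeff_add, ih]
    rw [map_sum, h5]
    refine Finset.sum_congr rfl fun n _ => ?_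
    rw [Module.End.mul_apply, vacCoeff_ann_ann_cre_cre]
  have hm := (orthonormal_mode (ι₀ := ι₀) (ι₁ := ι₁)).isBessel
  -- The number bound with N = 2 is used once for each of the two annihilators.
  refine modeHS_of_sum_le (M := 2 * (2 * ‖χ‖ ^ 2)) fun s => ?_
  rw [Finset.sum_comm]
  calc ∑ i ∈ s, ∑ j ∈ s, ‖K (mode j) i‖ ^ 2
      ≤ ∑ i ∈ s, ∑ j ∈ s, ‖ann (mode j) (ann (mode i) χ)‖ ^ 2 := by
        gcongr with i _ j _
        refine le_trans ?_ (norm_vacCoeff_le _)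
        rw [key, norm_mul]
        have : ‖(2 : ℂ)‖ = 2 := by simp
        rw [this]; linarith [norm_nonneg (K (mode j) i)]
    _ ≤ ∑ i ∈ s, 1 * ((2 : ℕ) * ‖ann (mode i) χ‖ ^ 2) := by
        gcongr with i _
        exact sum_norm_ann_sq_le hm zero_le_one (ann_mem_sector _ hΨ2) s
    _ = 2 * ∑ i ∈ s, ‖ann (mode i) χ‖ ^ 2 := by
        rw [Finset.mul_sum]; simp
    _ ≤ 2 * (2 * ‖χ‖ ^ 2) := by
        gcongr
        simpa only [one_mul, Nat.cast_ofNat] using sum_norm_ann_sq_le hm zero_le_one (φ := χ) hΨ2 s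

end Fock

/-! ### Necessity of the Hilbert–Schmidt conditions. -/

namespace NeutralSystem

namespace ModeBasis

/-- Uniform boundedness principle on a sector, which is complete: the partial sums are bounded there
and converge pointwise. -/
theorem exists_bound_of_seriesAt {ι₀ ι₁ : Type*} {T : ℕ → Module.End ℂ (finPart ι₀ ι₁)}
    (hT : ∀ n, SecBdd (T n)) (N : ℕ) (h : ∀ φ : finPart ι₀ ι₁, ∃ ψ, SeriesAt T φ ψ) :
    ∃ M : ℝ, ∀ (φ : finPart ι₀ ι₁) (ψ : Fock ι₀ ι₁), φ.1 ∈ sector ι₀ ι₁ N → SeriesAt T φ ψ →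
      ‖ψ‖ ≤ M * ‖φ‖ := by
  have : CompleteSpace (sector ι₀ ι₁ N) := (isClosed_sector N).completeSpace_coe
  let L : ℕ → sector ι₀ ι₁ N →L[ℂ] Fock ι₀ ι₁ := fun n =>
    LinearMap.mkContinuousOfExistsBound ((finPart ι₀ ι₁).subtype ∘ₗ (∑ k ∈ Finset.range n, T k)
      ∘ₗ Submodule.inclusion fun _ => mem_finPart_of_mem_sector) (by
        obtain ⟨M, C, hC⟩ := SecBdd.sum (Finset.range n) hT N
        exact ⟨C, fun φ => (hC _ φ.2).2⟩)
  obtain ⟨M, hM⟩ := banach_steinhaus (g := L) fun φ => by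
    obtain ⟨ψ, hψ⟩ := h ⟨φ.1, mem_finPart_of_mem_sector φ.2⟩
    obtain ⟨C, hC⟩ := hψ.norm.bddAbove_range
    exact ⟨C, fun n => hC ⟨n, rfl⟩⟩
  refine ⟨M, fun φ ψ hφ hψ => le_of_tendsto hψ.norm (Eventually.of_forall fun n => ?_)⟩
  exact (L n).le_of_opNorm_le (hM n) ⟨φ.1, hφ⟩

variable {h : Type*} [NormedAddCommGroup h] [InnerProductSpace ℂ h] [CompleteSpace h]
variable {S : NeutralSystem h} {ι₀ ι₁ : Type*} [LinearOrder ι₁] (b : S.ModeBasis ι₀ ι₁)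

theorem modeHS_kernCC_of_series {X : h →L[ℂ] h} (hX : S.IsSelfDual X) {C : S.HalfConj}
    {e : HilbertBasis ℕ ℂ S.half} {Ψ : Fock ι₀ ι₁}
    (hΨ : b.QuadDagDag C e (compDagDag C X) vacuum Ψ) : ModeHS (b.kernCC X) := by
  rw [quadDagDag_eq] at hΨ
  refine modeHS_of_tendsto (b.coordBasis (C.mapBasis e))
    (fun i v => b.kernCC_symm hX (isHom_mode i) v) (hΨ.congr fun N => ?_)
  rw [LinearMap.sum_apply]; rfl

theorem seriesAt_kernAA_testVec {X : h →L[ℂ] h} (hX : S.IsSelfDual X) (C : S.HalfConj)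
    (e : HilbertBasis ℕ ℂ S.half) (s : Finset (ι₀ ⊕ ι₁)) :
    b.QuadAA C e (compAA C X) (testVec (b.kernAA X) s)
      ((((2 * ∑ i ∈ s, ∑ j ∈ s, ‖b.kernAA X (mode i) j‖ ^ 2 : ℝ) : ℂ)) • vacuum :
        finPart ι₀ ι₁) := by
  rw [quadAA_eq]
  exact seriesAt_of_hasSum (hasSum_ann_ann_testVec (b.coordBasis e)
    (fun i v => b.kernAA_symm hX (isHom_mode i) v) s)

theorem memG₂_of_currentDefined {X : h →L[ℂ] h} (hX : S.IsSelfDual X) {C : S.HalfConj}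
    {e : HilbertBasis ℕ ℂ S.half} (hc : b.CurrentDefined C e X) : S.MemG₂ X := by
  refine ⟨hX, (b.modeHS_kernCC_iff X).1 ?_, (b.modeHS_kernAA_iff X).1 ?_⟩
  · obtain ⟨-, -, Ψ, -, -, hΨ, -⟩ := hc vacuum
    exact b.modeHS_kernCC_of_series hX hΨ
  · obtain ⟨M, hM⟩ := exists_bound_of_seriesAt
      (T := fun n => ann (b.kernAA X (b.coordBasis e n)) * ann (b.coordBasis e n))
      (fun n => (secBdd_ann _).mul (secBdd_ann _)) 2 fun φ => by
        obtain ⟨-, -, -, Ψ, -, -, hΨ, -⟩ := hc φ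
        rw [quadAA_eq] at hΨ
        exact ⟨Ψ, hΨ⟩
    refine modeHS_of_bound (M := M) fun s => ?_
    have h1 := b.seriesAt_kernAA_testVec hX C e s
    rw [quadAA_eq] at h1
    have h2 := hM _ _ (testVec_mem_sector _ s) h1
    rw [Submodule.coe_smul, norm_smul, Complex.norm_real, Real.norm_of_nonneg (by positivity)]
      at h2
    rwa [show ‖(vacuum : finPart ι₀ ι₁).1‖ = 1 from norm_vacuum, mul_one] at h2

theorem testVec_mem_algSpan (W : OnePart ι₀ ι₁ →L⋆[ℂ] OnePart ι₀ ι₁) (s : Finset (ι₀ ⊕ ι₁)) :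
    testVec W s ∈ b.algSpan := by
  have h0 : ∀ i, cre (mode i) = b.aDag (b.basis i) := fun i => by
    classical
    rw [aDag, HilbertBasis.repr_self, mode]
    congr
    exact Subsingleton.elim _ _
  refine Submodule.sum_mem _ fun i _ => ?_
  rw [map_sum]
  refine Submodule.sum_mem _ fun j _ => ?_
  rw [map_smul, map_smul]
  refine Submodule.smul_mem _ _ (Submodule.subset_span ⟨[b.basis i, b.basis j], ?_⟩)
  simp [h0]

theorem vacuum_mem_algSpan : vacuum ∈ b.algSpan :=
  Submodule.subset_span ⟨[], rfl⟩

/-- Convergence at the vacuum already settles the a†a† kernel. For aa, the uniform boundedness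
argument relies on completeness of the sectors and is not used on the algebraic span. Instead, an aa
kernel that is not Hilbert–Schmidt yields a sequence tending to 0 in the domain whose images tend to
-½Ω, contrary to closability. -/
theorem memG₂_of_currentClosable {X : h →L[ℂ] h} (hX : S.IsSelfDual X) {C : S.HalfConj}
    {e : HilbertBasis ℕ ℂ S.half} (hc : b.CurrentClosable C e X) : S.MemG₂ X := by
  obtain ⟨T, hdom, ⟨T', hT'⟩, hT⟩ := hc
  have hmem : ∀ φ ∈ b.algSpan, (φ : Fock ι₀ ι₁) ∈ T.domain := fun φ hφ => by
    rw [hdom]; exact ⟨φ, hφ, rfl⟩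
  have hCC : ModeHS (b.kernCC X) := by
    obtain ⟨-, Ψ, -, -, hΨ, -⟩ := hT _ (hmem _ b.vacuum_mem_algSpan)
    exact b.modeHS_kernCC_of_series hX hΨ
  have hPX := (b.modeHS_kernCC_iff X).1 hCC
  refine ⟨hX, hPX, (b.modeHS_kernAA_iff X).1 ?_⟩
  by_contra hAA
  set W := b.kernAA X with hW
  -- Otherwise the pair annihilation values would be bounded by (n + 1)‖t‖ on all test vectors t,
  -- and `modeHS_of_bound` would apply.
  have hs : ∀ n : ℕ, ∃ s : Finset (ι₀ ⊕ ι₁),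
      ((n : ℝ) + 1) * ‖testVec W s‖ < 2 * ∑ i ∈ s, ∑ j ∈ s, ‖W (mode i) j‖ ^ 2 := fun n => by
    by_contra! hn
    exact hAA (modeHS_of_bound hn)
  choose s hs using hs
  let Q : ℕ → ℝ := fun n => 2 * ∑ i ∈ s n, ∑ j ∈ s n, ‖W (mode i) j‖ ^ 2
  have hQ : ∀ n, 0 < Q n := fun n => lt_of_le_of_lt (by positivity) (hs n)
  -- Normalized so that pair annihilation sends each vector exactly to Ω; by the choice of the sets
  -- its norm is then at most 1/(n + 1).
  let x : ℕ → finPart ι₀ ι₁ := fun n => ((Q n)⁻¹ : ℂ) • testVec W (s n)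
  have hx2 : ∀ n, (x n).1 ∈ sector ι₀ ι₁ 2 := fun n =>
    (sector ι₀ ι₁ 2).smul_mem _ (testVec_mem_sector _ _)
  have hxa : ∀ n, x n ∈ b.algSpan := fun n => b.algSpan.smul_mem _ (b.testVec_mem_algSpan _ _)
  have hx0 : Tendsto x atTop (𝓝 0) := by
    refine squeeze_zero_norm (fun n => ?_) tendsto_one_div_add_atTop_nhds_zero_nat
    have h1 : ‖x n‖ = (Q n)⁻¹ * ‖testVec W (s n)‖ := by
      rw [norm_smul, norm_inv, Complex.norm_real, Real.norm_of_nonneg (hQ n).le]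
    rw [h1, inv_mul_le_iff₀ (hQ n), mul_one_div, le_div_iff₀ (by positivity), mul_comm]
    exact (hs n).le
  have hval : ∀ n, T ⟨x n, hmem _ (hxa n)⟩ = (quadCA (b.kernCA X) (x n)
      + (1 / 2 : ℂ) • quadCC (b.kernCC X) (x n) - (1 / 2 : ℂ) • vacuum : finPart ι₀ ι₁) := by
    intro n
    obtain ⟨ψ₁, ψ₂, ψ₃, h1, h2, h3, h4⟩ := hT _ (hmem _ (hxa n))
    rw [quadDagA_eq] at h1
    rw [quadDagDag_eq] at h2
    rw [h4, tendsto_nhds_unique h1 (seriesAt_of_hasSum (hasSum_quadCA _ _ _)),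
      tendsto_nhds_unique h2 (seriesAt_of_hasSum (hasSum_quadCC _ hCC
        (b.summable_kernCC_coordBasis hPX _) _))]
    have h5 : ψ₃ = (vacuum : finPart ι₀ ι₁).1 := by
      have h6 := (b.seriesAt_kernAA_testVec hX C e (s n)).const_smul ((Q n)⁻¹ : ℂ)
      have h7 : ((Q n)⁻¹ : ℂ) • ((Q n : ℂ) • (vacuum : finPart ι₀ ι₁)).1
          = (vacuum : finPart ι₀ ι₁).1 := by
        rw [Submodule.coe_smul, smul_smul, inv_mul_cancel₀ (by exact_mod_cast (hQ n).ne'), one_smul]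
      rw [← h7]
      refine tendsto_nhds_unique h3 (h6.congr fun N => ?_)
      rw [← Submodule.coe_smul, ← map_smul]
    rw [h5]; rfl
  have hlim : Tendsto (fun n => T ⟨x n, hmem _ (hxa n)⟩) atTop
      (𝓝 (-((1 / 2 : ℂ) • vacuum) : finPart ι₀ ι₁).1) := by
    -- The a†a and a†a† parts are bounded on the two-particle sector, so they vanish in the limit
    -- and only the constant -½Ω survives.
    have h1 := (goodSeries_quadCA (b.kernCA X)).secBdd.tendsto hx2 hx0
    have h2 := ((goodSeries_quadCC hCC).secBdd.tendsto hx2 hx0).const_smul (1 / 2 : ℂ)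
    have h3 := (h1.add h2).sub_const ((1 / 2 : ℂ) • (vacuum : finPart ι₀ ι₁))
    rw [map_zero, map_zero, smul_zero, add_zero, zero_sub] at h3
    exact ((continuous_subtype_val.tendsto _).comp h3).congr fun n => (hval n).symm
  have hcl : ((0 : Fock ι₀ ι₁), (-((1 / 2 : ℂ) • vacuum) : finPart ι₀ ι₁).1)
      ∈ T.graph.topologicalClosure := by
    refine mem_closure_of_tendsto (((continuous_subtype_val.tendsto _).comp hx0).prodMk_nhds hlim)
      (Eventually.of_forall fun n => T.mem_graph ⟨x n, hmem _ (hxa n)⟩)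
  rw [hT'] at hcl
  have h1 := T'.graph_fst_eq_zero_snd hcl rfl
  have h2 : vacCoeff (-((1 / 2 : ℂ) • vacuum) : finPart ι₀ ι₁) = 0 := by
    rw [vacCoeff, h1]; rfl
  rw [← neg_one_smul ℂ, vacCoeff_smul, vacCoeff_smul, vacCoeff_vacuum] at h2
  norm_num at h2

end ModeBasis

end NeutralSystem

end

/-- Since `dΓ` is chosen before the conjugation and the basis of the series, and limits in Fock
space are unique, independence of both is part of the statement; invariance of the finite-particle
space is part of the type of `dΓ`. -/
theorem proposition1 {h : Type*} [NormedAddCommGroup h] [InnerProductSpace ℂ h] [CompleteSpace h]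
    (S : NeutralSystem h) {ι₀ ι₁ : Type*} [LinearOrder ι₁] (b : S.ModeBasis ι₀ ι₁) :
    (∀ X : h →L[ℂ] h, S.IsSelfDual X →
      ∀ (C : S.HalfConj) (e : HilbertBasis ℕ ℂ S.half),
        (b.CurrentDefined C e X ↔ S.MemG₂ X) ∧ (b.CurrentClosable C e X ↔ S.MemG₂ X)) ∧
    ∃ dΓ : (h →L[ℂ] h) → Module.End ℂ (finPart ι₀ ι₁),
      (∀ X, S.MemG₂ X →
        ∀ (C : S.HalfConj) (e : HilbertBasis ℕ ℂ S.half) (φ : finPart ι₀ ι₁),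
          b.Current C e X φ (dΓ X φ)) ∧
      (∀ X, S.MemG₂ X → ∀ f : h, superComm fockEven (dΓ X) (b.BDag f) = b.BDag (X f)) ∧
      (∀ X Y, S.MemG₂ X → S.MemG₂ Y →
        S.MemG₂ (superComm S.P₀ X Y) ∧
        ∃ c : ℂ, S.HasStr (S.schwingerOp X Y) c ∧
          superComm fockEven (dΓ X) (dΓ Y) = dΓ (superComm S.P₀ X Y) - (c / 2) • 1) := by
  refine ⟨fun X hX C e =>
    ⟨⟨b.memG₂_of_currentDefined hX, fun hX₂ => b.currentDefined_of_memG₂ hX₂ C e⟩,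
      ⟨b.memG₂_of_currentClosable hX, fun hX₂ => b.currentClosable_of_memG₂ hX₂ C e⟩⟩, b.dGamma,
    fun X hX C e φ => b.current_dGamma hX C e φ, fun X hX f => b.superComm_dGamma_BDag hX f,
    fun X Y hX hY => ⟨hX.superComm hY, b.exists_superComm_dGamma hX hY⟩⟩
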